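/- Let $n\ge 1$. A cube is a cube in $\mathbb R^n$ with sides parallel to the axes, and $Mf(x)=\sup_{Q\ni x}\frac1{|Q|}\int_Q|f|$ is the Hardy--Littlewood maximal function, the supremum being over all cubes containing $x$. A weight is a locally integrable function $w$ with $0<w<\infty$ a.e.; $w(E)=\int_E w$. For $q>1$, $A_q$ is the class of weights with $$[w]_{A_q}=\sup_Q\Big(\frac1{|Q|}\int_Q w\Big)\Big(\frac1{|Q|}\int_Q w^{1-q'}\Big)^{q-1}<\infty,\qquad \tfrac1q+\tfrac1{q'}=1,$$ $A_\infty=\bigcup_{q>1}A_q$, and $[w]_{A_\infty}=\sup_Q\frac1{w(Q)}\int_Q M(w\chi_Q)$. A weight $u$ is in $A_1$ if $Mu\le Cu$ a.e. for some finite $C$, and $[u]_{A_1}$ is the least such $C$. For $q\ge1$, $\widehat A_{q,2}$ is the class of weights $w$ that can be written a.e. as $w=u_0(Mh_1)^{\beta(1-q)}(Mh_2)^{(1-\beta)(1-q)}$ with $0\le\beta\le1$, $u_0\in A_1$, $h_1,h_2\in L^1_{loc}(\mathbb R^n)$, and $[w]_{\widehat A_{q,2}}$ is the infimum of $[u_0]_{A_1}^{1/q}$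 over all such representations. Finally $\|g\|_{L^{q,\infty}(W)}=\sup_{t>0}t\,W(\{|g|>t\})^{1/q}$. Let $\mathcal F$ be a family of pairs $(f_1,f_2)$ of measurable functions on $\mathbb R^n$ with values in $[0,\infty]$, let $0<p_0<\infty$, let $\varphi:[0,\infty)\to[0,\infty)$ be increasing (in the weak sense), and suppose that for every $w\in A_\infty$ $$\int_{\mathbb R^n} f_1^{p_0}\,w\,dx\le\varphi([w]_{A_\infty})\int_{\mathbb R^n} f_2^{p_0}\,w\,dx$$ for all $(f_1,f_2)\in\mathcal F$ for which the left-hand side is finite. Let $\mathcal F_0$ be the set of the pairs $(f_1,f_2)\in\mathcal F$ for which the left-hand side is finite for at least one $w\in A_\infty$ (for the other pairs nothing is assumed). Let $q\ge1$. (i) For every $u\in A_\infty$ and every $v$ with $v^q\in A_\infty$ there is a finite constant $C(u,v)$ such that $$\|f_1v^{-1}\|_{L^{q,\infty}(uv^q)}\le C(u,v)\,\|f_2v^{-1}\|_{L^{q,\infty}(uv^q)}\qquad\text{for all }(f_1,f_2)\in\mathcal F_0.$$ (ii) For every $\alpha>0$ there is an increasing function $\phi:[0,\infty)\to[0,\infty)$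 such that, whenever $u\in\widehat A_{q,2}$ and $v=(Mh)^{-\alpha}$ with $h\in L^1_{loc}(\mathbb R^n)$, the inequality in (i) holds for all $(f_1,f_2)\in\mathcal F_0$ with $C(u,v)=\phi([u]_{\widehat A_{q,2}})$; thus $\phi$ does not depend on $u$ or $h$. -/

import Mathlib

open MeasureTheory
open scoped ENNReal NNReal

namespace Muckenhoupt

noncomputable section

/-- The average of `f` over the cube with centre `c` and side length `2 * r`.
The norm on `Fin n → ℝ` is the sup norm, so `Metric.closedBall c r` with `0 < r` is exactly a closed
cube with sides parallel to the axes, and every such cube is of this form. -/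
def avg {n : ℕ} (c : Fin n → ℝ) (r : ℝ) (f : (Fin n → ℝ) → ℝ≥0∞) : ℝ≥0∞ :=
  (volume (Metric.closedBall c r))⁻¹ * ∫⁻ y in Metric.closedBall c r, f y

/-- The (uncentred) Hardy-Littlewood maximal function of a nonnegative function: the supremum of the
averages over all cubes that contain `x`. -/
def maximal {n : ℕ} (f : (Fin n → ℝ) → ℝ≥0∞) (x : Fin n → ℝ) : ℝ≥0∞ :=
  ⨆ (c : Fin n → ℝ) (r : ℝ) (_ : 0 < r) (_ : x ∈ Metric.closedBall c r), avg c r f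

/-- The Hardy-Littlewood maximal function of a real function. -/
def maximalReal {n : ℕ} (h : (Fin n → ℝ) → ℝ) : (Fin n → ℝ) → ℝ≥0∞ :=
  maximal fun y => ‖h y‖ₑ

/-- A weight: a (Lebesgue) measurable, locally integrable function with values in `(0, ∞)` almost
everywhere. -/
structure IsWeight {n : ℕ} (w : (Fin n → ℝ) → ℝ≥0∞) : Prop where
  aemeasurable : AEMeasurable w volume
  ae_pos : ∀ᵐ x, 0 < w x
  ae_lt_top : ∀ᵐ x, w x < ∞
  locally_integrable : ∀ (c : Fin n → ℝ) (r : ℝ), ∫⁻ y in Metric.closedBall c r, w y < ∞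

/-- The constant `[w]_{A_q}` for `1 < q`; here `1 - q'` is the exponent of the second factor, with
`q' = q / (q - 1)`. -/
def aqConst {n : ℕ} (q : ℝ) (w : (Fin n → ℝ) → ℝ≥0∞) : ℝ≥0∞ :=
  ⨆ (c : Fin n → ℝ) (r : ℝ) (_ : 0 < r),
    avg c r w * (avg c r fun y => w y ^ (1 - q / (q - 1))) ^ (q - 1)

/-- The class `A_q`, for `1 < q`. -/
def IsAq {n : ℕ} (q : ℝ) (w : (Fin n → ℝ) → ℝ≥0∞) : Prop :=
  IsWeight w ∧ aqConst q w < ∞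

/-- The class `A_∞`, the union of the classes `A_q` over `1 < q`. -/
def IsAInfty {n : ℕ} (w : (Fin n → ℝ) → ℝ≥0∞) : Prop :=
  ∃ q : ℝ, 1 < q ∧ IsAq q w

/-- The Fujii-Wilson constant `[w]_{A_∞}`. -/
def aInftyConst {n : ℕ} (w : (Fin n → ℝ) → ℝ≥0∞) : ℝ≥0∞ :=
  ⨆ (c : Fin n → ℝ) (r : ℝ) (_ : 0 < r),
    (∫⁻ y in Metric.closedBall c r, w y)⁻¹ *
      ∫⁻ x in Metric.closedBall c r, maximal ((Metric.closedBall c r).indicator w) x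

/-- The constant `[u]_{A_1}`: the least `C` with `M u ≤ C u` almost everywhere. -/
def a1Const {n : ℕ} (u : (Fin n → ℝ) → ℝ≥0∞) : ℝ≥0∞ :=
  sInf {C : ℝ≥0∞ | ∀ᵐ x, maximal u x ≤ C * u x}

/-- The class `A_1`. -/
def IsA1 {n : ℕ} (u : (Fin n → ℝ) → ℝ≥0∞) : Prop :=
  IsWeight u ∧ a1Const u < ∞

/-- `w = u₀ (M h₁)^{β (1 - q)} (M h₂)^{(1 - β) (1 - q)}` almost everywhere for some `0 ≤ β ≤ 1` and
some locally integrable `h₁`, `h₂`. -/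
def HatFactor {n : ℕ} (q : ℝ) (w u₀ : (Fin n → ℝ) → ℝ≥0∞) : Prop :=
  ∃ (β : ℝ) (h₁ h₂ : (Fin n → ℝ) → ℝ), 0 ≤ β ∧ β ≤ 1 ∧
    LocallyIntegrable h₁ volume ∧ LocallyIntegrable h₂ volume ∧
    ∀ᵐ x, w x = u₀ x * maximalReal h₁ x ^ (β * (1 - q)) * maximalReal h₂ x ^ ((1 - β) * (1 - q))

/-- The class `\widehat A_{q,2}`. -/
def IsHatA2 {n : ℕ} (q : ℝ) (w : (Fin n → ℝ) → ℝ≥0∞) : Prop :=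
  IsWeight w ∧ ∃ u₀ : (Fin n → ℝ) → ℝ≥0∞, IsA1 u₀ ∧ HatFactor q w u₀

/-- The constant `[w]_{\widehat A_{q,2}}`: the infimum of `[u₀]_{A_1}^{1/q}` over all factorizations
of `w` with `u₀ ∈ A_1`. -/
def hatA2Const {n : ℕ} (q : ℝ) (w : (Fin n → ℝ) → ℝ≥0∞) : ℝ≥0∞ :=
  ⨅ (u₀ : (Fin n → ℝ) → ℝ≥0∞) (_ : IsA1 u₀) (_ : HatFactor q w u₀), a1Const u₀ ^ (1 / q)

/-- The quasi-norm of a nonnegative function `g` in `L^{q,∞}(W)`: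
the supremum over `t > 0` of `t * W({g > t})^{1/q}`. -/
def weakNorm {n : ℕ} (q : ℝ) (W g : (Fin n → ℝ) → ℝ≥0∞) : ℝ≥0∞ :=
  ⨆ (t : ℝ≥0) (_ : 0 < t), (t : ℝ≥0∞) * (∫⁻ x in {x | (t : ℝ≥0∞) < g x}, W x) ^ (1 / q)

end

end Muckenhoupt

open Muckenhoupt

/-!
Put `W = u v ^ q`. Extrapolation upgrades the hypothesis to strong-type inequalities with every
exponent `r > 0` and every `A_∞` weight. By Jones' factorization `u = u₀ ω₁ ^ (-a)` and
`v ^ q = v₀ ω₂ ^ (-b)` with `A_1` weights `u₀, ω₁, v₀, ω₂`; in part (ii) the Coifman-Rochberg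
theorem provides such factors with explicit `A_1` constants. The operator `g ↦ M (g u₀) / u₀` is
bounded on `L^∞` and on `L^P(W)` for some large `P`, so, given a set `E ⊆ {f₁ / v > t}`, the Rubio
de Francia iteration of the indicator function of `E` is a bounded function `H ≥ 1_E`, of comparable
size in `L^P(W)`, for which `H u₀` is an `A_1` weight. Then
`H v ^ (-r) W = (H u₀) ω₁ ^ (-a) (v ^ q) ^ ε` with `r = q (1 - ε)`, and for small `ε` this is an
`A_∞` weight with controlled constants. The strong-type inequality for it bounds `t ^ r W(E)` by
the integral of `(f₂ / v) ^ r H W`, which Hölder's inequality and the layer cake formula bound by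
`W(E) ^ (1 - r / q)` times the `r`-th power of the weak norm of `f₂ / v`.
-/

namespace Muckenhoupt

open Metric Filter Set
open scoped Topology

section LayerCake

variable {α : Type*} [MeasurableSpace α] {ν : Measure α} {f g : α → ℝ≥0∞}

theorem setLIntegral_Ioi_rpow_eq_top (s : ℝ) :
    ∫⁻ t in Ioi (0 : ℝ), ENNReal.ofReal (t ^ s) = ∞ := by
  by_contra hfin
  refine not_integrableOn_Ioi_rpow s ⟨(by fun_prop : Measurable _).aestronglyMeasurable, ?_⟩
  rw [hasFiniteIntegral_iff_ofReal]
  · exact lt_top_iff_ne_top.2 hfin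
  · filter_upwards [ae_restrict_mem measurableSet_Ioi] with t ht
    exact Real.rpow_nonneg (mem_Ioi.1 ht).le _

theorem setLIntegral_Ioi_rpow {b s : ℝ} (hb : 0 < b) (hs : 0 < s) :
    ∫⁻ t in Ioi s, ENNReal.ofReal (t ^ (-b - 1)) = ENNReal.ofReal (s ^ (-b) / b) := by
  rw [← ofReal_integral_eq_lintegral_ofReal (integrableOn_Ioi_rpow_of_lt (by linarith) hs),
    integral_Ioi_rpow_of_lt (by linarith) hs]
  · rw [sub_add_cancel, neg_div_neg_eq]
  · filter_upwards [ae_restrict_mem measurableSet_Ioi] with t ht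
    exact Real.rpow_nonneg (hs.trans (mem_Ioi.1 ht)).le _

theorem setLIntegral_Ioo_rpow {b s : ℝ} (hb : 0 < b) (hs : 0 ≤ s) :
    ∫⁻ t in Ioo 0 s, ENNReal.ofReal (t ^ (b - 1)) = ENNReal.ofReal (s ^ b / b) := by
  have hint : IntegrableOn (fun t : ℝ => t ^ (b - 1)) (Ioc 0 s) :=
    (intervalIntegrable_iff_integrableOn_Ioc_of_le hs).1
      (intervalIntegral.intervalIntegrable_rpow' (by linarith))
  rw [setLIntegral_congr Ioo_ae_eq_Ioc, ← ofReal_integral_eq_lintegral_ofReal hint,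
    ← intervalIntegral.integral_of_le hs, integral_rpow (Or.inl (by linarith)), sub_add_cancel,
    Real.zero_rpow hb.ne', sub_zero]
  filter_upwards [ae_restrict_mem measurableSet_Ioc] with t ht
  exact Real.rpow_nonneg ht.1.le _

theorem lintegral_rpow_eq_lintegral_meas_ofReal_lt (hg : AEMeasurable g ν) {p : ℝ} (hp : 0 < p) :
    ∫⁻ x, g x ^ p ∂ν =
      ∫⁻ t in Ioi (0 : ℝ), ENNReal.ofReal (p * t ^ (p - 1)) * ν {x | ENNReal.ofReal t < g x} := by
  by_cases htop : ν {x | g x = ∞} = 0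
  · have hfin : ∀ᵐ x ∂ν, g x ≠ ∞ := ae_iff.2 (by simpa only [not_not] using htop)
    have hreal : ∀ᵐ x ∂ν, g x ^ p = ENNReal.ofReal ((g x).toReal ^ p) := by
      filter_upwards [hfin] with x hx
      rw [ENNReal.toReal_rpow, ENNReal.ofReal_toReal (ENNReal.rpow_ne_top_of_nonneg hp.le hx)]
    rw [lintegral_congr_ae hreal, lintegral_rpow_eq_lintegral_meas_lt_mul ν
      (Eventually.of_forall fun _ => ENNReal.toReal_nonneg) hg.ennreal_toReal hp,
      ← lintegral_const_mul' _ _ ENNReal.ofReal_ne_top]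
    refine setLIntegral_congr_fun measurableSet_Ioi fun t ht => ?_
    have hset : ν {x | t < (g x).toReal} = ν {x | ENNReal.ofReal t < g x} := by
      refine measure_congr ?_
      filter_upwards [hfin] with x hx
      exact propext (ENNReal.ofReal_lt_iff_lt_toReal (mem_Ioi.1 ht).le hx).symm
    simp only [hset, ENNReal.ofReal_mul hp.le, mul_assoc, mul_comm (ν _)]
  · have hp_top : ν {x | g x ^ p = ∞} ≠ 0 := by
      simpa only [ENNReal.rpow_eq_top_iff_of_pos hp] using htop
    rw [lintegral_eq_top_of_measure_eq_top_ne_zero (hg.pow_const p) hp_top, eq_comm, eq_top_iff]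
    calc ∞ = ∫⁻ t in Ioi (0 : ℝ), ENNReal.ofReal p * ν {x | g x = ∞} *
          ENNReal.ofReal (t ^ (p - 1)) := by
          rw [lintegral_const_mul _ (by fun_prop), setLIntegral_Ioi_rpow_eq_top,
            ENNReal.mul_top (mul_ne_zero (by simpa using hp) htop)]
      _ ≤ _ := by
          refine lintegral_mono fun t => ?_
          rw [ENNReal.ofReal_mul hp.le, mul_right_comm]
          gcongr
          exact fun hx => hx ▸ ENNReal.ofReal_lt_top

theorem lintegral_rpow_le_of_meas_lt_le_rpow (hg : AEMeasurable g ν) {p a₁ a₂ : ℝ} (hp : 0 < p)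
    (ha₁ : a₁ < p) (ha₂ : p < a₂) {C₁ C₂ : ℝ≥0∞}
    (hC₁ : ∀ t : ℝ, 0 < t → ν {x | ENNReal.ofReal t < g x} ≤ C₁ * ENNReal.ofReal (t ^ (-a₁)))
    (hC₂ : ∀ t : ℝ, 0 < t → ν {x | ENNReal.ofReal t < g x} ≤ C₂ * ENNReal.ofReal (t ^ (-a₂)))
    {s : ℝ} (hs : 0 < s) :
    ∫⁻ x, g x ^ p ∂ν ≤ C₁ * ENNReal.ofReal (p / (p - a₁) * s ^ (p - a₁)) +
      C₂ * ENNReal.ofReal (p / (a₂ - p) * s ^ (p - a₂)) := by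
  have hintegrand : ∀ (C : ℝ≥0∞) (a t : ℝ), 0 < t →
      ENNReal.ofReal (p * t ^ (p - 1)) * (C * ENNReal.ofReal (t ^ (-a))) =
        C * ENNReal.ofReal p * ENNReal.ofReal (t ^ (p - a - 1)) := fun C a t ht => by
    rw [mul_left_comm, mul_assoc, ← ENNReal.ofReal_mul (by positivity), ← ENNReal.ofReal_mul hp.le,
      mul_assoc, ← Real.rpow_add ht]
    ring_nf
  rw [lintegral_rpow_eq_lintegral_meas_ofReal_lt hg hp, ← Ioo_union_Ici_eq_Ioi hs]
  refine (lintegral_union_le _ _ _).trans (add_le_add ?_ ?_)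
  · calc _ ≤ ∫⁻ t in Ioo 0 s, C₁ * ENNReal.ofReal p * ENNReal.ofReal (t ^ (p - a₁ - 1)) :=
          setLIntegral_mono' measurableSet_Ioo fun t ht =>
            (mul_le_mul_right (hC₁ t ht.1) _).trans_eq (hintegrand C₁ a₁ t ht.1)
      _ = _ := by
          rw [lintegral_const_mul _ (by fun_prop), setLIntegral_Ioo_rpow (by linarith) hs.le,
            mul_assoc, ← ENNReal.ofReal_mul hp.le]
          ring_nf
  · calc _ = _ := setLIntegral_congr Ioi_ae_eq_Ici.symm
      _ ≤ ∫⁻ t in Ioi s, C₂ * ENNReal.ofReal p * ENNReal.ofReal (t ^ (p - a₂ - 1)) :=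
          setLIntegral_mono' measurableSet_Ioi fun t ht =>
            (mul_le_mul_right (hC₂ t (hs.trans ht)) _).trans_eq (hintegrand C₂ a₂ t (hs.trans ht))
      _ = _ := by
          rw [lintegral_const_mul _ (by fun_prop), ← neg_sub a₂ p,
            setLIntegral_Ioi_rpow (by linarith) hs, mul_assoc, ← ENNReal.ofReal_mul hp.le]
          ring_nf

theorem lintegral_rpow_le_add_lintegral_rpow {β : Type*} [MeasurableSpace β] {ρ : Measure β}
    {h : β → ℝ≥0∞} (hg : AEMeasurable g ν) (hh : AEMeasurable h ρ) {δ a : ℝ} (hδ : 0 < δ)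
    (ha : 0 < a) {C : ℝ≥0∞} (hC : C ≠ ∞) (hlevel : ∀ t : ℝ, a ≤ t → ν {x | ENNReal.ofReal t < g x} ≤
      C * ENNReal.ofReal t * ρ {x | ENNReal.ofReal t < h x}) :
    ∫⁻ x, g x ^ δ ∂ν ≤
      ν univ * ENNReal.ofReal a ^ δ + C * ENNReal.ofReal δ * ∫⁻ x, h x ^ (1 + δ) ∂ρ := by
  rw [lintegral_rpow_eq_lintegral_meas_ofReal_lt hg hδ, ← Ioo_union_Ici_eq_Ioi ha]
  refine (lintegral_union_le _ _ _).trans (add_le_add ?_ ?_)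
  · calc ∫⁻ t in Ioo 0 a, ENNReal.ofReal (δ * t ^ (δ - 1)) * ν {x | ENNReal.ofReal t < g x}
        ≤ ∫⁻ t in Ioo 0 a, ν univ * ENNReal.ofReal δ * ENNReal.ofReal (t ^ (δ - 1)) := by
          refine setLIntegral_mono' measurableSet_Ioo fun t _ => ?_
          rw [ENNReal.ofReal_mul hδ.le, mul_comm, ← mul_assoc]
          gcongr
          exact subset_univ _
      _ = ν univ * ENNReal.ofReal a ^ δ := by
          rw [lintegral_const_mul _ (by fun_prop), setLIntegral_Ioo_rpow hδ ha.le, mul_assoc,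
            ← ENNReal.ofReal_mul hδ.le, mul_div_cancel₀ _ hδ.ne', ENNReal.ofReal_rpow_of_pos ha]
  · have hcoeff : ∀ t : ℝ, 0 < t → ENNReal.ofReal (δ * t ^ (δ - 1)) * (C * ENNReal.ofReal t) ≤
        C * ENNReal.ofReal δ * ENNReal.ofReal ((1 + δ) * t ^ (1 + δ - 1)) := fun t ht => by
      rw [mul_left_comm, mul_assoc, ← ENNReal.ofReal_mul (by positivity),
        ← ENNReal.ofReal_mul hδ.le, add_sub_cancel_left, mul_assoc, ← Real.rpow_add_one ht.ne',
        sub_add_cancel]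
      gcongr
      exact le_mul_of_one_le_left (by positivity) (by linarith)
    rw [lintegral_rpow_eq_lintegral_meas_ofReal_lt hh (by linarith : 0 < 1 + δ),
      ← lintegral_const_mul' _ _ (by finiteness)]
    refine (setLIntegral_mono' measurableSet_Ici fun t (hat : a ≤ t) => ?_).trans
      (lintegral_mono_set fun t hat => ha.trans_le hat)
    calc _ ≤ ENNReal.ofReal (δ * t ^ (δ - 1)) *
          (C * ENNReal.ofReal t * ρ {x | ENNReal.ofReal t < h x}) := by
          gcongr
          exact hlevel t hat
      _ ≤ C * ENNReal.ofReal δ * ENNReal.ofReal ((1 + δ) * t ^ (1 + δ - 1)) *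
          ρ {x | ENNReal.ofReal t < h x} := by
          rw [← mul_assoc]
          gcongr ?_ * _
          exact hcoeff t (ha.trans_le hat)
      _ = _ := mul_assoc _ _ _

theorem lintegral_rpow_le_of_meas_lt_le_withDensity (hf : AEMeasurable f ν)
    (hg : AEMeasurable g ν) {p : ℝ} (hp : 1 < p) {D : ℝ≥0}
    (hweak : ∀ t : ℝ, 0 < t → ν {x | ENNReal.ofReal t < g x} ≤
      D * ENNReal.ofReal t⁻¹ * ν.withDensity f {x | ENNReal.ofReal t < f x}) :
    ∫⁻ x, g x ^ p ∂ν ≤ D * ENNReal.ofReal (p / (p - 1)) * ∫⁻ x, f x ^ p ∂ν := by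
  have hp0 : 0 < p := by linarith
  have hp1 : 0 < p - 1 := by linarith
  have hdensity : ∫⁻ x, f x ^ (p - 1) ∂ν.withDensity f = ∫⁻ x, f x ^ p ∂ν := by
    rw [lintegral_withDensity_eq_lintegral_mul₀ hf (hf.pow_const _)]
    refine lintegral_congr fun x => ?_
    have hsplit := ENNReal.rpow_add_of_nonneg (x := f x) 1 (p - 1) zero_le_one hp1.le
    rwa [add_sub_cancel, ENNReal.rpow_one, eq_comm] at hsplit
  rw [← hdensity, lintegral_rpow_eq_lintegral_meas_ofReal_lt hg hp0,
    lintegral_rpow_eq_lintegral_meas_ofReal_lt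
      (hf.mono_ac (withDensity_absolutelyContinuous _ _)) hp1,
    ← lintegral_const_mul' _ _ (by finiteness)]
  refine setLIntegral_mono' measurableSet_Ioi fun t ht => ?_
  have ht0 : 0 < t := ht
  have hcoef : ENNReal.ofReal (p * t ^ (p - 1)) * ENNReal.ofReal t⁻¹ =
      ENNReal.ofReal (p / (p - 1)) * ENNReal.ofReal ((p - 1) * t ^ (p - 1 - 1)) := by
    rw [← ENNReal.ofReal_mul (by positivity), ← ENNReal.ofReal_mul (by positivity),
      Real.rpow_sub_one ht0.ne' (p - 1)]
    field_simp
  calc _ ≤ ENNReal.ofReal (p * t ^ (p - 1)) *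
        (D * ENNReal.ofReal t⁻¹ * ν.withDensity f {x | ENNReal.ofReal t < f x}) :=
        mul_le_mul_right (hweak t ht0) _
    _ = D * (ENNReal.ofReal (p * t ^ (p - 1)) * ENNReal.ofReal t⁻¹) *
        ν.withDensity f {x | ENNReal.ofReal t < f x} := by ring
    _ = _ := by rw [hcoef]; ring

end LayerCake

section DoublingMeasure

variable {X : Type*} [PseudoMetricSpace X] [MeasurableSpace X] {μ : Measure X} {f g : X → ℝ≥0∞}

/-- The average of `f` over a closed ball with respect to `μ`. -/
noncomputable def ballAvg (μ : Measure X) (c : X) (r : ℝ) (f : X → ℝ≥0∞) : ℝ≥0∞ :=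
  (μ (closedBall c r))⁻¹ * ∫⁻ y in closedBall c r, f y ∂μ

/-- The uncentred Hardy-Littlewood maximal function with respect to `μ`. -/
noncomputable def ballMaximal (μ : Measure X) (f : X → ℝ≥0∞) (x : X) : ℝ≥0∞ :=
  ⨆ (c : X) (r : ℝ) (_ : 0 < r) (_ : x ∈ closedBall c r), ballAvg μ c r f

/-- `μ` is positive and finite on balls, and doubling with constant `D`. The dilation factor is the
one of the Vitali covering lemma. -/
structure IsDoubling (μ : Measure X) (D : ℝ≥0) : Prop where
  pos : ∀ (c : X) (r : ℝ), 0 < r → 0 < μ (closedBall c r)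
  lt_top : ∀ (c : X) (r : ℝ), μ (closedBall c r) < ∞
  le_mul : ∀ (c : X) (r : ℝ), 0 < r → μ (closedBall c (5 * r)) ≤ D * μ (closedBall c r)

theorem ballAvg_le_ballMaximal {c x : X} {r : ℝ} (hr : 0 < r) (hx : x ∈ closedBall c r) :
    ballAvg μ c r f ≤ ballMaximal μ f x :=
  le_iSup_of_le c <| le_iSup_of_le r <| le_iSup_of_le hr <| le_iSup_of_le hx le_rfl

theorem ballMaximal_le {x : X} {A : ℝ≥0∞}
    (h : ∀ (c : X) (r : ℝ), 0 < r → x ∈ closedBall c r → ballAvg μ c r f ≤ A) :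
    ballMaximal μ f x ≤ A :=
  iSup_le fun c => iSup_le fun r => iSup_le fun hr => iSup_le fun hx => h c r hr hx

theorem lt_ballMaximal_iff {x : X} {A : ℝ≥0∞} : A < ballMaximal μ f x ↔
    ∃ (c : X) (r : ℝ), 0 < r ∧ x ∈ closedBall c r ∧ A < ballAvg μ c r f := by
  simp only [ballMaximal, lt_iSup_iff, exists_prop]

theorem ballAvg_mono (h : ∀ᵐ x ∂μ, f x ≤ g x) (c : X) (r : ℝ) :
    ballAvg μ c r f ≤ ballAvg μ c r g :=
  mul_le_mul_right (lintegral_mono_ae (ae_restrict_of_ae h)) _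

theorem ballMaximal_mono (h : ∀ᵐ x ∂μ, f x ≤ g x) (x : X) :
    ballMaximal μ f x ≤ ballMaximal μ g x :=
  ballMaximal_le fun c r hr hx => (ballAvg_mono h c r).trans (ballAvg_le_ballMaximal hr hx)

theorem ballAvg_tsum {F : ℕ → X → ℝ≥0∞} (hF : ∀ k, AEMeasurable (F k) μ) (c : X) (r : ℝ) :
    ballAvg μ c r (fun y => ∑' k, F k y) = ∑' k, ballAvg μ c r (F k) := by
  unfold ballAvg
  rw [lintegral_tsum fun k => (hF k).restrict, ENNReal.tsum_mul_left]

theorem ballAvg_const_mul {a : ℝ≥0∞} (ha : a ≠ ∞) (c : X) (r : ℝ) :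
    ballAvg μ c r (fun y => a * f y) = a * ballAvg μ c r f := by
  unfold ballAvg
  rw [lintegral_const_mul' _ _ ha, mul_left_comm]

theorem ballMaximal_const_mul_le {a : ℝ≥0∞} (ha : a ≠ ∞) (x : X) :
    ballMaximal μ (fun y => a * f y) x ≤ a * ballMaximal μ f x :=
  ballMaximal_le fun c r hr hx => by
    rw [ballAvg_const_mul ha]
    exact mul_le_mul_right (ballAvg_le_ballMaximal hr hx) _

theorem ballMaximal_tsum_const_mul_le {F : ℕ → X → ℝ≥0∞} (hF : ∀ k, AEMeasurable (F k) μ)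
    {a : ℕ → ℝ≥0∞} (ha : ∀ k, a k ≠ ∞) (x : X) :
    ballMaximal μ (fun y => ∑' k, a k * F k y) x ≤ ∑' k, a k * ballMaximal μ (F k) x :=
  ballMaximal_le fun c r hr hx => by
    rw [ballAvg_tsum fun k => (hF k).const_mul _]
    refine ENNReal.tsum_le_tsum fun k => ?_
    rw [ballAvg_const_mul (ha k)]
    exact mul_le_mul_right (ballAvg_le_ballMaximal hr hx) _

theorem IsDoubling.ballAvg_const {D : ℝ≥0} (hμ : IsDoubling μ D) {c : X} {r : ℝ}
    (hr : 0 < r) (a : ℝ≥0∞) : ballAvg μ c r (fun _ => a) = a := by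
  unfold ballAvg
  rw [setLIntegral_const, mul_left_comm, ENNReal.inv_mul_cancel (hμ.pos c r hr).ne'
    (hμ.lt_top c r).ne, mul_one]

theorem IsDoubling.ballMaximal_le_indicator_add {D : ℝ≥0} (hμ : IsDoubling μ D) (t : ℝ≥0∞) (x : X) :
    ballMaximal μ f x ≤ ballMaximal μ ({x | t < f x}.indicator f) x + t := by
  refine ballMaximal_le fun c r hr hx => ?_
  have hsplit : ∀ y, f y ≤ {x | t < f x}.indicator f y + t := fun y => by
    by_cases hy : t < f y
    · rw [indicator_of_mem (s := {x | t < f x}) hy]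
      exact le_self_add
    · exact (not_lt.1 hy).trans le_add_self
  calc ballAvg μ c r f ≤ ballAvg μ c r (fun y => {x | t < f x}.indicator f y + t) :=
        ballAvg_mono (Eventually.of_forall hsplit) c r
    _ = ballAvg μ c r ({x | t < f x}.indicator f) + ballAvg μ c r (fun _ => t) := by
        unfold ballAvg
        rw [lintegral_add_right _ measurable_const, mul_add]
    _ ≤ _ := by
        rw [hμ.ballAvg_const hr]
        gcongr
        exact ballAvg_le_ballMaximal hr hx

variable [OpensMeasurableSpace X]

theorem tendsto_measure_closedBall_nhdsGT (hμ : ∀ (c : X) (r : ℝ), μ (closedBall c r) < ∞) (c : X)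
    (r : ℝ) : Tendsto (fun s => μ (closedBall c s)) (𝓝[>] r) (𝓝 (μ (closedBall c r))) := by
  have hinter : (⋂ s, ⋂ (_ : s > r), closedBall c s) = closedBall c r := by
    ext y
    simp only [mem_iInter, mem_closedBall]
    exact ⟨fun h => le_of_forall_gt_imp_ge_of_dense h, fun h s hs => h.trans hs.le⟩
  rw [← hinter]
  exact tendsto_measure_biInter_gt (fun s _ => measurableSet_closedBall.nullMeasurableSet)
    (fun i j _ hij => closedBall_subset_closedBall hij) ⟨r + 1, by simp, (hμ _ _).ne⟩

theorem lowerSemicontinuous_ballMaximal (hμ : ∀ (c : X) (r : ℝ), μ (closedBall c r) < ∞) :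
    LowerSemicontinuous (ballMaximal μ f) := by
  intro x A hA
  obtain ⟨c, r, hr, hx, hlt⟩ := lt_ballMaximal_iff.1 hA
  have hlim : Tendsto (fun s => (μ (closedBall c s))⁻¹ * ∫⁻ y in closedBall c r, f y ∂μ) (𝓝[>] r)
      (𝓝 (ballAvg μ c r f)) :=
    ENNReal.Tendsto.mul_const (tendsto_measure_closedBall_nhdsGT hμ c r).inv
      (Or.inl (ENNReal.inv_ne_zero.2 (hμ c r).ne))
  obtain ⟨s, hs, hsr⟩ := ((hlim.eventually (lt_mem_nhds hlt)).and self_mem_nhdsWithin).exists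
  have hball : ball c s ∈ 𝓝 x :=
    isOpen_ball.mem_nhds (mem_ball.2 ((mem_closedBall.1 hx).trans_lt hsr))
  filter_upwards [hball] with y hy
  calc A < (μ (closedBall c s))⁻¹ * ∫⁻ y in closedBall c r, f y ∂μ := hs
    _ ≤ ballAvg μ c s f :=
        mul_le_mul_right (lintegral_mono_set (closedBall_subset_closedBall (le_of_lt hsr))) _
    _ ≤ ballMaximal μ f y := ballAvg_le_ballMaximal (hr.trans hsr) (ball_subset_closedBall hy)

theorem IsDoubling.measurable_ballMaximal {D : ℝ≥0} (hμ : IsDoubling μ D) :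
    Measurable (ballMaximal μ f) :=
  (lowerSemicontinuous_ballMaximal hμ.lt_top).measurable

variable [SecondCountableTopology X]

theorem IsDoubling.measure_biUnion_closedBall_le {D : ℝ≥0} (hμ : IsDoubling μ D) {ι : Type*}
    (t : Set ι) (c : ι → X) (r : ι → ℝ) (R : ℝ) (hr : ∀ i ∈ t, 0 < r i) (hR : ∀ i ∈ t, r i ≤ R)
    (ν : Measure X) (hν : ∀ i ∈ t, μ (closedBall (c i) (r i)) ≤ ν (closedBall (c i) (r i))) :
    μ (⋃ i ∈ t, closedBall (c i) (r i)) ≤ D * ν univ := by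
  obtain ⟨u, hut, hdisj, hcov⟩ :=
    Vitali.exists_disjoint_subfamily_covering_enlargement_closedBall t c r R hR 5 (by norm_num)
  have hcount : u.Countable := hdisj.countable_of_nonempty_interior fun i hi =>
    ⟨c i, ball_subset_interior_closedBall (mem_ball_self (hr i (hut hi)))⟩
  calc μ (⋃ i ∈ t, closedBall (c i) (r i)) ≤ μ (⋃ i ∈ u, closedBall (c i) (5 * r i)) := by
        refine measure_mono (iUnion₂_subset fun i hi => ?_)
        obtain ⟨j, hj, hij⟩ := hcov i hi
        exact hij.trans (subset_biUnion_of_mem (u := fun j => closedBall (c j) (5 * r j)) hj)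
    _ ≤ ∑' i : u, μ (closedBall (c i) (5 * r i)) := measure_biUnion_le _ hcount _
    _ ≤ ∑' i : u, D * ν (closedBall (c i) (r i)) := ENNReal.tsum_le_tsum fun i =>
        (hμ.le_mul _ _ (hr i (hut i.2))).trans (mul_le_mul_right (hν i (hut i.2)) _)
    _ = D * ν (⋃ i ∈ u, closedBall (c i) (r i)) := by
        rw [ENNReal.tsum_mul_left, measure_biUnion hcount hdisj
          fun i _ => measurableSet_closedBall]
    _ ≤ D * ν univ := mul_le_mul_right (measure_mono (subset_univ _)) _

theorem IsDoubling.measure_lt_ballMaximal_le {D : ℝ≥0} (hμ : IsDoubling μ D) {t : ℝ≥0∞} (ht : t ≠ 0)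
    (ht' : t ≠ ∞) : μ {x | t < ballMaximal μ f x} ≤ D * (t⁻¹ * ∫⁻ x, f x ∂μ) := by
  -- The radii are bounded by `N` because the Vitali covering lemma needs bounded radii.
  let T : ℕ → Set (X × ℝ) := fun N => {z | 0 < z.2 ∧ z.2 ≤ N ∧ t < ballAvg μ z.1 z.2 f}
  have hunion : {x | t < ballMaximal μ f x} = ⋃ N, ⋃ z ∈ T N, closedBall z.1 z.2 := by
    ext x
    simp only [mem_ofPred_eq, lt_ballMaximal_iff, mem_iUnion, T]
    constructor
    · rintro ⟨c, r, hr, hx, h⟩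
      obtain ⟨N, hN⟩ := exists_nat_ge r
      exact ⟨N, (c, r), ⟨hr, hN, h⟩, hx⟩
    · rintro ⟨N, z, ⟨hr, -, h⟩, hx⟩
      exact ⟨z.1, z.2, hr, hx, h⟩
  have hmono : Monotone fun N => ⋃ z ∈ T N, closedBall z.1 z.2 := fun N M hNM =>
    biUnion_subset_biUnion_left fun z hz => ⟨hz.1, hz.2.1.trans (by exact_mod_cast hNM), hz.2.2⟩
  have hball : ∀ N, ∀ z ∈ T N,
      μ (closedBall z.1 z.2) ≤ (t⁻¹ • μ.withDensity f) (closedBall z.1 z.2) := by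
    rintro N z ⟨hz, -, h⟩
    rw [Measure.smul_apply, withDensity_apply _ measurableSet_closedBall, smul_eq_mul,
      ← ENNReal.div_eq_inv_mul, ENNReal.le_div_iff_mul_le (Or.inl ht) (Or.inl ht'), mul_comm]
    refine (ENNReal.le_div_iff_mul_le (Or.inl (hμ.pos z.1 z.2 hz).ne')
      (Or.inl (hμ.lt_top z.1 z.2).ne)).1 ?_
    rw [ENNReal.div_eq_inv_mul]
    exact h.le
  rw [hunion, hmono.measure_iUnion]
  refine iSup_le fun N => ?_
  refine (hμ.measure_biUnion_closedBall_le (T N) Prod.fst Prod.snd N (fun z hz => hz.1)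
    (fun z hz => hz.2.1) (t⁻¹ • μ.withDensity f) (hball N)).trans_eq ?_
  rw [Measure.smul_apply, withDensity_apply _ MeasurableSet.univ, smul_eq_mul, setLIntegral_univ]

theorem IsDoubling.measure_two_mul_lt_ballMaximal_le {D : ℝ≥0} (hμ : IsDoubling μ D)
    (hf : AEMeasurable f μ) {t : ℝ≥0∞} (ht : t ≠ 0) (ht' : t ≠ ∞) :
    μ {x | 2 * t < ballMaximal μ f x} ≤ D * t⁻¹ * μ.withDensity f {x | t < f x} := by
  have hlevel : NullMeasurableSet {x | t < f x} μ := nullMeasurableSet_lt aemeasurable_const hf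
  calc μ {x | 2 * t < ballMaximal μ f x}
      ≤ μ {x | t < ballMaximal μ ({x | t < f x}.indicator f) x} := by
        refine measure_mono fun x hx => ?_
        have h := (mem_ofPred.1 hx).trans_le (hμ.ballMaximal_le_indicator_add t x)
        rw [two_mul] at h
        exact lt_of_add_lt_add_right h
    _ ≤ D * (t⁻¹ * ∫⁻ x, {x | t < f x}.indicator f x ∂μ) := hμ.measure_lt_ballMaximal_le ht ht'
    _ = _ := by rw [withDensity_apply₀ _ hlevel, ← lintegral_indicator₀ hlevel, mul_assoc]

theorem IsDoubling.lintegral_ballMaximal_rpow_le {D : ℝ≥0} (hμ : IsDoubling μ D) {p : ℝ}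
    (hp : 1 < p) (hf : AEMeasurable f μ) :
    ∫⁻ x, ballMaximal μ f x ^ p ∂μ ≤
      2 ^ p * (D * ENNReal.ofReal (p / (p - 1))) * ∫⁻ x, f x ^ p ∂μ := by
  have hp0 : 0 ≤ p := by linarith
  have hscale : ∀ x, ballMaximal μ f x ^ p = 2 ^ p * (ballMaximal μ f x / 2) ^ p := fun x => by
    rw [← ENNReal.mul_rpow_of_nonneg _ _ hp0, ENNReal.mul_div_cancel (by simp) (by simp)]
  simp_rw [hscale]
  rw [lintegral_const_mul' _ _ (by finiteness), mul_assoc]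
  gcongr
  refine lintegral_rpow_le_of_meas_lt_le_withDensity hf
    (hμ.measurable_ballMaximal.div_const 2).aemeasurable hp fun t ht => ?_
  simp_rw [ENNReal.lt_div_iff_mul_lt (Or.inl two_ne_zero) (Or.inl ENNReal.ofNat_ne_top),
    mul_comm _ (2 : ℝ≥0∞), ENNReal.ofReal_inv_of_pos ht]
  exact hμ.measure_two_mul_lt_ballMaximal_le hf (by simpa using ht) ENNReal.ofReal_ne_top

end DoublingMeasure

section CoifmanRochberg

variable {X : Type*} [PseudoMetricSpace X]

theorem exists_whitney_covering [SecondCountableTopology X] {Ω : Set X} (hΩ : IsOpen Ω)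
    (hne : Ωᶜ.Nonempty) {R : ℝ} (hR : ∀ x ∈ Ω, infDist x Ωᶜ ≤ R) :
    ∃ u ⊆ Ω, u.Countable ∧ u.PairwiseDisjoint (fun x => closedBall x (2 / 5 * infDist x Ωᶜ)) ∧
      ⋃ x ∈ u, closedBall x (2 / 5 * infDist x Ωᶜ) ⊆ Ω ∧
      Ω ⊆ ⋃ x ∈ u, closedBall x (2 * infDist x Ωᶜ) := by
  have hpos : ∀ x ∈ Ω, 0 < infDist x Ωᶜ := fun x hx =>
    (hΩ.isClosed_compl.notMem_iff_infDist_pos hne).1 (notMem_compl_iff.2 hx)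
  obtain ⟨u, huΩ, hdisj, hcov⟩ := Vitali.exists_disjoint_subfamily_covering_enlargement_closedBall
    Ω id (fun x => 2 / 5 * infDist x Ωᶜ) (2 / 5 * R)
    (fun x hx => by linarith [hR x hx]) 5 (by norm_num)
  refine ⟨u, huΩ, hdisj.countable_of_nonempty_interior fun x hx => ⟨x,
    ball_subset_interior_closedBall (mem_ball_self (by linarith [hpos x (huΩ hx)]))⟩, hdisj,
    iUnion₂_subset fun x hx y hy => ?_, fun x hx => ?_⟩
  · by_contra hyΩ
    have hle : infDist x Ωᶜ ≤ dist x y := infDist_le_dist_of_mem hyΩ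
    rw [mem_closedBall, dist_comm] at hy
    linarith [hpos x (huΩ hx)]
  · obtain ⟨z, hz, hsub⟩ := hcov x hx
    have hmem := hsub (mem_closedBall_self (by linarith [hpos x hx]))
    rw [← mul_assoc, show (5 : ℝ) * (2 / 5) = 2 by norm_num] at hmem
    exact mem_biUnion hz hmem

variable [MeasurableSpace X] {μ : Measure X} {f : X → ℝ≥0∞}

theorem setLIntegral_closedBall_eq_mul_ballAvg {D : ℝ≥0} (hμ : IsDoubling μ D) (f : X → ℝ≥0∞)
    (c : X) {r : ℝ} (hr : 0 < r) :
    ∫⁻ y in closedBall c r, f y ∂μ = μ (closedBall c r) * ballAvg μ c r f := by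
  unfold ballAvg
  rw [← mul_assoc, ENNReal.mul_inv_cancel (hμ.pos c r hr).ne' (hμ.lt_top c r).ne, one_mul]

theorem ballAvg_le_of_setLIntegral_le {D : ℝ≥0} (hμ : IsDoubling μ D) {c : X} {r : ℝ} (hr : 0 < r)
    {A : ℝ≥0∞} (h : ∫⁻ y in closedBall c r, f y ∂μ ≤ μ (closedBall c r) * A) :
    ballAvg μ c r f ≤ A := by
  refine (mul_le_mul_right h _).trans ?_
  rw [← mul_assoc, ENNReal.inv_mul_cancel (hμ.pos c r hr).ne' (hμ.lt_top c r).ne, one_mul]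

theorem setLIntegral_closedBall_eq_zero {D : ℝ≥0} (hμ : IsDoubling μ D) {x : X}
    (h : ballMaximal μ f x = 0) (c : X) (r : ℝ) : ∫⁻ y in closedBall c r, f y ∂μ = 0 := by
  have hR : 0 < max r 0 + dist c x + 1 := by positivity
  have hsub : closedBall c r ⊆ closedBall x (max r 0 + dist c x + 1) :=
    closedBall_subset_closedBall' (by linarith [le_max_left r 0])
  have havg : ballAvg μ x (max r 0 + dist c x + 1) f = 0 :=
    le_antisymm ((ballAvg_le_ballMaximal hR (mem_closedBall_self hR.le)).trans h.le) zero_le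
  refine le_antisymm ((lintegral_mono_set hsub).trans ?_) zero_le
  rw [setLIntegral_closedBall_eq_mul_ballAvg hμ f x hR, havg, mul_zero]

theorem IsDoubling.ballMaximal_eq_zero {D : ℝ≥0} (hμ : IsDoubling μ D) {x : X}
    (h : ballMaximal μ f x = 0) (y : X) : ballMaximal μ f y = 0 :=
  le_antisymm (ballMaximal_le fun c r _ _ => by
    rw [ballAvg, setLIntegral_closedBall_eq_zero hμ h, mul_zero]) zero_le

theorem IsDoubling.ballMaximal_ne_zero {D : ℝ≥0} (hμ : IsDoubling μ D) (hf : AEMeasurable f μ)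
    (h : ¬ f =ᵐ[μ] 0) (x : X) : ballMaximal μ f x ≠ 0 := by
  refine fun hx => h ?_
  rw [← Measure.restrict_univ (μ := μ), ← iUnion_closedBall_nat x, EventuallyEq,
    ae_restrict_iUnion_iff]
  exact fun N => (lintegral_eq_zero_iff' hf.restrict).1 (setLIntegral_closedBall_eq_zero hμ hx x N)

variable [OpensMeasurableSpace X]

theorem IsDoubling.ballMaximal_le_max_indicator {D : ℝ≥0} (hμ : IsDoubling μ D) {c x y : X} {r : ℝ}
    (hx : x ∈ closedBall c r) (hy : y ∈ closedBall c r) : ballMaximal μ f y ≤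
      max (ballMaximal μ ((closedBall c (5 * r)).indicator f) y) (D * ballMaximal μ f x) := by
  refine ballMaximal_le fun c' r' hr' hy' => ?_
  rw [mem_closedBall] at hx hy hy'
  have hyc' := dist_comm c' y
  rcases le_or_gt r' r with h | h
  · have hsub : closedBall c' r' ⊆ closedBall c (5 * r) :=
      closedBall_subset_closedBall' (by linarith [dist_triangle c' y c])
    have heq : ballAvg μ c' r' f = ballAvg μ c' r' ((closedBall c (5 * r)).indicator f) :=
      congrArg (_ * ·) (setLIntegral_congr_fun measurableSet_closedBall fun z hz =>
        (indicator_of_mem (hsub hz) f).symm)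
    exact le_max_of_le_left (heq.le.trans (ballAvg_le_ballMaximal hr' hy'))
  · have hx' : x ∈ closedBall c' (5 * r') := by
      rw [mem_closedBall]
      linarith [dist_triangle4 x c y c', dist_comm c y]
    refine le_max_of_le_right ((ballAvg_le_of_setLIntegral_le hμ hr' ?_).trans
      (mul_le_mul_right (ballAvg_le_ballMaximal (by positivity) hx') _))
    calc ∫⁻ z in closedBall c' r', f z ∂μ ≤ ∫⁻ z in closedBall c' (5 * r'), f z ∂μ :=
          lintegral_mono_set (closedBall_subset_closedBall (by linarith))
      _ = μ (closedBall c' (5 * r')) * ballAvg μ c' (5 * r') f :=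
          setLIntegral_closedBall_eq_mul_ballAvg hμ f c' (by positivity)
      _ ≤ D * μ (closedBall c' r') * ballAvg μ c' (5 * r') f := by
          gcongr
          exact hμ.le_mul c' r' hr'
      _ = _ := by ring

theorem IsDoubling.setLIntegral_lt_ballMaximal_le [SecondCountableTopology X] {D : ℝ≥0}
    (hμ : IsDoubling μ D) {t : ℝ≥0∞} (hne : {x | t < ballMaximal μ f x}ᶜ.Nonempty) {R : ℝ}
    (hR : ∀ x, t < ballMaximal μ f x → infDist x {x | t < ballMaximal μ f x}ᶜ ≤ R) :
    ∫⁻ x in {x | t < ballMaximal μ f x}, f x ∂μ ≤ D * (t * μ {x | t < ballMaximal μ f x}) := by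
  set Ω : Set X := {x | t < ballMaximal μ f x}
  have hΩ : IsOpen Ω := (lowerSemicontinuous_ballMaximal hμ.lt_top).isOpen_preimage t
  obtain ⟨u, huΩ, hcount, hdisj, hsub, hcov⟩ := exists_whitney_covering hΩ hne hR
  have hpos : ∀ x ∈ u, 0 < infDist x Ωᶜ := fun x hx =>
    (hΩ.isClosed_compl.notMem_iff_infDist_pos hne).1 (notMem_compl_iff.2 (huΩ hx))
  have hball : ∀ x ∈ u, ∫⁻ y in closedBall x (2 * infDist x Ωᶜ), f y ∂μ ≤
      D * (t * μ (closedBall x (2 / 5 * infDist x Ωᶜ))) := fun x hx => by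
    have hx0 := hpos x hx
    have hlt : infDist x Ωᶜ < 2 * infDist x Ωᶜ := by linarith
    obtain ⟨z, hz, hxz⟩ := (infDist_lt_iff hne).1 hlt
    have havg : ballAvg μ x (2 * infDist x Ωᶜ) f ≤ t :=
      (ballAvg_le_ballMaximal (by positivity)
        (mem_closedBall'.2 hxz.le)).trans (not_lt.1 hz)
    have hdouble : μ (closedBall x (2 * infDist x Ωᶜ)) ≤
        D * μ (closedBall x (2 / 5 * infDist x Ωᶜ)) := by
      rw [show 2 * infDist x Ωᶜ = 5 * (2 / 5 * infDist x Ωᶜ) by ring]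
      exact hμ.le_mul _ _ (by positivity)
    rw [setLIntegral_closedBall_eq_mul_ballAvg hμ f x (by positivity), mul_comm t, ← mul_assoc]
    exact mul_le_mul' hdouble havg
  calc ∫⁻ x in Ω, f x ∂μ ≤ ∫⁻ x in ⋃ x ∈ u, closedBall x (2 * infDist x Ωᶜ), f x ∂μ :=
        lintegral_mono_set hcov
    _ ≤ ∑' x : u, ∫⁻ y in closedBall (x : X) (2 * infDist (x : X) Ωᶜ), f y ∂μ := by
        have := hcount.to_subtype
        rw [biUnion_eq_iUnion]
        exact lintegral_iUnion_le _ _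
    _ ≤ ∑' x : u, D * (t * μ (closedBall (x : X) (2 / 5 * infDist (x : X) Ωᶜ))) :=
        ENNReal.tsum_le_tsum fun x => hball x x.2
    _ = D * (t * μ (⋃ x ∈ u, closedBall x (2 / 5 * infDist x Ωᶜ))) := by
        rw [ENNReal.tsum_mul_left, ENNReal.tsum_mul_left, measure_biUnion hcount hdisj
          fun _ _ => measurableSet_closedBall]
    _ ≤ D * (t * μ Ω) := by gcongr

theorem IsDoubling.setLIntegral_ballMaximal_rpow_le [SecondCountableTopology X] {D : ℝ≥0}
    (hμ : IsDoubling μ D) {δ : ℝ} (hδ : 0 < δ) (hδ1 : δ < 1) {E : Set X} {a B : ℝ≥0∞} (ha : a ≠ 0)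
    (ha' : a ≠ ∞) (hf : ∫⁻ x, f x ∂μ ≤ B * μ E * a) :
    ∫⁻ x in E, ballMaximal μ f x ^ δ ∂μ ≤
      μ E * ((1 + D * B * ENNReal.ofReal (δ / (1 - δ))) * a ^ δ) := by
  have ha0 : 0 < a.toReal := ENNReal.toReal_pos ha ha'
  have haeq : ENNReal.ofReal a.toReal = a := ENNReal.ofReal_toReal ha'
  have hpow : a * ENNReal.ofReal (δ / (1 - δ) * a.toReal ^ (δ - 1)) =
      ENNReal.ofReal (δ / (1 - δ)) * a ^ δ := by
    rw [ENNReal.ofReal_mul (div_nonneg hδ.le (by linarith)), ← ENNReal.ofReal_rpow_of_pos ha0, haeq,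
      mul_left_comm]
    nth_rw 1 [← ENNReal.rpow_one a]
    rw [← ENNReal.rpow_add _ _ ha ha', add_sub_cancel]
  refine (lintegral_rpow_le_of_meas_lt_le_rpow (a₁ := 0) (a₂ := 1) (C₁ := μ E)
    (C₂ := D * (B * μ E * a)) hμ.measurable_ballMaximal.aemeasurable hδ hδ hδ1 (fun t _ => ?_)
    (fun t ht => ?_) ha0).trans_eq ?_
  · exact (measure_mono (subset_univ _)).trans (by simp)
  · refine (Measure.restrict_apply_le _ _).trans ((hμ.measure_lt_ballMaximal_le
      (ENNReal.ofReal_pos.2 ht).ne' ENNReal.ofReal_ne_top).trans ?_)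
    rw [Real.rpow_neg_one, ENNReal.ofReal_inv_of_pos ht, mul_comm (ENNReal.ofReal t)⁻¹, ← mul_assoc]
    gcongr
  · rw [sub_zero, div_self hδ.ne', one_mul, ← ENNReal.ofReal_rpow_of_pos ha0, haeq,
      show D * (B * μ E * a) * ENNReal.ofReal (δ / (1 - δ) * a.toReal ^ (δ - 1)) =
        D * (B * μ E) * (a * ENNReal.ofReal (δ / (1 - δ) * a.toReal ^ (δ - 1))) by ring, hpow]
    ring

theorem IsDoubling.ballMaximal_rpow_ballMaximal_le [SecondCountableTopology X] {D : ℝ≥0}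
    (hμ : IsDoubling μ D) (f : X → ℝ≥0∞) {δ : ℝ} (hδ : 0 < δ) (hδ1 : δ < 1) (x : X) :
    ballMaximal μ (fun y => ballMaximal μ f y ^ δ) x ≤
      (1 + D * D * ENNReal.ofReal (δ / (1 - δ)) + D ^ δ) * ballMaximal μ f x ^ δ := by
  refine ballMaximal_le fun c r hr hx => ?_
  rcases eq_or_ne (ballMaximal μ f x) 0 with h0 | h0
  · simp [hμ.ballMaximal_eq_zero h0, ENNReal.zero_rpow_of_pos hδ, hμ.ballAvg_const hr]
  rcases eq_or_ne (ballMaximal μ f x) ∞ with h1 | h1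
  · rw [h1, ENNReal.top_rpow_of_pos hδ, ENNReal.mul_top (by positivity)]
    exact le_top
  set f₀ := (closedBall c (5 * r)).indicator f
  have hlocal : ∫⁻ y, f₀ y ∂μ ≤ D * μ (closedBall c r) * ballMaximal μ f x := by
    rw [lintegral_indicator measurableSet_closedBall,
      setLIntegral_closedBall_eq_mul_ballAvg hμ f c (by positivity)]
    gcongr
    · exact hμ.le_mul c r hr
    · exact ballAvg_le_ballMaximal (by positivity)
        (closedBall_subset_closedBall (by linarith) hx)
  have hpt : ∀ y ∈ closedBall c r, ballMaximal μ f y ^ δ ≤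
      ballMaximal μ f₀ y ^ δ + D ^ δ * ballMaximal μ f x ^ δ := fun y hy => by
    rw [← ENNReal.mul_rpow_of_nonneg _ _ hδ.le]
    refine (ENNReal.rpow_le_rpow (hμ.ballMaximal_le_max_indicator hx hy) hδ.le).trans ?_
    rw [(ENNReal.monotone_rpow_of_nonneg hδ.le).map_max]
    exact max_le_add_of_nonneg zero_le zero_le
  refine ballAvg_le_of_setLIntegral_le hμ hr ?_
  calc ∫⁻ y in closedBall c r, ballMaximal μ f y ^ δ ∂μ
      ≤ ∫⁻ y in closedBall c r, (ballMaximal μ f₀ y ^ δ + D ^ δ * ballMaximal μ f x ^ δ) ∂μ :=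
        setLIntegral_mono' measurableSet_closedBall hpt
    _ ≤ μ (closedBall c r) *
          ((1 + D * D * ENNReal.ofReal (δ / (1 - δ))) * ballMaximal μ f x ^ δ) +
        μ (closedBall c r) * (D ^ δ * ballMaximal μ f x ^ δ) := by
        rw [lintegral_add_right _ measurable_const, setLIntegral_const, mul_comm (_ * _) (μ _)]
        gcongr
        exact hμ.setLIntegral_ballMaximal_rpow_le hδ hδ1 h0 h1 hlocal
    _ = _ := by ring

end CoifmanRochberg

section ReverseHolder

variable {n : ℕ} {f g u : (Fin n → ℝ) → ℝ≥0∞}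

theorem volume_closedBall_mul {k r : ℝ} (hk : 0 ≤ k) (hr : 0 ≤ r) (c c' : Fin n → ℝ) :
    volume (closedBall c (k * r)) = ENNReal.ofReal (k ^ n) * volume (closedBall c' r) := by
  rw [Real.volume_pi_closedBall _ (by positivity), Real.volume_pi_closedBall _ hr,
    ← ENNReal.ofReal_mul (by positivity), Fintype.card_fin, ← mul_pow]
  ring_nf

theorem isDoubling_volume : IsDoubling (volume : Measure (Fin n → ℝ)) (5 ^ n) where
  pos c _ hr := measure_closedBall_pos volume c hr
  lt_top _ _ := measure_closedBall_lt_top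
  le_mul c r hr := by
    rw [volume_closedBall_mul (by norm_num) hr.le c c, ENNReal.ofReal_pow (by norm_num)]
    simp

theorem measurable_maximal : Measurable (maximal f) := isDoubling_volume.measurable_ballMaximal

theorem avg_le_maximal {c x : Fin n → ℝ} {r : ℝ} (hr : 0 < r) (hx : x ∈ closedBall c r) :
    avg c r f ≤ maximal f x := ballAvg_le_ballMaximal hr hx

theorem maximal_le {x : Fin n → ℝ} {A : ℝ≥0∞}
    (h : ∀ (c : Fin n → ℝ) (r : ℝ), 0 < r → x ∈ closedBall c r → avg c r f ≤ A) :
    maximal f x ≤ A := ballMaximal_le h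

theorem avg_mono (h : ∀ᵐ x, f x ≤ g x) (c : Fin n → ℝ) (r : ℝ) : avg c r f ≤ avg c r g :=
  ballAvg_mono h c r

theorem avg_const {c : Fin n → ℝ} {r : ℝ} (hr : 0 < r) (a : ℝ≥0∞) : avg c r (fun _ => a) = a :=
  isDoubling_volume.ballAvg_const hr a

theorem avg_const_mul {a : ℝ≥0∞} (ha : a ≠ ∞) (c : Fin n → ℝ) (r : ℝ) :
    avg c r (fun y => a * f y) = a * avg c r f := ballAvg_const_mul ha c r

theorem avg_add_const {c : Fin n → ℝ} {r : ℝ} (hr : 0 < r) (a : ℝ≥0∞) :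
    avg c r (fun y => f y + a) = avg c r f + a := by
  conv_rhs => rw [← avg_const (c := c) hr a]
  unfold avg
  rw [lintegral_add_right _ measurable_const, mul_add]

theorem setLIntegral_eq_mul_avg (f : (Fin n → ℝ) → ℝ≥0∞) (c : Fin n → ℝ) {r : ℝ} (hr : 0 < r) :
    ∫⁻ y in closedBall c r, f y = volume (closedBall c r) * avg c r f :=
  setLIntegral_closedBall_eq_mul_ballAvg isDoubling_volume f c hr

theorem avg_le_of_setLIntegral_le {c : Fin n → ℝ} {r : ℝ} (hr : 0 < r) {A : ℝ≥0∞}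
    (h : ∫⁻ y in closedBall c r, f y ≤ volume (closedBall c r) * A) : avg c r f ≤ A :=
  ballAvg_le_of_setLIntegral_le isDoubling_volume hr h

theorem infDist_compl_le_of_volume_ne_top (hn : 0 < n) {Ω : Set (Fin n → ℝ)}
    (hΩ : volume Ω ≠ ∞) (x : Fin n → ℝ) : infDist x Ωᶜ ≤ 1 + (volume Ω).toReal := by
  by_contra! hlt
  have hV : 0 ≤ (volume Ω).toReal := ENNReal.toReal_nonneg
  have hvol : volume (ball x (infDist x Ωᶜ)) ≤ volume Ω := measure_mono ball_infDist_compl_subset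
  rw [Real.volume_pi_ball _ (by linarith), ENNReal.ofReal_le_iff_le_toReal hΩ,
    Fintype.card_fin] at hvol
  linarith [le_self_pow₀ (by linarith : 1 ≤ 2 * infDist x Ωᶜ) hn.ne']

theorem setLIntegral_lt_maximal_le (hn : 0 < n) (hf : ∫⁻ x, f x ≠ ∞) {t : ℝ≥0∞} (ht : t ≠ 0)
    (ht' : t ≠ ∞) :
    ∫⁻ x in {x | t < maximal f x}, f x ≤ 5 ^ n * (t * volume {x | t < maximal f x}) := by
  have hΩ : volume {x | t < maximal f x} ≠ ∞ := ne_top_of_le_ne_top (by finiteness)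
    (isDoubling_volume.measure_lt_ballMaximal_le (f := f) ht ht')
  have : Nonempty (Fin n) := ⟨⟨0, hn⟩⟩
  have hne : {x | t < maximal f x}ᶜ.Nonempty := by
    rw [nonempty_compl]
    intro huniv
    simp [huniv] at hΩ
  have h := isDoubling_volume.setLIntegral_lt_ballMaximal_le hne
    fun x _ => infDist_compl_le_of_volume_ne_top hn hΩ x
  push_cast at h
  exact h

theorem ae_le_maximal (hf : AEMeasurable f) (hfin : ∫⁻ x, f x ≠ ∞) : ∀ᵐ x, f x ≤ maximal f x := by
  filter_upwards [(Besicovitch.vitaliFamily (volume : Measure (Fin n → ℝ))).ae_tendsto_lintegral_div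
    hf hfin] with x hx
  refine le_of_tendsto (hx.comp (Besicovitch.tendsto_filterAt volume x)) ?_
  filter_upwards [self_mem_nhdsWithin] with r hr
  rw [Function.comp, ENNReal.div_eq_inv_mul]
  exact avg_le_maximal hr (mem_closedBall_self (le_of_lt hr))

theorem maximal_indicator_le_avg {c x : Fin n → ℝ} {r : ℝ} (hr : 0 < r)
    (hx : x ∉ closedBall c (3 * r)) : maximal ((closedBall c r).indicator f) x ≤ avg c r f := by
  refine maximal_le fun c' r' hr' hx' => avg_le_of_setLIntegral_le hr' ?_
  rw [setLIntegral_indicator measurableSet_closedBall]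
  rcases le_or_gt r r' with hrr | hrr
  · calc ∫⁻ y in closedBall c r ∩ closedBall c' r', f y ≤ ∫⁻ y in closedBall c r, f y :=
          lintegral_mono_set inter_subset_left
      _ = volume (closedBall c r) * avg c r f := setLIntegral_eq_mul_avg _ _ hr
      _ ≤ volume (closedBall c' r') * avg c r f := by
          gcongr 1
          rw [Real.volume_pi_closedBall _ hr.le, Real.volume_pi_closedBall _ hr'.le]
          gcongr
  · have hdisj : closedBall c r ∩ closedBall c' r' = ∅ := by
      rw [mem_closedBall, not_le] at hx
      rw [mem_closedBall] at hx'
      refine (closedBall_disjoint_closedBall ?_).inter_eq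
      linarith [dist_triangle x c' c, dist_comm c c']
    simp [hdisj]

theorem withDensity_lt_maximal_indicator_le (hn : 0 < n) {K : ℝ≥0}
    (hK : ∀ᵐ x, maximal u x ≤ K * u x) {c : Fin n → ℝ} {r : ℝ} (hr : 0 < r) {t : ℝ≥0∞}
    (ht : t ≠ 0) (ht' : t ≠ ∞) (havg : avg c r u ≤ t) :
    volume.withDensity ((closedBall c r).indicator u)
        {x | t < maximal ((closedBall c r).indicator u) x} ≤
      5 ^ n * t * volume.restrict (closedBall c (3 * r)) {x | t < K * u x} := by
  have hfin : ∫⁻ x, (closedBall c r).indicator u x ≠ ∞ := by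
    rw [lintegral_indicator measurableSet_closedBall, setLIntegral_eq_mul_avg _ _ hr]
    exact ENNReal.mul_ne_top measure_closedBall_lt_top.ne (ne_top_of_le_ne_top ht' havg)
  rw [withDensity_apply _ (measurableSet_lt measurable_const measurable_maximal)]
  refine (setLIntegral_lt_maximal_le hn hfin ht ht').trans ?_
  rw [← mul_assoc, Measure.restrict_apply₀' measurableSet_closedBall.nullMeasurableSet]
  refine mul_le_mul_right (measure_mono_ae ?_) _
  filter_upwards [hK] with x hx hxt
  have hle : maximal ((closedBall c r).indicator u) x ≤ maximal u x :=
    ballMaximal_mono (Eventually.of_forall (indicator_le_self _ u)) x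
  refine ⟨(lt_of_lt_of_le hxt hle).trans_le hx, not_not.1 fun hx3 => ?_⟩
  exact not_le.2 (lt_of_lt_of_le hxt (maximal_indicator_le_avg hr hx3)) havg

theorem setLIntegral_rpow_le_of_maximal_le (hn : 0 < n) {K : ℝ≥0} (hu : AEMeasurable u)
    (hK : ∀ᵐ x, maximal u x ≤ K * u x) {δ : ℝ} (hδ : 0 < δ) {c : Fin n → ℝ} {r : ℝ} (hr : 0 < r)
    (h0 : avg c r u ≠ 0) (h1 : avg c r u ≠ ∞) :
    ∫⁻ y in closedBall c r, u y ^ (1 + δ) ≤ volume (closedBall c r) * avg c r u ^ (1 + δ) +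
      5 ^ n * ENNReal.ofReal δ * ∫⁻ y in closedBall c (3 * r), (K * u y) ^ (1 + δ) := by
  set f := (closedBall c r).indicator u with hf
  have hfm : AEMeasurable f := hu.indicator measurableSet_closedBall
  have hsplit : ∀ a : ℝ≥0∞, a ^ (1 + δ) = a * a ^ δ := fun a => by
    rw [ENNReal.rpow_add_of_nonneg _ _ zero_le_one hδ.le, ENNReal.rpow_one]
  have hfint : ∫⁻ x, f x = volume (closedBall c r) * avg c r u := by
    rw [lintegral_indicator measurableSet_closedBall, setLIntegral_eq_mul_avg _ _ hr]
  have hffin : ∫⁻ x, f x ≠ ∞ := hfint ▸ ENNReal.mul_ne_top measure_closedBall_lt_top.ne h1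
  calc ∫⁻ y in closedBall c r, u y ^ (1 + δ) = ∫⁻ y, f y * f y ^ δ := by
        rw [← lintegral_indicator measurableSet_closedBall]
        refine lintegral_congr fun y => ?_
        by_cases hy : y ∈ closedBall c r
        · rw [hf, indicator_of_mem hy, indicator_of_mem hy, hsplit]
        · rw [hf, indicator_of_notMem hy, indicator_of_notMem hy, zero_mul]
    _ ≤ ∫⁻ y, f y * maximal f y ^ δ := by
        refine lintegral_mono_ae ?_
        filter_upwards [ae_le_maximal hfm hffin] with y hy
        gcongr
    _ = ∫⁻ y, maximal f y ^ δ ∂volume.withDensity f :=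
        (lintegral_withDensity_eq_lintegral_mul₀ hfm
          (measurable_maximal.pow_const _).aemeasurable).symm
    _ ≤ volume.withDensity f univ * ENNReal.ofReal (avg c r u).toReal ^ δ +
          5 ^ n * ENNReal.ofReal δ * ∫⁻ y in closedBall c (3 * r), (K * u y) ^ (1 + δ) := by
        refine lintegral_rpow_le_add_lintegral_rpow measurable_maximal.aemeasurable
          (hu.restrict.const_mul _) hδ (ENNReal.toReal_pos h0 h1) (by finiteness) fun t ht => ?_
        have hat : avg c r u ≤ ENNReal.ofReal t := (ENNReal.le_ofReal_iff_toReal_le h1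
          (ENNReal.toReal_nonneg.trans ht)).2 ht
        exact withDensity_lt_maximal_indicator_le hn hK hr (ne_bot_of_le_ne_bot h0 hat)
          ENNReal.ofReal_ne_top hat
    _ = _ := by
        rw [ENNReal.ofReal_toReal h1, withDensity_apply _ MeasurableSet.univ, setLIntegral_univ,
          hfint, hsplit, mul_assoc]

theorem avg_le_mul_avg_of_maximal_le {K : ℝ≥0} (hK : ∀ᵐ x, maximal u x ≤ K * u x)
    {c c' : Fin n → ℝ} {r s : ℝ} (hr : 0 < r) (hs : 0 < s)
    (hsub : closedBall c r ⊆ closedBall c' s) : avg c' s u ≤ K * avg c r u := by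
  rw [← avg_const (c := c) hr (avg c' s u), ← avg_const_mul ENNReal.coe_ne_top]
  refine mul_le_mul_right (lintegral_mono_ae ?_) _
  filter_upwards [ae_restrict_of_ae hK, ae_restrict_mem measurableSet_closedBall] with x hx hxb
  exact (avg_le_maximal hs (hsub hxb)).trans hx

theorem setLIntegral_triple_mul_rpow_le {K : ℝ≥0} (hK1 : 1 ≤ K)
    (hK : ∀ᵐ x, maximal u x ≤ K * u x) {δ : ℝ} (hδ : 0 ≤ δ) (hδ1 : δ ≤ 1) {A : ℝ≥0∞}
    (hA : ∀ (c : Fin n → ℝ) (r : ℝ), 0 < r →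
      avg c r (fun x => u x ^ (1 + δ)) ≤ A * avg c r u ^ (1 + δ))
    {c : Fin n → ℝ} {r : ℝ} (hr : 0 < r) :
    ∫⁻ y in closedBall c (3 * r), (K * u y) ^ (1 + δ) ≤
      K ^ 2 * (3 ^ n * volume (closedBall c r) * (A * (K ^ 2 * avg c r u ^ (1 + δ)))) := by
  have hKp : (K : ℝ≥0∞) ^ (1 + δ) ≤ K ^ (2 : ℕ) := by
    rw [← ENNReal.rpow_natCast]
    exact ENNReal.rpow_le_rpow_of_exponent_le (by exact_mod_cast hK1) (by push_cast; linarith)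
  have hKp_mul (a : ℝ≥0∞) : (K * a) ^ (1 + δ) ≤ K ^ 2 * a ^ (1 + δ) := by
    rw [ENNReal.mul_rpow_of_nonneg _ _ (by linarith)]
    gcongr
  have htriple : avg c (3 * r) (fun x => u x ^ (1 + δ)) ≤ A * (K ^ 2 * avg c r u ^ (1 + δ)) :=
    calc avg c (3 * r) (fun x => u x ^ (1 + δ)) ≤ A * avg c (3 * r) u ^ (1 + δ) :=
          hA c _ (by positivity)
      _ ≤ A * (K * avg c r u) ^ (1 + δ) := by
          gcongr
          exact avg_le_mul_avg_of_maximal_le hK hr (by positivity)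
            (closedBall_subset_closedBall (by linarith))
      _ ≤ _ := by
          gcongr
          exact hKp_mul _
  calc ∫⁻ y in closedBall c (3 * r), (K * u y) ^ (1 + δ)
      ≤ ∫⁻ y in closedBall c (3 * r), K ^ 2 * u y ^ (1 + δ) :=
        lintegral_mono fun y => hKp_mul _
    _ = K ^ 2 * (3 ^ n * volume (closedBall c r) * avg c (3 * r) fun x => u x ^ (1 + δ)) := by
        rw [lintegral_const_mul' _ _ (by finiteness), setLIntegral_eq_mul_avg _ _ (by positivity),
          volume_closedBall_mul (by norm_num) hr.le c c, ENNReal.ofReal_pow (by norm_num),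
          ENNReal.ofReal_ofNat]
    _ ≤ _ := by gcongr

theorem avg_rpow_le_of_forall_avg_rpow_le (hn : 0 < n) {K : ℝ≥0} (hK1 : 1 ≤ K)
    (hu : AEMeasurable u) (hK : ∀ᵐ x, maximal u x ≤ K * u x) {δ : ℝ} (hδ : 0 < δ) (hδ1 : δ ≤ 1)
    (hδK : (15 ^ n * K ^ 4 : ℝ≥0∞) * ENNReal.ofReal δ ≤ 2⁻¹) {A : ℝ≥0∞}
    (hA : ∀ (c : Fin n → ℝ) (r : ℝ), 0 < r →
      avg c r (fun x => u x ^ (1 + δ)) ≤ A * avg c r u ^ (1 + δ))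
    {c : Fin n → ℝ} {r : ℝ} (hr : 0 < r) (h0 : avg c r u ≠ 0) (h1 : avg c r u ≠ ∞) :
    avg c r (fun x => u x ^ (1 + δ)) ≤ (1 + A / 2) * avg c r u ^ (1 + δ) := by
  refine avg_le_of_setLIntegral_le hr ?_
  calc ∫⁻ y in closedBall c r, u y ^ (1 + δ)
      ≤ volume (closedBall c r) * avg c r u ^ (1 + δ) +
          5 ^ n * ENNReal.ofReal δ * ∫⁻ y in closedBall c (3 * r), (K * u y) ^ (1 + δ) :=
        setLIntegral_rpow_le_of_maximal_le hn hu hK hδ hr h0 h1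
    _ ≤ volume (closedBall c r) * avg c r u ^ (1 + δ) + 5 ^ n * ENNReal.ofReal δ *
          (K ^ 2 * (3 ^ n * volume (closedBall c r) * (A * (K ^ 2 * avg c r u ^ (1 + δ))))) := by
        gcongr
        exact setLIntegral_triple_mul_rpow_le hK1 hK hδ.le hδ1 hA hr
    _ = volume (closedBall c r) * avg c r u ^ (1 + δ) + (15 ^ n * K ^ 4 * ENNReal.ofReal δ) *
          (volume (closedBall c r) * (A * avg c r u ^ (1 + δ))) := by
        rw [show (15 : ℝ≥0∞) = 5 * 3 by norm_num, mul_pow]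
        ring
    _ ≤ volume (closedBall c r) * avg c r u ^ (1 + δ) +
          2⁻¹ * (volume (closedBall c r) * (A * avg c r u ^ (1 + δ))) := by gcongr
    _ = _ := by
        rw [ENNReal.div_eq_inv_mul]
        ring

theorem le_two_of_le_one_add_half {A : ℝ≥0∞} (hA : A ≠ ∞) (h : A ≤ 1 + A / 2) : A ≤ 2 := by
  have h1 : A / 2 ≤ 1 := by
    refine (ENNReal.add_le_add_iff_right (ENNReal.div_ne_top hA two_ne_zero)).1 ?_
    rwa [ENNReal.add_halves]
  calc A = A / 2 + A / 2 := (ENNReal.add_halves A).symm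
    _ ≤ 1 + 1 := add_le_add h1 h1
    _ = 2 := one_add_one_eq_two

theorem avg_rpow_le_of_le_of_le (hn : 0 < n) {K : ℝ≥0} (hK1 : 1 ≤ K) (hu : AEMeasurable u)
    (hK : ∀ᵐ x, maximal u x ≤ K * u x) {δ : ℝ} (hδ : 0 < δ) (hδ1 : δ ≤ 1)
    (hδK : (15 ^ n * K ^ 4 : ℝ≥0∞) * ENNReal.ofReal δ ≤ 2⁻¹) {a b : ℝ≥0∞} (ha : a ≠ 0) (hb : b ≠ ∞)
    (hau : ∀ x, a ≤ u x) (hub : ∀ x, u x ≤ b) (c : Fin n → ℝ) {r : ℝ} (hr : 0 < r) :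
    avg c r (fun x => u x ^ (1 + δ)) ≤ 2 * avg c r u ^ (1 + δ) := by
  have hp : 0 < 1 + δ := by linarith
  have hlow : ∀ (c : Fin n → ℝ) {r : ℝ}, 0 < r → a ≤ avg c r u := fun c r hr =>
    (avg_const hr a).ge.trans (avg_mono (Eventually.of_forall hau) c r)
  have hupp : ∀ (c : Fin n → ℝ) {r : ℝ}, 0 < r → avg c r u ≤ b := fun c r hr =>
    (avg_mono (Eventually.of_forall hub) c r).trans (avg_const hr b).le
  have hne0 : ∀ (c : Fin n → ℝ) {r : ℝ}, 0 < r → avg c r u ≠ 0 := fun c _ hr =>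
    ne_bot_of_le_ne_bot ha (hlow c hr)
  have hne_top : ∀ (c : Fin n → ℝ) {r : ℝ}, 0 < r → avg c r u ≠ ∞ := fun c _ hr =>
    ne_top_of_le_ne_top hb (hupp c hr)
  set A : ℝ≥0∞ := ⨆ (c : Fin n → ℝ) (r : ℝ) (_ : 0 < r),
    avg c r (fun x => u x ^ (1 + δ)) / avg c r u ^ (1 + δ)
  have hdiv : ∀ (c : Fin n → ℝ) {r : ℝ} (B : ℝ≥0∞), 0 < r →
      (avg c r (fun x => u x ^ (1 + δ)) / avg c r u ^ (1 + δ) ≤ B ↔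
        avg c r (fun x => u x ^ (1 + δ)) ≤ B * avg c r u ^ (1 + δ)) := fun c r B hr =>
    ENNReal.div_le_iff (by simp [hne0 c hr, hne_top c hr])
      (ENNReal.rpow_ne_top_of_nonneg hp.le (hne_top c hr))
  have hA : ∀ (c : Fin n → ℝ) (r : ℝ), 0 < r →
      avg c r (fun x => u x ^ (1 + δ)) ≤ A * avg c r u ^ (1 + δ) := fun c r hr =>
    (hdiv c A hr).1 (le_iSup_of_le c <| le_iSup_of_le r <| le_iSup_of_le hr le_rfl)
  have hA_top : A ≠ ∞ := by
    refine ne_top_of_le_ne_top (b := b ^ (1 + δ) / a ^ (1 + δ)) (ENNReal.div_ne_top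
      (ENNReal.rpow_ne_top_of_nonneg hp.le hb) (by simp [ha, hp.le])) ?_
    refine iSup_le fun c => iSup_le fun r => iSup_le fun hr => ENNReal.div_le_div ?_ ?_
    · exact (avg_mono (Eventually.of_forall fun x => ENNReal.rpow_le_rpow (hub x) hp.le) c r).trans
        (avg_const hr _).le
    · exact ENNReal.rpow_le_rpow (hlow c hr) hp.le
  have hA2 : A ≤ 2 := le_two_of_le_one_add_half hA_top <|
    iSup_le fun c => iSup_le fun r => iSup_le fun hr => (hdiv c _ hr).2 <|
      avg_rpow_le_of_forall_avg_rpow_le hn hK1 hu hK hδ hδ1 hδK hA hr (hne0 c hr) (hne_top c hr)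
  exact (hA c r hr).trans (by gcongr)

theorem le_apply_of_forall_le_apply_add {Φ : ℝ≥0∞ → ℝ≥0∞} (hΦ : Continuous Φ) {x A : ℝ≥0∞}
    (h : ∀ ε : ℝ, 0 < ε → x ≤ Φ (A + ENNReal.ofReal ε)) : x ≤ Φ A := by
  have hlim : Tendsto (fun ε : ℝ => Φ (A + ENNReal.ofReal ε)) (𝓝[>] 0) (𝓝 (Φ A)) := by
    have hc : Continuous fun ε : ℝ => Φ (A + ENNReal.ofReal ε) :=
      hΦ.comp (continuous_const.add ENNReal.continuous_ofReal)
    simpa using hc.tendsto 0 |>.mono_left nhdsWithin_le_nhds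
  exact ge_of_tendsto hlim (eventually_nhdsWithin_of_forall h)

theorem maximal_min_add_le {K : ℝ≥0} (hK1 : 1 ≤ K) {x : Fin n → ℝ}
    (hx : maximal u x ≤ K * u x) (a b : ℝ≥0∞) :
    maximal (fun y => min (u y) a + b) x ≤ K * (min (u x) a + b) := by
  have hK1' : (1 : ℝ≥0∞) ≤ K := by exact_mod_cast hK1
  refine maximal_le fun c r hr hxc => ?_
  rw [avg_add_const hr, mul_add, mul_min]
  refine add_le_add (le_min ?_ ?_) (le_mul_of_one_le_left zero_le hK1')
  · calc avg c r (fun y => min (u y) a) ≤ avg c r u :=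
          avg_mono (Eventually.of_forall fun _ => min_le_left _ _) c r
      _ ≤ _ := (avg_le_maximal hr hxc).trans hx
  · calc avg c r (fun y => min (u y) a) ≤ avg c r (fun _ => a) :=
          avg_mono (Eventually.of_forall fun _ => min_le_right _ _) c r
      _ = a := avg_const hr a
      _ ≤ _ := le_mul_of_one_le_left zero_le hK1'

theorem avg_rpow_eq_iSup_min (hu : AEMeasurable u) {p : ℝ} (hp : 0 ≤ p) (c : Fin n → ℝ) (r : ℝ) :
    avg c r (fun x => u x ^ p) = ⨆ N : ℕ, avg c r fun x => min (u x) N ^ p := by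
  have hmono : ∀ x, Monotone fun N : ℕ => min (u x) (N : ℝ≥0∞) := fun x _ _ h =>
    min_le_min_left _ (by exact_mod_cast h)
  have hlim : ∀ x, u x ^ p = ⨆ N : ℕ, min (u x) (N : ℝ≥0∞) ^ p := fun x => by
    refine tendsto_nhds_unique ?_
      (tendsto_atTop_iSup fun _ _ h => ENNReal.rpow_le_rpow (hmono x h) hp)
    have h := tendsto_atTop_iSup (hmono x)
    rw [← inf_iSup_eq, ENNReal.iSup_natCast, inf_top_eq] at h
    exact (ENNReal.continuous_rpow_const.tendsto _).comp h
  unfold avg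
  rw [← ENNReal.mul_iSup, ← lintegral_iSup' (fun N => by fun_prop)
    (Eventually.of_forall fun x _ _ h => ENNReal.rpow_le_rpow (hmono x h) hp)]
  simp_rw [hlim]

theorem avg_rpow_le_of_maximal_le (hn : 0 < n) {K : ℝ≥0} (hK1 : 1 ≤ K) (hu : AEMeasurable u)
    (hK : ∀ᵐ x, maximal u x ≤ K * u x) {δ : ℝ} (hδ : 0 < δ) (hδ1 : δ ≤ 1)
    (hδK : (15 ^ n * K ^ 4 : ℝ≥0∞) * ENNReal.ofReal δ ≤ 2⁻¹) (c : Fin n → ℝ) {r : ℝ} (hr : 0 < r) :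
    avg c r (fun x => u x ^ (1 + δ)) ≤ 2 * avg c r u ^ (1 + δ) := by
  have hp : 0 ≤ 1 + δ := by linarith
  rw [avg_rpow_eq_iSup_min hu hp]
  refine iSup_le fun N => le_apply_of_forall_le_apply_add (Φ := fun A => 2 * A ^ (1 + δ))
    ((ENNReal.continuous_const_mul (by finiteness)).comp ENNReal.continuous_rpow_const)
    fun ε hε => ?_
  set v : (Fin n → ℝ) → ℝ≥0∞ := fun x => min (u x) N + ENNReal.ofReal ε
  calc avg c r (fun x => min (u x) N ^ (1 + δ)) ≤ avg c r (fun x => v x ^ (1 + δ)) :=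
        avg_mono (Eventually.of_forall fun x => ENNReal.rpow_le_rpow le_self_add hp) c r
    _ ≤ 2 * avg c r v ^ (1 + δ) :=
        avg_rpow_le_of_le_of_le hn hK1 (by fun_prop)
          (hK.mono fun x hx => maximal_min_add_le hK1 hx _ _) hδ hδ1 hδK
          (ENNReal.ofReal_pos.2 hε).ne' (b := N + ENNReal.ofReal ε) (by finiteness)
          (fun x => le_add_self) (fun x => add_le_add_left (min_le_right _ _) _) c hr
    _ ≤ 2 * (avg c r u + ENNReal.ofReal ε) ^ (1 + δ) := by
        rw [avg_add_const hr]
        gcongr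
        exact avg_mono (Eventually.of_forall fun x => min_le_left _ _) c r

theorem exists_pos_le_one_mul_ofReal_le {C : ℝ≥0∞} (hC : C ≠ ∞) {ε : ℝ≥0∞} (hε : 0 < ε) :
    ∃ δ : ℝ, 0 < δ ∧ δ ≤ 1 ∧ C * ENNReal.ofReal δ ≤ ε := by
  have hlim : Tendsto (fun δ => C * ENNReal.ofReal δ) (𝓝[>] 0) (𝓝 0) := by
    have hc : Continuous fun δ => C * ENNReal.ofReal δ :=
      (ENNReal.continuous_const_mul hC).comp ENNReal.continuous_ofReal
    simpa using (hc.tendsto 0).mono_left nhdsWithin_le_nhds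
  have hIoc : ∀ᶠ δ in 𝓝[>] (0 : ℝ), δ ∈ Ioc 0 1 := Ioc_mem_nhdsGT zero_lt_one
  obtain ⟨δ, ⟨hδ, hδ1⟩, hle⟩ := (hIoc.and (hlim.eventually_le_const hε)).exists
  exact ⟨δ, hδ, hδ1, hle⟩

theorem exists_reverse_holder (hn : 0 < n) (K : ℝ≥0) : ∃ δ : ℝ, 0 < δ ∧
    ∀ u : (Fin n → ℝ) → ℝ≥0∞, AEMeasurable u → (∀ᵐ x, maximal u x ≤ K * u x) →
      ∀ (c : Fin n → ℝ) (r : ℝ), 0 < r →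
        avg c r (fun x => u x ^ (1 + δ)) ≤ 2 * avg c r u ^ (1 + δ) := by
  obtain ⟨δ, hδ, hδ1, hδK⟩ := exists_pos_le_one_mul_ofReal_le
    (C := 15 ^ n * (max K 1 : ℝ≥0) ^ 4) (ε := 2⁻¹) (by finiteness) (by simp)
  refine ⟨δ, hδ, fun u hu hK c r hr => ?_⟩
  refine avg_rpow_le_of_maximal_le hn (le_max_right K 1) hu ?_ hδ hδ1 hδK c hr
  filter_upwards [hK] with x hx
  exact hx.trans (by gcongr; exact le_max_left K 1)

end ReverseHolder

section Exponential

/-- The exponential function with values in `ℝ≥0∞`. Writing positive finite quantities as `eexp t`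
turns identities between their real powers into linear identities between exponents. -/
noncomputable def eexp (t : ℝ) : ℝ≥0∞ := ENNReal.ofReal (Real.exp t)

theorem exists_eq_eexp {x : ℝ≥0∞} (hx : x ≠ 0 ∧ x ≠ ∞) : ∃ t, x = eexp t := by
  refine ⟨Real.log x.toReal, ?_⟩
  rw [eexp, Real.exp_log (ENNReal.toReal_pos hx.1 hx.2), ENNReal.ofReal_toReal hx.2]

theorem eexp_mul (s t : ℝ) : eexp s * eexp t = eexp (s + t) := by
  rw [eexp, eexp, eexp, ← ENNReal.ofReal_mul (Real.exp_pos _).le, Real.exp_add]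

theorem eexp_rpow (s p : ℝ) : eexp s ^ p = eexp (s * p) := by
  rw [eexp, eexp, ENNReal.ofReal_rpow_of_pos (Real.exp_pos _), Real.exp_mul]

theorem eexp_inv (s : ℝ) : (eexp s)⁻¹ = eexp (-s) := by
  rw [eexp, eexp, ← ENNReal.ofReal_inv_of_pos (Real.exp_pos _), Real.exp_neg]

theorem eexp_zero : eexp 0 = 1 := by simp [eexp]

theorem eexp_ne_zero (s : ℝ) : eexp s ≠ 0 := by simp [eexp, Real.exp_pos]

theorem eexp_ne_top (s : ℝ) : eexp s ≠ ∞ := ENNReal.ofReal_ne_top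

theorem rpow_ne_zero_top {x : ℝ≥0∞} (hx : x ≠ 0 ∧ x ≠ ∞) (p : ℝ) : x ^ p ≠ 0 ∧ x ^ p ≠ ∞ := by
  obtain ⟨t, rfl⟩ := exists_eq_eexp hx
  rw [eexp_rpow]
  exact ⟨eexp_ne_zero _, eexp_ne_top _⟩

theorem mul_ne_zero_top {x y : ℝ≥0∞} (hx : x ≠ 0 ∧ x ≠ ∞) (hy : y ≠ 0 ∧ y ≠ ∞) :
    x * y ≠ 0 ∧ x * y ≠ ∞ :=
  ⟨mul_ne_zero hx.1 hy.1, ENNReal.mul_ne_top hx.2 hy.2⟩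

theorem rpow_neg_le_of_le_mul {A K x : ℝ≥0∞} (hA : A ≠ 0) (hK : K ≠ 0 ∧ K ≠ ∞)
    (h : A ≤ K * x) {e : ℝ} (he : 0 ≤ e) : x ^ (-e) ≤ K ^ e * A ^ (-e) := by
  have hx : x ≠ 0 := by
    rintro rfl
    exact hA (by simpa using h)
  calc x ^ (-e) = K ^ e * (K * x) ^ (-e) := by
        rw [ENNReal.mul_rpow_of_ne_zero hK.1 hx, ← mul_assoc, ← ENNReal.rpow_add _ _ hK.1 hK.2]
        simp
    _ ≤ K ^ e * A ^ (-e) := by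
        rw [ENNReal.rpow_neg, ENNReal.rpow_neg]
        gcongr

end Exponential

section Weights

variable {n : ℕ} {f g : (Fin n → ℝ) → ℝ≥0∞}

theorem avg_congr {c : Fin n → ℝ} {r : ℝ}
    (h : ∀ᵐ y ∂(volume.restrict (closedBall c r)), f y = g y) : avg c r f = avg c r g := by
  unfold avg
  rw [lintegral_congr_ae h]

theorem avg_mono_restrict {c : Fin n → ℝ} {r : ℝ}
    (h : ∀ᵐ y ∂(volume.restrict (closedBall c r)), f y ≤ g y) : avg c r f ≤ avg c r g :=
  mul_le_mul_right (lintegral_mono_ae h) _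

theorem avg_rpow_mul_rpow_le (hf : AEMeasurable f) (hg : AEMeasurable g) {a b : ℝ} (ha : 0 ≤ a)
    (hb : 0 ≤ b) (hab : a + b = 1) (c : Fin n → ℝ) (r : ℝ) :
    avg c r (fun y => f y ^ a * g y ^ b) ≤ avg c r f ^ a * avg c r g ^ b := by
  unfold avg
  rw [ENNReal.mul_rpow_of_nonneg _ _ ha, ENNReal.mul_rpow_of_nonneg _ _ hb, mul_mul_mul_comm,
    ← ENNReal.rpow_add_of_nonneg _ _ ha hb, hab, ENNReal.rpow_one]
  gcongr
  exact ENNReal.lintegral_mul_norm_pow_le hf.restrict hg.restrict ha hb hab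

theorem avg_rpow_le (hf : AEMeasurable f) {a : ℝ} (ha : 0 ≤ a) (ha1 : a ≤ 1) (c : Fin n → ℝ) {r : ℝ}
    (hr : 0 < r) : avg c r (fun y => f y ^ a) ≤ avg c r f ^ a := by
  simpa [avg_const hr] using avg_rpow_mul_rpow_le hf (g := fun _ => 1) aemeasurable_const ha
    (sub_nonneg.2 ha1) (add_sub_cancel a 1) c r

theorem maximal_rpow_mul_rpow_le (hf : AEMeasurable f) (hg : AEMeasurable g) {a b : ℝ} (ha : 0 ≤ a)
    (hb : 0 ≤ b) (hab : a + b = 1) (x : Fin n → ℝ) :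
    maximal (fun y => f y ^ a * g y ^ b) x ≤ maximal f x ^ a * maximal g x ^ b :=
  maximal_le fun c r hr hx => (avg_rpow_mul_rpow_le hf hg ha hb hab c r).trans
    (mul_le_mul' (ENNReal.rpow_le_rpow (avg_le_maximal hr hx) ha)
      (ENNReal.rpow_le_rpow (avg_le_maximal hr hx) hb))

variable {u v w w' ω : (Fin n → ℝ) → ℝ≥0∞}

theorem avg_ne_zero (hw : AEMeasurable w) (hpos : ∀ᵐ x, w x ≠ 0) (c : Fin n → ℝ) {r : ℝ}
    (hr : 0 < r) : avg c r w ≠ 0 := by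
  refine mul_ne_zero (ENNReal.inv_ne_zero.2 measure_closedBall_lt_top.ne) fun h => ?_
  rw [lintegral_eq_zero_iff' hw.restrict] at h
  have hfalse : ∀ᵐ _ ∂(volume.restrict (closedBall c r)), False := by
    filter_upwards [h, ae_restrict_of_ae hpos] with x h1 h2 using h2 h1
  rw [eventually_false_iff_eq_bot, ae_eq_bot, Measure.restrict_eq_zero] at hfalse
  exact (measure_closedBall_pos volume c hr).ne' hfalse

theorem IsWeight.congr (hw : IsWeight w) (h : w =ᵐ[volume] w') : IsWeight w' where
  aemeasurable := hw.aemeasurable.congr h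
  ae_pos := by filter_upwards [hw.ae_pos, h] with x hx hx' using hx' ▸ hx
  ae_lt_top := by filter_upwards [hw.ae_lt_top, h] with x hx hx' using hx' ▸ hx
  locally_integrable c r := by
    rw [← lintegral_congr_ae (ae_restrict_of_ae h)]
    exact hw.locally_integrable c r

theorem IsWeight.ae_ne (hw : IsWeight w) : ∀ᵐ x, w x ≠ 0 ∧ w x ≠ ∞ := by
  filter_upwards [hw.ae_pos, hw.ae_lt_top] with x h1 h2 using ⟨h1.ne', h2.ne⟩

theorem IsWeight.avg_ne (hw : IsWeight w) (c : Fin n → ℝ) {r : ℝ} (hr : 0 < r) :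
    avg c r w ≠ 0 ∧ avg c r w ≠ ∞ :=
  ⟨avg_ne_zero hw.aemeasurable (hw.ae_ne.mono fun _ h => h.1) c hr,
    ENNReal.mul_ne_top (ENNReal.inv_ne_top.2 (measure_closedBall_pos volume c hr).ne')
      (hw.locally_integrable c r).ne⟩

theorem isWeight_of_avg_ne_top (hw : AEMeasurable w) (h : ∀ᵐ x, w x ≠ 0 ∧ w x ≠ ∞)
    (havg : ∀ (c : Fin n → ℝ) (r : ℝ), 0 < r → avg c r w ≠ ∞) : IsWeight w where
  aemeasurable := hw
  ae_pos := h.mono fun x hx => pos_iff_ne_zero.2 hx.1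
  ae_lt_top := h.mono fun x hx => lt_top_iff_ne_top.2 hx.2
  locally_integrable c r := by
    refine (lintegral_mono_set (closedBall_subset_closedBall (le_max_left r 1))).trans_lt ?_
    rw [setLIntegral_eq_mul_avg _ _ (by positivity)]
    exact ENNReal.mul_lt_top measure_closedBall_lt_top
      (lt_top_iff_ne_top.2 (havg _ _ (by positivity)))

variable {K L : ℝ≥0}

/-- The `A_1` condition with the explicit bound `K` for the `A_1` constant. -/
structure A1 (K : ℝ≥0) (u : (Fin n → ℝ) → ℝ≥0∞) : Prop where
  weight : IsWeight u
  le : ∀ᵐ x, maximal u x ≤ K * u x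

/-- The dual weight `w ^ (1 - p')` of the `A_p` theory, with exponent in the form
`-(1 / (p - 1))`. -/
noncomputable abbrev dualWeight (p : ℝ) (w : (Fin n → ℝ) → ℝ≥0∞) : (Fin n → ℝ) → ℝ≥0∞ :=
  fun x => w x ^ (-(1 / (p - 1)))

/-- The `A_p` condition with the explicit bound `K` for the `A_p` constant. -/
structure Ap (p : ℝ) (K : ℝ≥0) (w : (Fin n → ℝ) → ℝ≥0∞) : Prop where
  weight : IsWeight w
  le : ∀ (c : Fin n → ℝ) (r : ℝ), 0 < r → avg c r w * avg c r (dualWeight p w) ^ (p - 1) ≤ K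

theorem exists_mem_closedBall_of_ae {P : (Fin n → ℝ) → Prop} (h : ∀ᵐ x, P x) (c : Fin n → ℝ)
    {r : ℝ} (hr : 0 < r) : ∃ x ∈ closedBall c r, P x := by
  have hfreq : ∃ᵐ x ∂(volume : Measure (Fin n → ℝ)), x ∈ closedBall c r := by
    rw [frequently_ae_mem_iff]
    exact (measure_closedBall_pos volume c hr).ne'
  exact (hfreq.and_eventually h).exists

theorem A1.of_maximal_le (hu : AEMeasurable u) (h : ∀ᵐ x, u x ≠ 0 ∧ u x ≠ ∞)
    (hK : ∀ᵐ x, maximal u x ≤ K * u x) : A1 K u where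
  le := hK
  weight := by
    refine isWeight_of_avg_ne_top hu h fun c r hr => ?_
    obtain ⟨x, hxc, hx, hxK⟩ := exists_mem_closedBall_of_ae (h.and hK) c hr
    exact ne_top_of_le_ne_top (ENNReal.mul_ne_top ENNReal.coe_ne_top hx.2)
      ((avg_le_maximal hr hxc).trans hxK)

theorem A1.congr (hu : A1 K u) (h : u =ᵐ[volume] v) : A1 K v where
  weight := hu.weight.congr h
  le := by
    filter_upwards [hu.le, h] with x h1 h2
    rw [← h2]
    exact (ballMaximal_mono h.symm.le x).trans h1

theorem A1.mono (hu : A1 K u) (h : K ≤ L) : A1 L u where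
  weight := hu.weight
  le := by
    filter_upwards [hu.le] with x hx
    exact hx.trans (by gcongr)

theorem A1.one : A1 (n := n) 1 (fun _ => 1) := by
  refine A1.of_maximal_le aemeasurable_const (Eventually.of_forall fun _ => by simp)
    (Eventually.of_forall fun x => maximal_le fun c r hr _ => ?_)
  simp [avg_const hr]

theorem A1.rpow_mul_rpow (hu : A1 K u) (hv : A1 L v) {a b : ℝ} (ha : 0 ≤ a) (hb : 0 ≤ b)
    (hab : a + b = 1) : A1 (K ^ a * L ^ b) (fun x => u x ^ a * v x ^ b) := by
  have hum := hu.weight.aemeasurable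
  have hvm := hv.weight.aemeasurable
  refine A1.of_maximal_le (by fun_prop) ?_ ?_
  · filter_upwards [hu.weight.ae_ne, hv.weight.ae_ne] with x h1 h2
    exact mul_ne_zero_top (rpow_ne_zero_top h1 _) (rpow_ne_zero_top h2 _)
  · filter_upwards [hu.le, hv.le] with x h1 h2
    refine (maximal_rpow_mul_rpow_le hum hvm ha hb hab x).trans ?_
    rw [ENNReal.coe_mul, ENNReal.coe_rpow_of_nonneg _ ha, ENNReal.coe_rpow_of_nonneg _ hb,
      mul_mul_mul_comm, ← ENNReal.mul_rpow_of_nonneg _ _ ha, ← ENNReal.mul_rpow_of_nonneg _ _ hb]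
    gcongr

theorem A1.rpow (hu : A1 K u) {a : ℝ} (ha : 0 ≤ a) (ha1 : a ≤ 1) :
    A1 (K ^ a) (fun x => u x ^ a) := by
  simpa using hu.rpow_mul_rpow A1.one ha (sub_nonneg.2 ha1) (by ring)

theorem A1.rpow_of_avg_rpow_le (hu : A1 K u) {p : ℝ} (hp : 0 ≤ p) {C : ℝ≥0}
    (h : ∀ (c : Fin n → ℝ) (r : ℝ), 0 < r → avg c r (fun x => u x ^ p) ≤ C * avg c r u ^ p) :
    A1 (C * K ^ p) (fun x => u x ^ p) := by
  have hum := hu.weight.aemeasurable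
  refine A1.of_maximal_le (by fun_prop) ?_ ?_
  · filter_upwards [hu.weight.ae_ne] with x hx using rpow_ne_zero_top hx _
  · filter_upwards [hu.le] with x hx
    refine maximal_le fun c r hr hxc => (h c r hr).trans ?_
    rw [ENNReal.coe_mul, ENNReal.coe_rpow_of_nonneg _ hp, mul_assoc,
      ← ENNReal.mul_rpow_of_nonneg _ _ hp]
    gcongr
    exact (avg_le_maximal hr hxc).trans hx

theorem exists_A1_mul_rpow (hn : 0 < n) (K : ℝ≥0) : ∃ θ₀ : ℝ, 0 < θ₀ ∧ θ₀ < 1 ∧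
    ∀ θ : ℝ, 0 ≤ θ → θ ≤ θ₀ → ∀ L : ℝ≥0, ∃ K' : ℝ≥0, ∀ u v : (Fin n → ℝ) → ℝ≥0∞,
      A1 K u → A1 L v → A1 K' (fun x => u x * v x ^ θ) := by
  obtain ⟨δ, hδ, hrh⟩ := exists_reverse_holder hn K
  have hδ' : 0 < 1 + δ := by linarith
  refine ⟨δ / (1 + δ), by positivity, by rw [div_lt_one hδ']; linarith, fun θ hθ hθ' L => ?_⟩
  have hη : θ * (1 + δ) / δ ≤ 1 := by
    rw [div_le_one hδ]
    rwa [le_div_iff₀ hδ'] at hθ'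
  refine ⟨(2 * K ^ (1 + δ)) ^ (1 / (1 + δ)) * (L ^ (θ * (1 + δ) / δ)) ^ (δ / (1 + δ)),
    fun u v hu hv => ?_⟩
  -- `u * v ^ θ` is a geometric mean of `u ^ (1 + δ)` and a power of `v` of exponent at most one.
  have hup : A1 (2 * K ^ (1 + δ)) (fun x => u x ^ (1 + δ)) :=
    hu.rpow_of_avg_rpow_le hδ'.le (hrh u hu.weight.aemeasurable hu.le)
  refine (hup.rpow_mul_rpow (hv.rpow (by positivity) hη) (a := 1 / (1 + δ)) (b := δ / (1 + δ))
    (by positivity) (by positivity) (by field_simp)).congr ?_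
  filter_upwards [hu.weight.ae_ne, hv.weight.ae_ne] with x hx hx'
  obtain ⟨s, hs⟩ := exists_eq_eexp hx
  obtain ⟨t, ht⟩ := exists_eq_eexp hx'
  simp only [hs, ht, eexp_rpow, eexp_mul]
  congr 1
  field_simp

theorem A1.ae_avg_le (hu : A1 K u) (c : Fin n → ℝ) {r : ℝ} (hr : 0 < r) :
    ∀ᵐ y ∂(volume.restrict (closedBall c r)), avg c r u ≤ K * u y := by
  filter_upwards [ae_restrict_of_ae hu.le, ae_restrict_mem measurableSet_closedBall] with y h1 h2
  exact (avg_le_maximal hr h2).trans h1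

theorem A1.coe_ne (hu : A1 K u) : (K : ℝ≥0∞) ≠ 0 ∧ (K : ℝ≥0∞) ≠ ∞ := by
  refine ⟨fun h0 => ?_, ENNReal.coe_ne_top⟩
  obtain ⟨x, hx⟩ := hu.le.exists
  rw [h0, zero_mul] at hx
  exact (hu.weight.avg_ne x one_pos).1
    (le_zero_iff.1 ((avg_le_maximal one_pos (mem_closedBall_self zero_le_one)).trans hx))

theorem A1.avg_mul_rpow_neg_le (hω : A1 L ω) (w : (Fin n → ℝ) → ℝ≥0∞) (c : Fin n → ℝ) {r : ℝ}
    (hr : 0 < r) {e : ℝ} (he : 0 ≤ e) :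
    avg c r (fun y => w y * ω y ^ (-e)) ≤ (L : ℝ≥0∞) ^ e * avg c r ω ^ (-e) * avg c r w := by
  have hne := hω.weight.avg_ne c hr
  rw [← avg_const_mul (mul_ne_zero_top (rpow_ne_zero_top hω.coe_ne e)
    (rpow_ne_zero_top hne (-e))).2]
  refine avg_mono_restrict ?_
  filter_upwards [hω.ae_avg_le c hr] with y hy
  rw [mul_comm]
  gcongr
  exact rpow_neg_le_of_le_mul hne.1 hω.coe_ne hy he

theorem A1.isWeight_mul_rpow_neg (hω : A1 L ω) (hw : IsWeight w) {e : ℝ} (he : 0 ≤ e) :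
    IsWeight (fun x => w x * ω x ^ (-e)) := by
  have hwm := hw.aemeasurable
  have hωm := hω.weight.aemeasurable
  refine isWeight_of_avg_ne_top (by fun_prop) ?_ fun c r hr => ?_
  · filter_upwards [hw.ae_ne, hω.weight.ae_ne] with x h1 h2
    exact mul_ne_zero_top h1 (rpow_ne_zero_top h2 _)
  · exact ne_top_of_le_ne_top (mul_ne_zero_top (mul_ne_zero_top (rpow_ne_zero_top hω.coe_ne e)
      (rpow_ne_zero_top (hω.weight.avg_ne c hr) (-e))) (hw.avg_ne c hr)).2
      (hω.avg_mul_rpow_neg_le w c hr he)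

theorem A1.ap (hu : A1 K u) (hω : A1 L ω) {e : ℝ} (he : 0 < e) :
    Ap (1 + e) (K * L ^ e) (fun x => u x * ω x ^ (-e)) where
  weight := hω.isWeight_mul_rpow_neg hu.weight he.le
  le c r hr := by
    have hdual : avg c r (dualWeight (1 + e) fun y => u y * ω y ^ (-e)) ≤
        (K : ℝ≥0∞) ^ (1 / e) * avg c r u ^ (-(1 / e)) * avg c r ω := by
      refine le_trans (le_of_eq (avg_congr ?_)) (hu.avg_mul_rpow_neg_le ω c hr (e := 1 / e)
        (by positivity))
      filter_upwards [ae_restrict_of_ae hu.weight.ae_ne, ae_restrict_of_ae hω.weight.ae_ne]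
        with x hx hx'
      obtain ⟨s, hs⟩ := exists_eq_eexp hx
      obtain ⟨t, ht⟩ := exists_eq_eexp hx'
      simp only [dualWeight, add_sub_cancel_left, hs, ht, eexp_rpow, eexp_mul]
      congr 1
      field_simp
      ring
    rw [add_sub_cancel_left]
    refine (mul_le_mul' (hω.avg_mul_rpow_neg_le u c hr he.le)
      (ENNReal.rpow_le_rpow hdual he.le)).trans (le_of_eq ?_)
    obtain ⟨s, hs⟩ := exists_eq_eexp (hu.weight.avg_ne c hr)
    obtain ⟨t, ht⟩ := exists_eq_eexp (hω.weight.avg_ne c hr)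
    obtain ⟨k, hk⟩ := exists_eq_eexp hu.coe_ne
    obtain ⟨l, hl⟩ := exists_eq_eexp hω.coe_ne
    simp only [ENNReal.coe_mul, ENNReal.coe_rpow_of_nonneg _ he.le, hs, ht, hk, hl, eexp_rpow,
      eexp_mul]
    congr 1
    field_simp
    ring

theorem avg_mul_rpow_neg_rpow_le {s e : ℝ} (hs : 1 < s) (he : 0 < e) (hw : IsWeight w)
    (hω : IsWeight ω) (c : Fin n → ℝ) (r : ℝ) :
    avg c r (dualWeight (s + e) fun y => w y * ω y ^ (-e)) ^ (s + e - 1) ≤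
      avg c r (dualWeight s w) ^ (s - 1) * avg c r ω ^ e := by
  have hs1 : 0 < s - 1 := by linarith
  have hse : 0 < s + e - 1 := by linarith
  have hwm := hw.aemeasurable
  have holder : avg c r (dualWeight (s + e) fun y => w y * ω y ^ (-e)) ≤
      avg c r (dualWeight s w) ^ ((s - 1) / (s + e - 1)) * avg c r ω ^ (e / (s + e - 1)) := by
    refine le_trans (le_of_eq (avg_congr ?_)) (avg_rpow_mul_rpow_le (by fun_prop) hω.aemeasurable
      (by positivity) (by positivity) (by field_simp; ring) c r)
    filter_upwards [ae_restrict_of_ae hw.ae_ne, ae_restrict_of_ae hω.ae_ne] with x hx hx'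
    obtain ⟨a, ha⟩ := exists_eq_eexp hx
    obtain ⟨b, hb⟩ := exists_eq_eexp hx'
    simp only [dualWeight, ha, hb, eexp_rpow, eexp_mul]
    congr 1
    field_simp
    ring
  refine (ENNReal.rpow_le_rpow holder hse.le).trans_eq ?_
  rw [ENNReal.mul_rpow_of_nonneg _ _ hse.le, ← ENNReal.rpow_mul, ← ENNReal.rpow_mul,
    div_mul_cancel₀ _ hse.ne', div_mul_cancel₀ _ hse.ne']

theorem Ap.mul_rpow_neg {s : ℝ} (hs : 1 < s) (hw : Ap s K w) (hω : A1 L ω) {e : ℝ} (he : 0 < e) :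
    Ap (s + e) (K * L ^ e) (fun x => w x * ω x ^ (-e)) where
  weight := hω.isWeight_mul_rpow_neg hw.weight he.le
  le c r hr := by
    obtain ⟨t, ht⟩ := exists_eq_eexp (hω.weight.avg_ne c hr)
    calc _ ≤ (L : ℝ≥0∞) ^ e * avg c r ω ^ (-e) * avg c r w *
          (avg c r (dualWeight s w) ^ (s - 1) * avg c r ω ^ e) :=
          mul_le_mul' (hω.avg_mul_rpow_neg_le w c hr he.le)
            (avg_mul_rpow_neg_rpow_le hs he hw.weight hω.weight c r)
      _ = avg c r w * avg c r (dualWeight s w) ^ (s - 1) * (L : ℝ≥0∞) ^ e *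
          (avg c r ω ^ (-e) * avg c r ω ^ e) := by ring
      _ = avg c r w * avg c r (dualWeight s w) ^ (s - 1) * (L : ℝ≥0∞) ^ e := by
          rw [ht, eexp_rpow, eexp_rpow, eexp_mul, mul_neg, neg_add_cancel, eexp_zero, mul_one]
      _ ≤ K * (L : ℝ≥0∞) ^ e := by
          gcongr
          exact hw.le c r hr
      _ = _ := by rw [ENNReal.coe_mul, ENNReal.coe_rpow_of_nonneg _ he.le]

end Weights

section ApWeights

variable {n : ℕ} {p q : ℝ} {K L : ℝ≥0} {f v w w' : (Fin n → ℝ) → ℝ≥0∞}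

theorem one_sub_div_sub_one (hq : 1 < q) : 1 - q / (q - 1) = -(1 / (q - 1)) := by
  have : q - 1 ≠ 0 := by linarith
  field_simp
  ring

theorem one_lt_div_sub_one (hp : 1 < p) : 1 < p / (p - 1) := by
  rw [lt_div_iff₀ (by linarith)]
  linarith

theorem Ap.isAq (hq : 1 < q) (hw : Ap q K w) : IsAq q w := by
  refine ⟨hw.weight, lt_of_le_of_lt (b := (K : ℝ≥0∞)) ?_ ENNReal.coe_lt_top⟩
  refine iSup_le fun c => iSup_le fun r => iSup_le fun hr => ?_
  rw [one_sub_div_sub_one hq]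
  exact hw.le c r hr

theorem IsAq.exists_ap (hq : 1 < q) (hw : IsAq q w) : ∃ K : ℝ≥0, Ap q K w := by
  refine ⟨(aqConst q w).toNNReal, hw.1, fun c r hr => ?_⟩
  unfold dualWeight
  rw [ENNReal.coe_toNNReal hw.2.ne, ← one_sub_div_sub_one hq]
  exact le_iSup_of_le c <| le_iSup_of_le r <| le_iSup_of_le hr le_rfl

theorem Ap.congr (hw : Ap p K w) (h : w =ᵐ[volume] w') : Ap p K w' where
  weight := hw.weight.congr h
  le c r hr := by
    have hdual : dualWeight p w =ᵐ[volume] dualWeight p w' := h.fun_comp (· ^ (-(1 / (p - 1))))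
    rw [← avg_congr (ae_restrict_of_ae h), ← avg_congr (ae_restrict_of_ae hdual)]
    exact hw.le c r hr

theorem Ap.mono_exponent (hp : 1 < p) (hpq : p ≤ q) (hw : Ap p K w) : Ap q K w where
  weight := hw.weight
  le c r hr := by
    refine le_trans ?_ (hw.le c r hr)
    have hwm := hw.weight.aemeasurable
    have hp1 : 0 < p - 1 := by linarith
    have hq1 : 0 < q - 1 := by linarith
    have hjensen := avg_rpow_le (f := dualWeight p w) (by fun_prop) (a := (p - 1) / (q - 1))
      (by positivity) (by rw [div_le_one hq1]; linarith) c hr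
    have hdual : dualWeight q w = fun y => dualWeight p w y ^ ((p - 1) / (q - 1)) := by
      ext y
      rw [dualWeight, dualWeight, ← ENNReal.rpow_mul]
      congr 1
      field_simp
    gcongr
    calc avg c r (dualWeight q w) ^ (q - 1)
        ≤ (avg c r (dualWeight p w) ^ ((p - 1) / (q - 1))) ^ (q - 1) := by
          rw [hdual]
          exact ENNReal.rpow_le_rpow hjensen hq1.le
      _ = avg c r (dualWeight p w) ^ (p - 1) := by
          rw [← ENNReal.rpow_mul, div_mul_cancel₀ _ hq1.ne']

theorem Ap.isWeight_dualWeight (hp : 1 < p) (hw : Ap p K w) : IsWeight (dualWeight p w) := by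
  have hwm := hw.weight.aemeasurable
  refine isWeight_of_avg_ne_top (by fun_prop) (hw.weight.ae_ne.mono fun x hx =>
    rpow_ne_zero_top hx _) fun c r hr h => ?_
  have hle := hw.le c r hr
  rw [h, ENNReal.top_rpow_of_pos (by linarith), ENNReal.mul_top (hw.weight.avg_ne c hr).1] at hle
  exact ENNReal.coe_ne_top (top_le_iff.1 hle)

theorem dualWeight_dualWeight (hp : 1 < p) (w : (Fin n → ℝ) → ℝ≥0∞) :
    dualWeight (p / (p - 1)) (dualWeight p w) = w := by
  have hp1 : p - 1 ≠ 0 := by linarith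
  ext y
  rw [dualWeight, dualWeight, ← ENNReal.rpow_mul,
    show -(1 / (p - 1)) * -(1 / (p / (p - 1) - 1)) = 1 by field_simp; ring, ENNReal.rpow_one]

theorem Ap.dual (hp : 1 < p) (hw : Ap p K w) :
    Ap (p / (p - 1)) (K ^ (1 / (p - 1))) (dualWeight p w) where
  weight := hw.isWeight_dualWeight hp
  le c r hr := by
    have hp1 : 0 < p - 1 := by linarith
    rw [dualWeight_dualWeight hp, show p / (p - 1) - 1 = 1 / (p - 1) by field_simp; ring,
      ENNReal.coe_rpow_of_nonneg _ (by positivity)]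
    calc _ = (avg c r w * avg c r (dualWeight p w) ^ (p - 1)) ^ (1 / (p - 1)) := by
          rw [ENNReal.mul_rpow_of_nonneg _ _ (by positivity), ← ENNReal.rpow_mul,
            mul_one_div_cancel hp1.ne', ENNReal.rpow_one, mul_comm]
      _ ≤ _ := ENNReal.rpow_le_rpow (hw.le c r hr) (by positivity)

theorem lintegral_withDensity_mul (hw : AEMeasurable w) (hf : AEMeasurable f) :
    ∫⁻ x, f x ∂(volume.withDensity w) = ∫⁻ x, w x * f x :=
  lintegral_withDensity_eq_lintegral_mul₀ hw hf

theorem withDensity_closedBall (w : (Fin n → ℝ) → ℝ≥0∞) (c : Fin n → ℝ) {r : ℝ} (hr : 0 < r) :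
    (volume.withDensity w) (closedBall c r) = volume (closedBall c r) * avg c r w := by
  rw [withDensity_apply _ measurableSet_closedBall, setLIntegral_eq_mul_avg _ _ hr]

theorem IsWeight.avg_mul_ballAvg_withDensity (hw : IsWeight w) (hf : AEMeasurable f)
    (c : Fin n → ℝ) {r : ℝ} (hr : 0 < r) :
    avg c r w * ballAvg (volume.withDensity w) c r f = avg c r fun y => w y * f y := by
  have hne := hw.avg_ne c hr
  rw [ballAvg, withDensity_closedBall _ _ hr, restrict_withDensity measurableSet_closedBall,
    lintegral_withDensity_eq_lintegral_mul₀ hw.aemeasurable.restrict hf.restrict,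
    ENNReal.mul_inv (Or.inl (measure_closedBall_pos volume c hr).ne')
      (Or.inl measure_closedBall_lt_top.ne), ← mul_assoc, mul_left_comm,
    ENNReal.mul_inv_cancel hne.1 hne.2, mul_one]
  rfl

theorem IsWeight.one_le_avg_mul_avg_dualWeight (hp : 1 < p) (hw : IsWeight w) (c : Fin n → ℝ)
    {r : ℝ} (hr : 0 < r) : 1 ≤ avg c r w * avg c r (dualWeight p w) ^ (p - 1) := by
  have hp1 : 0 < p - 1 := by linarith
  have hwm := hw.aemeasurable
  have holder := avg_rpow_mul_rpow_le (f := w) (g := dualWeight p w) hwm (by fun_prop) (a := 1 / p)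
    (b := (p - 1) / p) (by positivity) (by positivity) (by field_simp; ring) c r
  have hone : avg c r (fun y => w y ^ (1 / p) * dualWeight p w y ^ ((p - 1) / p)) = 1 := by
    rw [← avg_const (c := c) hr 1]
    refine avg_congr ?_
    filter_upwards [ae_restrict_of_ae hw.ae_ne] with x hx
    obtain ⟨s, hs⟩ := exists_eq_eexp hx
    simp only [dualWeight, hs, eexp_rpow, eexp_mul]
    rw [← eexp_zero]
    congr 1
    field_simp
    ring
  have hpow := ENNReal.rpow_le_rpow (hone ▸ holder) (by linarith : 0 ≤ p)
  rwa [ENNReal.one_rpow, ENNReal.mul_rpow_of_nonneg _ _ (by linarith), ← ENNReal.rpow_mul,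
    ← ENNReal.rpow_mul, one_div_mul_cancel (by linarith), div_mul_cancel₀ _ (by linarith),
    ENNReal.rpow_one] at hpow

theorem avg_le_mul_avg {c : Fin n → ℝ} {r : ℝ} (hr : 0 < r) :
    avg c r f ≤ 5 ^ n * avg c (5 * r) f := by
  refine avg_le_of_setLIntegral_le hr ?_
  have hvol := volume_closedBall_mul (k := 5) (by norm_num) hr.le c c
  rw [ENNReal.ofReal_pow (by norm_num), ENNReal.ofReal_ofNat] at hvol
  rw [← mul_assoc, mul_comm (volume _), ← hvol, ← setLIntegral_eq_mul_avg _ _ (by positivity)]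
  exact lintegral_mono_set (closedBall_subset_closedBall (by linarith))

theorem Ap.isDoubling (hp : 1 < p) (hw : Ap p K w) :
    IsDoubling (volume.withDensity w) (K * (5 ^ n) ^ p) where
  pos c r hr := by
    rw [withDensity_closedBall _ _ hr]
    exact ENNReal.mul_pos (measure_closedBall_pos volume c hr).ne' (hw.weight.avg_ne c hr).1
  lt_top c r := by
    rw [withDensity_apply _ measurableSet_closedBall]
    exact hw.weight.locally_integrable c r
  le_mul c r hr := by
    have hp1 : 0 < p - 1 := by linarith
    have hone : 1 ≤ avg c r w * (5 ^ n * avg c (5 * r) (dualWeight p w)) ^ (p - 1) :=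
      (hw.weight.one_le_avg_mul_avg_dualWeight hp c hr).trans (by gcongr; exact avg_le_mul_avg hr)
    have hpow : (5 ^ n : ℝ≥0∞) * (5 ^ n) ^ (p - 1) = (5 ^ n) ^ p := by
      nth_rewrite 1 [← ENNReal.rpow_one (5 ^ n)]
      rw [← ENNReal.rpow_add_of_nonneg _ _ zero_le_one hp1.le, add_sub_cancel]
    have hvol := isDoubling_volume.le_mul c r hr
    rw [withDensity_closedBall _ _ (by positivity), withDensity_closedBall _ _ hr]
    calc volume (closedBall c (5 * r)) * avg c (5 * r) w
        ≤ (5 ^ n : ℝ≥0) * volume (closedBall c r) * avg c (5 * r) w *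
          (avg c r w * (5 ^ n * avg c (5 * r) (dualWeight p w)) ^ (p - 1)) := by
          refine le_mul_of_le_of_one_le ?_ hone
          gcongr
      _ = (avg c (5 * r) w * avg c (5 * r) (dualWeight p w) ^ (p - 1)) *
          (5 ^ n * (5 ^ n) ^ (p - 1)) * (volume (closedBall c r) * avg c r w) := by
          rw [ENNReal.mul_rpow_of_nonneg _ _ hp1.le]
          push_cast
          ring
      _ ≤ K * (5 ^ n) ^ p * (volume (closedBall c r) * avg c r w) := by
          rw [hpow]
          gcongr
          exact hw.le c (5 * r) (by positivity)
      _ = _ := by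
          rw [ENNReal.coe_mul, ENNReal.coe_rpow_of_nonneg _ (by linarith)]
          push_cast
          rfl

/-- The maximal function of `f / σ` with respect to the measure `σ dx`, where `σ` is the dual
weight of `w`. It is bounded on `L^p(σ)` whenever `w ∈ A_p`. -/
noncomputable def dualMaximal (p : ℝ) (w f : (Fin n → ℝ) → ℝ≥0∞) : (Fin n → ℝ) → ℝ≥0∞ :=
  ballMaximal (volume.withDensity (dualWeight p w)) fun y => (dualWeight p w y)⁻¹ * f y

theorem Ap.measurable_dualMaximal (hp : 1 < p) (hw : Ap p K w) (f : (Fin n → ℝ) → ℝ≥0∞) :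
    Measurable (dualMaximal p w f) :=
  ((hw.dual hp).isDoubling (one_lt_div_sub_one hp)).measurable_ballMaximal

theorem Ap.avg_rpow_le (hp : 1 < p) (hw : Ap p K w) (hf : AEMeasurable f) (c : Fin n → ℝ) {r : ℝ}
    (hr : 0 < r) : avg c r f ^ (p - 1) ≤ K * ballAvg (volume.withDensity w) c r
      fun y => dualMaximal p w f y ^ (p - 1) * (w y)⁻¹ := by
  have hp1 : 0 < p - 1 := by linarith
  have hσ := hw.isWeight_dualWeight hp
  have hwm := hw.weight.aemeasurable
  have hmm := hw.measurable_dualMaximal hp f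
  set σ := dualWeight p w
  set A := ballAvg (volume.withDensity σ) c r fun y => (σ y)⁻¹ * f y with hA
  set B := ballAvg (volume.withDensity w) c r fun y => dualMaximal p w f y ^ (p - 1) * (w y)⁻¹
    with hB
  have hfA : avg c r f = avg c r σ * A := by
    rw [hA, hσ.avg_mul_ballAvg_withDensity (by fun_prop) c hr]
    refine avg_congr ?_
    filter_upwards [ae_restrict_of_ae hσ.ae_ne] with y hy
    rw [← mul_assoc, ENNReal.mul_inv_cancel hy.1 hy.2, one_mul]
  have hAB : A ^ (p - 1) ≤ avg c r w * B := by
    rw [hB, hw.weight.avg_mul_ballAvg_withDensity (by fun_prop) c hr,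
      ← avg_const (c := c) hr (A ^ (p - 1))]
    refine avg_mono_restrict ?_
    filter_upwards [ae_restrict_of_ae hw.weight.ae_ne, ae_restrict_mem measurableSet_closedBall]
      with y hy hyc
    rw [mul_left_comm, ENNReal.mul_inv_cancel hy.1 hy.2, mul_one]
    exact ENNReal.rpow_le_rpow (ballAvg_le_ballMaximal hr hyc) hp1.le
  calc avg c r f ^ (p - 1) = avg c r σ ^ (p - 1) * A ^ (p - 1) := by
        rw [hfA, ENNReal.mul_rpow_of_nonneg _ _ hp1.le]
    _ ≤ avg c r σ ^ (p - 1) * (avg c r w * B) := by gcongr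
    _ = avg c r w * avg c r σ ^ (p - 1) * B := by ring
    _ ≤ K * B := by
        gcongr
        exact hw.le c r hr

theorem Ap.maximal_rpow_le (hp : 1 < p) (hw : Ap p K w) (hf : AEMeasurable f) (x : Fin n → ℝ) :
    maximal f x ^ (p - 1) ≤ K * ballMaximal (volume.withDensity w)
      (fun y => dualMaximal p w f y ^ (p - 1) * (w y)⁻¹) x := by
  have hp1 : 0 < p - 1 := by linarith
  rw [← ENNReal.le_rpow_inv_iff hp1]
  refine maximal_le fun c r hr hx => ?_
  rw [ENNReal.le_rpow_inv_iff hp1]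
  exact (hw.avg_rpow_le hp hf c hr).trans (by gcongr; exact ballAvg_le_ballMaximal hr hx)

theorem Ap.lintegral_maximal_rpow_mul_le (hp : 1 < p) (hw : Ap p K w) (hf : AEMeasurable f) :
    ∫⁻ x, maximal f x ^ p * w x ≤ (K : ℝ≥0∞) ^ (p / (p - 1)) *
      ∫⁻ x, ballMaximal (volume.withDensity w)
        (fun y => dualMaximal p w f y ^ (p - 1) * (w y)⁻¹) x ^ (p / (p - 1))
        ∂(volume.withDensity w) := by
  have hp1 : 0 < p - 1 := by linarith
  set G := ballMaximal (volume.withDensity w) fun y => dualMaximal p w f y ^ (p - 1) * (w y)⁻¹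
  have hGm : Measurable G := (hw.isDoubling hp).measurable_ballMaximal
  rw [lintegral_withDensity_mul hw.weight.aemeasurable (by fun_prop),
    ← lintegral_const_mul' _ _ (by finiteness)]
  refine lintegral_mono fun x => ?_
  calc maximal f x ^ p * w x = (maximal f x ^ (p - 1)) ^ (p / (p - 1)) * w x := by
        rw [← ENNReal.rpow_mul, mul_div_cancel₀ _ hp1.ne']
    _ ≤ (K * G x) ^ (p / (p - 1)) * w x := by
        gcongr
        exact hw.maximal_rpow_le hp hf x
    _ = _ := by
        rw [ENNReal.mul_rpow_of_nonneg _ _ (by positivity)]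
        ring

theorem IsWeight.lintegral_rpow_mul_inv_withDensity (hp : 1 < p) (hw : IsWeight w)
    (hf : AEMeasurable f) :
    ∫⁻ x, (f x ^ (p - 1) * (w x)⁻¹) ^ (p / (p - 1)) ∂(volume.withDensity w) =
      ∫⁻ x, f x ^ p ∂(volume.withDensity (dualWeight p w)) := by
  have hp1 : 0 < p - 1 := by linarith
  have hwm := hw.aemeasurable
  rw [lintegral_withDensity_mul hwm (by fun_prop),
    lintegral_withDensity_mul (by fun_prop) (by fun_prop)]
  refine lintegral_congr_ae ?_
  filter_upwards [hw.ae_ne] with x hx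
  obtain ⟨s, hs⟩ := exists_eq_eexp hx
  rw [ENNReal.mul_rpow_of_nonneg _ _ (by positivity), ← ENNReal.rpow_mul,
    mul_div_cancel₀ _ hp1.ne', mul_left_comm, mul_comm]
  simp only [dualWeight, hs, eexp_rpow, eexp_inv, eexp_mul]
  congr 2
  field_simp
  ring

theorem IsWeight.lintegral_inv_mul_rpow_withDensity (hp : 1 < p) (hw : IsWeight w)
    (hf : AEMeasurable f) :
    ∫⁻ x, ((dualWeight p w x)⁻¹ * f x) ^ p ∂(volume.withDensity (dualWeight p w)) =
      ∫⁻ x, f x ^ p * w x := by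
  have hp1 : 0 < p - 1 := by linarith
  have hwm := hw.aemeasurable
  rw [lintegral_withDensity_mul (by fun_prop) (by fun_prop)]
  refine lintegral_congr_ae ?_
  filter_upwards [hw.ae_ne] with x hx
  obtain ⟨s, hs⟩ := exists_eq_eexp hx
  rw [ENNReal.mul_rpow_of_nonneg _ _ (by linarith), ← mul_assoc, mul_comm]
  simp only [dualWeight, hs, eexp_rpow, eexp_inv, eexp_mul]
  congr 2
  field_simp
  ring

theorem exists_lintegral_maximal_rpow_le (n : ℕ) (hp : 1 < p) (K : ℝ≥0) :
    ∃ C : ℝ≥0, 1 ≤ C ∧ ∀ w f : (Fin n → ℝ) → ℝ≥0∞, Ap p K w → AEMeasurable f →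
      ∫⁻ x, maximal f x ^ p * w x ≤ C * ∫⁻ x, f x ^ p * w x := by
  have hq := one_lt_div_sub_one hp
  set C₁ : ℝ≥0∞ := 2 ^ (p / (p - 1)) *
    ((K * (5 ^ n) ^ p : ℝ≥0) * ENNReal.ofReal (p / (p - 1) / (p / (p - 1) - 1)))
  set C₂ : ℝ≥0∞ := 2 ^ p * ((K ^ (1 / (p - 1)) * (5 ^ n) ^ (p / (p - 1)) : ℝ≥0) *
    ENNReal.ofReal (p / (p - 1)))
  obtain ⟨C, hC⟩ : ∃ C : ℝ≥0, (C : ℝ≥0∞) = K ^ (p / (p - 1)) * C₁ * C₂ :=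
    ENNReal.canLift.prf _ (by finiteness)
  refine ⟨max 1 C, le_max_left _ _, fun w f hw hf => ?_⟩
  have hwm := hw.weight.aemeasurable
  have hmm := hw.measurable_dualMaximal hp f
  have hbound₁ := (hw.isDoubling hp).lintegral_ballMaximal_rpow_le hq
    (f := fun y => dualMaximal p w f y ^ (p - 1) * (w y)⁻¹)
    (AEMeasurable.mono_ac (by fun_prop) (withDensity_absolutelyContinuous volume w))
  have hbound₂ := ((hw.dual hp).isDoubling hq).lintegral_ballMaximal_rpow_le hp
    (f := fun y => (dualWeight p w y)⁻¹ * f y)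
    (AEMeasurable.mono_ac (by fun_prop) (withDensity_absolutelyContinuous volume _))
  rw [hw.weight.lintegral_rpow_mul_inv_withDensity hp hmm.aemeasurable] at hbound₁
  rw [hw.weight.lintegral_inv_mul_rpow_withDensity hp hf] at hbound₂
  calc ∫⁻ x, maximal f x ^ p * w x
      ≤ (K : ℝ≥0∞) ^ (p / (p - 1)) * (C₁ * (C₂ * ∫⁻ x, f x ^ p * w x)) :=
        (hw.lintegral_maximal_rpow_mul_le hp hf).trans
          (mul_le_mul_right (hbound₁.trans (mul_le_mul_right hbound₂ _)) _)
    _ = C * ∫⁻ x, f x ^ p * w x := by rw [hC]; ring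
    _ ≤ _ := by
        gcongr
        exact le_max_right _ _

theorem IsWeight.setLIntegral_le_rpow_mul_rpow (hp : 1 < p) (hw : IsWeight w) (hf : AEMeasurable f)
    (s : Set (Fin n → ℝ)) : ∫⁻ x in s, f x ≤
      (∫⁻ x in s, f x ^ (p / (p - 1)) * dualWeight p w x) ^ ((p - 1) / p) *
        (∫⁻ x in s, w x) ^ (1 / p) := by
  have hp1 : 0 < p - 1 := by linarith
  have hwm := hw.aemeasurable
  refine le_trans (le_of_eq (lintegral_congr_ae ?_)) (ENNReal.lintegral_mul_norm_pow_le
    (AEMeasurable.restrict (by fun_prop)) hwm.restrict (by positivity) (by positivity)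
    (by field_simp; ring))
  filter_upwards [ae_restrict_of_ae hw.ae_ne] with x hx
  obtain ⟨s, hs⟩ := exists_eq_eexp hx
  rw [ENNReal.mul_rpow_of_nonneg _ _ (by positivity), ← ENNReal.rpow_mul, mul_assoc]
  simp only [dualWeight, hs, eexp_rpow, eexp_mul]
  rw [show p / (p - 1) * ((p - 1) / p) = 1 by field_simp, ENNReal.rpow_one,
    show s * -(1 / (p - 1)) * ((p - 1) / p) + s * (1 / p) = 0 by field_simp; ring, eexp_zero,
    mul_one]

theorem IsWeight.lintegral_indicator_rpow_mul_dualWeight (hp : 1 < p) (hw : IsWeight w)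
    {s : Set (Fin n → ℝ)} (hs : MeasurableSet s) :
    ∫⁻ x, s.indicator w x ^ (p / (p - 1)) * dualWeight p w x = ∫⁻ x in s, w x := by
  have hp1 : 0 < p - 1 := by linarith
  rw [← lintegral_indicator hs]
  refine lintegral_congr_ae ?_
  filter_upwards [hw.ae_ne] with x hx
  by_cases hxs : x ∈ s
  · simp only [indicator_of_mem hxs]
    obtain ⟨t, ht⟩ := exists_eq_eexp hx
    simp only [dualWeight, ht, eexp_rpow, eexp_mul]
    congr 1
    field_simp
    ring
  · simp only [indicator_of_notMem hxs]
    rw [ENNReal.zero_rpow_of_pos (by positivity), zero_mul]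

theorem exists_aInftyConst_le (n : ℕ) (hp : 1 < p) (K : ℝ≥0) :
    ∃ C : ℝ≥0, ∀ w : (Fin n → ℝ) → ℝ≥0∞, Ap p K w → aInftyConst w ≤ C := by
  obtain ⟨C, -, hC⟩ :=
    exists_lintegral_maximal_rpow_le n (one_lt_div_sub_one hp) (K ^ (1 / (p - 1)))
  refine ⟨C ^ ((p - 1) / p), fun w hw => iSup_le fun c => iSup_le fun r => iSup_le fun hr => ?_⟩
  have hI0 : ∫⁻ y in closedBall c r, w y ≠ 0 := by
    rw [setLIntegral_eq_mul_avg _ _ hr]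
    exact mul_ne_zero (measure_closedBall_pos volume c hr).ne' (hw.weight.avg_ne c hr).1
  have hI1 := (hw.weight.locally_integrable c r).ne
  have hstrong := hC _ ((closedBall c r).indicator w) (hw.dual hp)
    (hw.weight.aemeasurable.indicator measurableSet_closedBall)
  rw [hw.weight.lintegral_indicator_rpow_mul_dualWeight hp measurableSet_closedBall] at hstrong
  set I := ∫⁻ y in closedBall c r, w y
  calc I⁻¹ * ∫⁻ x in closedBall c r, maximal ((closedBall c r).indicator w) x
      ≤ I⁻¹ * ((C * I) ^ ((p - 1) / p) * I ^ (1 / p)) := by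
        refine mul_le_mul_right ((hw.weight.setLIntegral_le_rpow_mul_rpow hp
          measurable_maximal.aemeasurable _).trans ?_) _
        gcongr
        exact (setLIntegral_le_lintegral _ _).trans hstrong
    _ = I⁻¹ * ((C : ℝ≥0∞) ^ ((p - 1) / p) * I) := by
        rw [ENNReal.mul_rpow_of_nonneg _ _ (by positivity), mul_assoc,
          ← ENNReal.rpow_add_of_nonneg _ _ (by positivity) (by positivity),
          show (p - 1) / p + 1 / p = 1 by field_simp; ring, ENNReal.rpow_one]
    _ = _ := by
        rw [mul_left_comm, ENNReal.inv_mul_cancel hI0 hI1, mul_one,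
          ENNReal.coe_rpow_of_nonneg _ (by positivity)]

theorem Ap.const_mul (hp : 1 < p) (hw : Ap p K w) {a : ℝ≥0∞} (ha : a ≠ 0 ∧ a ≠ ∞) :
    Ap p K (fun x => a * w x) where
  weight := by
    have hwm := hw.weight.aemeasurable
    refine isWeight_of_avg_ne_top (by fun_prop) (hw.weight.ae_ne.mono fun x hx =>
      mul_ne_zero_top ha hx) fun c r hr => ?_
    rw [avg_const_mul ha.2]
    exact (mul_ne_zero_top ha (hw.weight.avg_ne c hr)).2
  le c r hr := by
    have hp1 : 0 < p - 1 := by linarith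
    have hdual : avg c r (dualWeight p fun x => a * w x) =
        a ^ (-(1 / (p - 1))) * avg c r (dualWeight p w) := by
      rw [← avg_const_mul (rpow_ne_zero_top ha _).2]
      refine avg_congr ?_
      filter_upwards [ae_restrict_of_ae hw.weight.ae_ne] with x hx
      exact ENNReal.mul_rpow_of_ne_zero ha.1 hx.1 _
    rw [hdual, avg_const_mul ha.2, ENNReal.mul_rpow_of_nonneg _ _ hp1.le, mul_mul_mul_comm]
    obtain ⟨s, rfl⟩ := exists_eq_eexp ha
    rw [eexp_rpow, eexp_rpow, eexp_mul, show s + s * -(1 / (p - 1)) * (p - 1) = 0 by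
      field_simp; ring, eexp_zero, one_mul]
    exact hw.le c r hr

theorem avg_dualWeight_inf_le (hw : AEMeasurable w) (v : (Fin n → ℝ) → ℝ≥0∞) (c : Fin n → ℝ)
    (r : ℝ) : avg c r (dualWeight p fun x => min (w x) (v x)) ≤
      avg c r (dualWeight p w) + avg c r (dualWeight p v) := by
  have hadd : avg c r (dualWeight p w) + avg c r (dualWeight p v) =
      avg c r fun x => dualWeight p w x + dualWeight p v x := by
    unfold avg
    rw [lintegral_add_left' (AEMeasurable.restrict (by fun_prop)), mul_add]
  rw [hadd]
  refine avg_mono (Eventually.of_forall fun y => ?_) c r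
  rcases min_choice (w y) (v y) with h | h <;> simp only [dualWeight, h]
  · exact le_self_add
  · exact le_add_self

theorem Ap.inf (hp : 1 < p) (hw : Ap p K w) (hv : Ap p L v) :
    Ap p (2 ^ (p - 1) * (K + L)) (fun x => min (w x) (v x)) where
  weight := by
    have hwm := hw.weight.aemeasurable
    have hvm := hv.weight.aemeasurable
    refine isWeight_of_avg_ne_top (by fun_prop) ?_ fun c r hr =>
      ne_top_of_le_ne_top (hw.weight.avg_ne c hr).2
        (avg_mono (Eventually.of_forall fun x => min_le_left _ _) c r)
    filter_upwards [hw.weight.ae_ne, hv.weight.ae_ne] with x hx hx'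
    rcases min_choice (w x) (v x) with h | h <;> rw [h] <;> assumption
  le c r hr := by
    have hp1 : 0 < p - 1 := by linarith
    set A := avg c r (dualWeight p w)
    set B := avg c r (dualWeight p v)
    set m := avg c r fun x => min (w x) (v x)
    have hmw : m ≤ avg c r w := avg_mono (Eventually.of_forall fun x => min_le_left _ _) c r
    have hmv : m ≤ avg c r v := avg_mono (Eventually.of_forall fun x => min_le_right _ _) c r
    have hmax : m * max A B ^ (p - 1) ≤ K + L := by
      rcases max_choice A B with h | h <;> rw [h]
      · exact (mul_le_mul_left hmw _).trans ((hw.le c r hr).trans le_self_add)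
      · exact (mul_le_mul_left hmv _).trans ((hv.le c r hr).trans le_add_self)
    calc m * avg c r (dualWeight p fun x => min (w x) (v x)) ^ (p - 1)
        ≤ m * (2 * max A B) ^ (p - 1) := by
          gcongr
          refine (avg_dualWeight_inf_le hw.weight.aemeasurable v c r).trans ?_
          rw [two_mul]
          exact add_le_add (le_max_left _ _) (le_max_right _ _)
      _ = 2 ^ (p - 1) * (m * max A B ^ (p - 1)) := by
          rw [ENNReal.mul_rpow_of_nonneg _ _ hp1.le]
          ring
      _ ≤ 2 ^ (p - 1) * (K + L) := by gcongr
      _ = _ := by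
          rw [ENNReal.coe_mul, ENNReal.coe_rpow_of_nonneg _ hp1.le]
          push_cast
          rfl

theorem avg_dualWeight_mul_rpow_le (hp : 1 < p) {A : ℝ≥0∞} (hA : A ≠ 0 ∧ A ≠ ∞) (hL : L ≠ 0)
    {c : Fin n → ℝ} {r : ℝ} (h : ∀ᵐ y ∂(volume.restrict (closedBall c r)), A ≤ L * f y)
    (hw : ∀ᵐ x, w x ≠ 0) (hf : ∀ᵐ x, f x ≠ 0) :
    avg c r (dualWeight p fun x => w x * f x) ^ (p - 1) ≤
      L * A⁻¹ * avg c r (dualWeight p w) ^ (p - 1) := by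
  have hp1 : 0 < p - 1 := by linarith
  have hL' : (L : ℝ≥0∞) ≠ 0 ∧ (L : ℝ≥0∞) ≠ ∞ := ⟨by simpa using hL, ENNReal.coe_ne_top⟩
  have havg : avg c r (dualWeight p fun x => w x * f x) ≤
      (L : ℝ≥0∞) ^ (1 / (p - 1)) * A ^ (-(1 / (p - 1))) * avg c r (dualWeight p w) := by
    rw [← avg_const_mul (mul_ne_zero_top (rpow_ne_zero_top hL' _) (rpow_ne_zero_top hA _)).2]
    refine avg_mono_restrict ?_
    filter_upwards [h, ae_restrict_of_ae hw, ae_restrict_of_ae hf] with y hy hwy hfy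
    rw [dualWeight, ENNReal.mul_rpow_of_ne_zero hwy hfy, mul_comm]
    gcongr
    exact rpow_neg_le_of_le_mul hA.1 hL' hy (by positivity)
  refine (ENNReal.rpow_le_rpow havg hp1.le).trans_eq ?_
  rw [ENNReal.mul_rpow_of_nonneg _ _ hp1.le, ENNReal.mul_rpow_of_nonneg _ _ hp1.le,
    ← ENNReal.rpow_mul, ← ENNReal.rpow_mul, neg_mul, one_div_mul_cancel hp1.ne', ENNReal.rpow_one,
    ENNReal.rpow_neg_one]

theorem Ap.mul_of_ballMaximal_le (hp : 1 < p) (hw : Ap p K w) (hfm : AEMeasurable f)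
    (hf : ∀ᵐ x, f x ≠ 0 ∧ f x ≠ ∞)
    (hL : ∀ᵐ x, ballMaximal (volume.withDensity w) f x ≤ L * f x) :
    Ap p (K * L) (fun x => w x * f x) := by
  have hwm := hw.weight.aemeasurable
  have hne : ∀ᵐ x, w x * f x ≠ 0 ∧ w x * f x ≠ ∞ := by
    filter_upwards [hf, hw.weight.ae_ne] with x hx hx' using mul_ne_zero_top hx' hx
  have hfin : ∀ (c : Fin n → ℝ) (r : ℝ), 0 < r → ballAvg (volume.withDensity w) c r f ≠ ∞ := by
    intro c r hr
    obtain ⟨y, hyc, hLy, hfy⟩ := exists_mem_closedBall_of_ae (hL.and hf) c hr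
    exact ne_top_of_le_ne_top (ENNReal.mul_ne_top ENNReal.coe_ne_top hfy.2)
      ((ballAvg_le_ballMaximal hr hyc).trans hLy)
  have havg (c : Fin n → ℝ) {r : ℝ} (hr : 0 < r) :=
    hw.weight.avg_mul_ballAvg_withDensity hfm c hr
  refine ⟨isWeight_of_avg_ne_top (by fun_prop) hne fun c r hr => ?_, fun c r hr => ?_⟩
  · rw [← havg c hr]
    exact ENNReal.mul_ne_top (hw.weight.avg_ne c hr).2 (hfin c r hr)
  set A := ballAvg (volume.withDensity w) c r f with hA
  have hA' : A ≠ 0 ∧ A ≠ ∞ := by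
    refine ⟨fun h0 => avg_ne_zero (by fun_prop) (hne.mono fun x hx => hx.1) c hr ?_, hfin c r hr⟩
    rw [← havg c hr, ← hA, h0, mul_zero]
  have hAL : ∀ᵐ y ∂(volume.restrict (closedBall c r)), A ≤ L * f y := by
    filter_upwards [ae_restrict_of_ae hL, ae_restrict_mem measurableSet_closedBall] with y hy hyc
    exact (ballAvg_le_ballMaximal hr hyc).trans hy
  have hL0 : L ≠ 0 := by
    rintro rfl
    obtain ⟨y, hyc, hLy⟩ := exists_mem_closedBall_of_ae hL c hr
    exact hA'.1 (by simpa using (ballAvg_le_ballMaximal hr hyc).trans hLy)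
  calc _ ≤ avg c r w * A * (L * A⁻¹ * avg c r (dualWeight p w) ^ (p - 1)) :=
        mul_le_mul' (havg c hr).ge (avg_dualWeight_mul_rpow_le hp hA' hL0 hAL
          (hw.weight.ae_ne.mono fun x hx => hx.1) (hf.mono fun x hx => hx.1))
    _ = avg c r w * avg c r (dualWeight p w) ^ (p - 1) * L * (A * A⁻¹) := by ring
    _ ≤ K * L := by
        rw [ENNReal.mul_inv_cancel hA'.1 hA'.2, mul_one]
        gcongr
        exact hw.le c r hr
    _ = _ := (ENNReal.coe_mul _ _).symm

end ApWeights

section RubioDeFrancia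

variable {α : Type*} {T T' : (α → ℝ≥0∞) → α → ℝ≥0∞} {B : ℝ≥0} {h : α → ℝ≥0∞}

/-- The series of the Rubio de Francia algorithm for an operator `T` of norm at most `B`, started
at `h`; it dominates `h` and satisfies `T (rubioDeFrancia T B h) ≤ 2 B rubioDeFrancia T B h`. -/
noncomputable def rubioDeFrancia (T : (α → ℝ≥0∞) → α → ℝ≥0∞) (B : ℝ≥0) (h : α → ℝ≥0∞) (x : α) :
    ℝ≥0∞ :=
  ∑' k : ℕ, ((2 * B : ℝ≥0∞)⁻¹) ^ k * T^[k] h x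

theorem le_rubioDeFrancia (x : α) : h x ≤ rubioDeFrancia T B h x := by
  simpa [rubioDeFrancia] using
    ENNReal.le_tsum (f := fun k : ℕ => ((2 * B : ℝ≥0∞)⁻¹) ^ k * T^[k] h x) 0

variable [MeasurableSpace α] {μ ν : Measure α}

theorem lintegral_tsum_rpow_le {F : ℕ → α → ℝ≥0∞} (hF : ∀ k, AEMeasurable (F k) μ) {p : ℝ}
    (hp : 1 ≤ p) : (∫⁻ x, (∑' k, F k x) ^ p ∂μ) ^ (1 / p) ≤
      ∑' k, (∫⁻ x, F k x ^ p ∂μ) ^ (1 / p) := by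
  have hsum (N : ℕ) : (∫⁻ x, (∑ k ∈ Finset.range N, F k x) ^ p ∂μ) ^ (1 / p) ≤
      ∑' k, (∫⁻ x, F k x ^ p ∂μ) ^ (1 / p) := by
    have := eLpNorm'_sum_le (s := Finset.range N) (fun k _ => (hF k).aestronglyMeasurable) hp
    simp only [eLpNorm', enorm_eq_self, Finset.sum_apply] at this
    exact this.trans (ENNReal.sum_le_tsum _)
  have hlim : Tendsto (fun N : ℕ => ∫⁻ x, (∑ k ∈ Finset.range N, F k x) ^ p ∂μ) atTop
      (𝓝 (∫⁻ x, (∑' k, F k x) ^ p ∂μ)) := by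
    refine lintegral_tendsto_of_tendsto_of_monotone (fun N =>
      (Finset.aemeasurable_fun_sum _ fun k _ => hF k).pow_const _)
      (Eventually.of_forall fun x N M hNM => ENNReal.rpow_le_rpow
        (Finset.sum_le_sum_of_subset (Finset.range_mono hNM)) (by linarith))
      (Eventually.of_forall fun x => ?_)
    exact (ENNReal.continuous_rpow_const.tendsto _).comp ENNReal.summable.hasSum.tendsto_sum_nat
  exact le_of_tendsto' ((ENNReal.continuous_rpow_const.tendsto _).comp hlim) hsum

/-- Countably sublinear operators on `[0, ∞]`-valued functions; only finite scalars are allowed,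
so that `T` need not commute with multiplication by `∞`. -/
structure IsCountablySublinear (μ : Measure α) (T : (α → ℝ≥0∞) → α → ℝ≥0∞) : Prop where
  aemeasurable : ∀ {g}, AEMeasurable g μ → AEMeasurable (T g) μ
  tsum_le : ∀ {F : ℕ → α → ℝ≥0∞} {a : ℕ → ℝ≥0∞}, (∀ k, AEMeasurable (F k) μ) → (∀ k, a k ≠ ∞) →
    ∀ x, T (fun y => ∑' k, a k * F k y) x ≤ ∑' k, a k * T (F k) x

theorem IsCountablySublinear.add (hT : IsCountablySublinear μ T)
    (hT' : IsCountablySublinear μ T') : IsCountablySublinear μ fun g x => T g x + T' g x where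
  aemeasurable hg := (hT.aemeasurable hg).add (hT'.aemeasurable hg)
  tsum_le hF ha x := by
    simp_rw [mul_add, ENNReal.tsum_add]
    exact add_le_add (hT.tsum_le hF ha x) (hT'.tsum_le hF ha x)

theorem IsCountablySublinear.aemeasurable_iterate (hT : IsCountablySublinear μ T)
    (hh : AEMeasurable h μ) (k : ℕ) : AEMeasurable (T^[k] h) μ := by
  induction k with
  | zero => exact hh
  | succ k ih => exact Function.iterate_succ_apply' T k h ▸ hT.aemeasurable ih

theorem IsCountablySublinear.aemeasurable_rubioDeFrancia (hT : IsCountablySublinear μ T)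
    (hh : AEMeasurable h μ) : AEMeasurable (rubioDeFrancia T B h) μ :=
  AEMeasurable.tsum fun k => (hT.aemeasurable_iterate hh k).const_mul _

theorem two_mul_inv_ne_top (hB : 1 ≤ B) : (2 * B : ℝ≥0∞)⁻¹ ≠ ∞ := by
  rw [ENNReal.inv_ne_top]
  exact mul_ne_zero two_ne_zero (ENNReal.coe_ne_zero.2 (one_pos.trans_le hB).ne')

theorem two_mul_inv_pow_mul_pow (hB : 1 ≤ B) (k : ℕ) :
    ((2 * B : ℝ≥0∞)⁻¹) ^ k * B ^ k = 2⁻¹ ^ k := by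
  have h0 : (B : ℝ≥0∞) ≠ 0 := ENNReal.coe_ne_zero.2 (one_pos.trans_le hB).ne'
  rw [← mul_pow, ENNReal.mul_inv (Or.inl two_ne_zero) (Or.inl (by simp)), mul_assoc,
    ENNReal.inv_mul_cancel h0 ENNReal.coe_ne_top, mul_one]

theorem tsum_two_inv_pow_mul (a : ℝ≥0∞) : ∑' k : ℕ, (2⁻¹ : ℝ≥0∞) ^ k * a = 2 * a := by
  rw [ENNReal.tsum_mul_right, ENNReal.tsum_geometric, ENNReal.one_sub_inv_two, inv_inv]

theorem IsCountablySublinear.apply_rubioDeFrancia_le (hT : IsCountablySublinear μ T) (hB : 1 ≤ B)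
    (hh : AEMeasurable h μ) (x : α) :
    T (rubioDeFrancia T B h) x ≤ (2 * B : ℝ≥0) * rubioDeFrancia T B h x := by
  have h0 : (2 * B : ℝ≥0∞) ≠ 0 :=
    mul_ne_zero two_ne_zero (ENNReal.coe_ne_zero.2 (one_pos.trans_le hB).ne')
  refine (hT.tsum_le (hT.aemeasurable_iterate hh)
    (fun k => ENNReal.pow_ne_top (two_mul_inv_ne_top hB)) x).trans ?_
  unfold rubioDeFrancia
  push_cast
  rw [← ENNReal.tsum_mul_left, tsum_eq_zero_add' (f := fun k => (2 * B : ℝ≥0∞) *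
    (((2 * B : ℝ≥0∞)⁻¹) ^ k * T^[k] h x)) ENNReal.summable]
  refine le_trans (le_of_eq (tsum_congr fun k => ?_)) le_add_self
  rw [Function.iterate_succ_apply', pow_succ', ← mul_assoc, ← mul_assoc,
    ENNReal.mul_inv_cancel h0 (by finiteness), one_mul]

theorem IsCountablySublinear.lintegral_iterate_rpow_le (hT : IsCountablySublinear μ T)
    (hB : 1 ≤ B) {p : ℝ} (hp : 1 ≤ p)
    (hbd : ∀ g, AEMeasurable g μ → ∫⁻ x, T g x ^ p ∂ν ≤ B * ∫⁻ x, g x ^ p ∂ν)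
    (hh : AEMeasurable h μ) (k : ℕ) :
    (∫⁻ x, T^[k] h x ^ p ∂ν) ^ (1 / p) ≤ B ^ k * (∫⁻ x, h x ^ p ∂ν) ^ (1 / p) := by
  have hp0 : 0 < p := by linarith
  have hBp : (B : ℝ≥0∞) ^ (1 / p) ≤ B := by
    simpa using ENNReal.rpow_le_rpow_of_exponent_le (x := B) (by exact_mod_cast hB)
      ((div_le_one hp0).2 hp)
  induction k with
  | zero => simp
  | succ k ih =>
    rw [Function.iterate_succ_apply', pow_succ', mul_assoc]
    refine (ENNReal.rpow_le_rpow (hbd _ (hT.aemeasurable_iterate hh k)) (by positivity)).trans ?_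
    rw [ENNReal.mul_rpow_of_nonneg _ _ (by positivity)]
    exact mul_le_mul' hBp ih

theorem IsCountablySublinear.lintegral_rubioDeFrancia_rpow_le (hT : IsCountablySublinear μ T)
    (hB : 1 ≤ B) (hνμ : ν ≪ μ) {p : ℝ} (hp : 1 ≤ p)
    (hbd : ∀ g, AEMeasurable g μ → ∫⁻ x, T g x ^ p ∂ν ≤ B * ∫⁻ x, g x ^ p ∂ν)
    (hh : AEMeasurable h μ) :
    ∫⁻ x, rubioDeFrancia T B h x ^ p ∂ν ≤ 2 ^ p * ∫⁻ x, h x ^ p ∂ν := by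
  have hp0 : 0 < p := by linarith
  have hroot : (∫⁻ x, rubioDeFrancia T B h x ^ p ∂ν) ^ (1 / p) ≤
      2 * (∫⁻ x, h x ^ p ∂ν) ^ (1 / p) := by
    refine (lintegral_tsum_rpow_le (fun k =>
      ((hT.aemeasurable_iterate hh k).mono_ac hνμ).const_mul _) hp).trans ?_
    rw [← tsum_two_inv_pow_mul ((∫⁻ x, h x ^ p ∂ν) ^ (1 / p))]
    refine ENNReal.tsum_le_tsum fun k => ?_
    have hne : (2 * B : ℝ≥0∞)⁻¹ ^ k ≠ ∞ := ENNReal.pow_ne_top (two_mul_inv_ne_top hB)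
    simp_rw [ENNReal.mul_rpow_of_nonneg _ _ hp0.le]
    rw [lintegral_const_mul' _ _ (ENNReal.rpow_ne_top_of_nonneg hp0.le hne),
      ENNReal.mul_rpow_of_nonneg _ _ (by positivity), ← ENNReal.rpow_mul,
      mul_one_div_cancel hp0.ne', ENNReal.rpow_one, ← two_mul_inv_pow_mul_pow hB, mul_assoc]
    exact mul_le_mul_right (hT.lintegral_iterate_rpow_le hB hp hbd hh k) _
  rwa [one_div, ENNReal.rpow_inv_le_iff hp0, ENNReal.mul_rpow_of_nonneg _ _ hp0.le,
    ← ENNReal.rpow_mul, inv_mul_cancel₀ hp0.ne', ENNReal.rpow_one] at hroot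

theorem ae_rubioDeFrancia_le_two (hB : 1 ≤ B)
    (hbd : ∀ (g : α → ℝ≥0∞) (A : ℝ≥0∞), (∀ᵐ x ∂μ, g x ≤ A) → ∀ᵐ x ∂μ, T g x ≤ B * A)
    (hh : ∀ᵐ x ∂μ, h x ≤ 1) : ∀ᵐ x ∂μ, rubioDeFrancia T B h x ≤ 2 := by
  have hit : ∀ k, ∀ᵐ x ∂μ, T^[k] h x ≤ B ^ k := by
    intro k
    induction k with
    | zero => simpa using hh
    | succ k ih =>
      rw [Function.iterate_succ_apply', pow_succ']
      exact hbd _ _ ih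
  filter_upwards [ae_all_iff.2 hit] with x hx
  calc rubioDeFrancia T B h x ≤ ∑' k : ℕ, (2⁻¹ : ℝ≥0∞) ^ k * 1 := by
        refine ENNReal.tsum_le_tsum fun k => ?_
        rw [mul_one, ← two_mul_inv_pow_mul_pow hB]
        exact mul_le_mul_right (hx k) _
    _ = 2 := by rw [tsum_two_inv_pow_mul, mul_one]

end RubioDeFrancia

section ConjugatedMaximal

theorem isCountablySublinear_ballMaximal {X : Type*} [PseudoMetricSpace X] [MeasurableSpace X]
    [BorelSpace X] {μ ν : Measure X} {D : ℝ≥0} (hν : IsDoubling ν D) (hνμ : ν ≪ μ) :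
    IsCountablySublinear μ (ballMaximal ν) where
  aemeasurable _ := hν.measurable_ballMaximal.aemeasurable
  tsum_le hF ha x := ballMaximal_tsum_const_mul_le (fun k => (hF k).mono_ac hνμ) ha x

variable {n : ℕ} {p r s : ℝ} {B C K : ℝ≥0} {g u w v η : (Fin n → ℝ) → ℝ≥0∞}

/-- The maximal operator conjugated by a weight `u` and a power `s`. If it maps `η` to at most a
multiple of `η`, then `η ^ s * u` is an `A₁` weight. -/
noncomputable def conjMaximal (s : ℝ) (u g : (Fin n → ℝ) → ℝ≥0∞) (x : Fin n → ℝ) : ℝ≥0∞ :=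
  ((u x)⁻¹ * maximal (fun y => g y ^ s * u y) x) ^ (1 / s)

theorem avg_rpow_mul_eq_lintegral_withDensity (hu : AEMeasurable u) (hg : AEMeasurable g)
    (c : Fin n → ℝ) (r : ℝ) : avg c r (fun y => g y ^ s * u y) =
      (volume (closedBall c r))⁻¹ *
        ∫⁻ y, g y ^ s ∂((volume.restrict (closedBall c r)).withDensity u) := by
  rw [lintegral_withDensity_eq_lintegral_mul₀ hu.restrict (hg.restrict.pow_const _), avg]
  simp_rw [Pi.mul_apply, mul_comm]

theorem avg_tsum_rpow_mul_le (hs : 1 ≤ s) {F : ℕ → (Fin n → ℝ) → ℝ≥0∞} {a : ℕ → ℝ≥0∞}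
    (hF : ∀ k, AEMeasurable (F k)) (ha : ∀ k, a k ≠ ∞) (hu : AEMeasurable u)
    (c : Fin n → ℝ) (r : ℝ) :
    avg c r (fun y => (∑' k, a k * F k y) ^ s * u y) ^ (1 / s) ≤
      ∑' k, a k * avg c r (fun y => F k y ^ s * u y) ^ (1 / s) := by
  have hs0 : 0 < s := by linarith
  have hroot : 0 ≤ 1 / s := by positivity
  rw [avg_rpow_mul_eq_lintegral_withDensity hu (AEMeasurable.tsum fun k => (hF k).const_mul _),
    ENNReal.mul_rpow_of_nonneg _ _ hroot]
  refine (mul_le_mul_right (lintegral_tsum_rpow_le (fun k =>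
    ((hF k).const_mul (a k)).restrict.mono_ac (withDensity_absolutelyContinuous _ _)) hs) _).trans
      (le_of_eq ?_)
  rw [← ENNReal.tsum_mul_left]
  refine tsum_congr fun k => ?_
  rw [← ENNReal.mul_rpow_of_nonneg _ _ hroot,
    ← avg_rpow_mul_eq_lintegral_withDensity hu ((hF k).const_mul _)]
  simp_rw [ENNReal.mul_rpow_of_nonneg _ _ hs0.le, mul_assoc]
  rw [avg_const_mul (ENNReal.rpow_ne_top_of_nonneg hs0.le (ha k)),
    ENNReal.mul_rpow_of_nonneg _ _ hroot, ← ENNReal.rpow_mul, mul_one_div_cancel hs0.ne',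
    ENNReal.rpow_one]

theorem isCountablySublinear_conjMaximal (hs : 1 ≤ s) (hu : AEMeasurable u) :
    IsCountablySublinear volume (conjMaximal s u) where
  aemeasurable _ := (hu.inv.mul measurable_maximal.aemeasurable).pow_const _
  tsum_le {F a} hF ha x := by
    have hs0 : 0 < s := by linarith
    have hroot : 0 ≤ 1 / s := by positivity
    have hmax : maximal (fun y => (∑' k, a k * F k y) ^ s * u y) x ^ (1 / s) ≤
        ∑' k, a k * maximal (fun y => F k y ^ s * u y) x ^ (1 / s) := by
      rw [one_div, ENNReal.rpow_inv_le_iff hs0]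
      refine maximal_le fun c r hr hx => ?_
      rw [← ENNReal.rpow_inv_le_iff hs0, ← one_div]
      refine (avg_tsum_rpow_mul_le hs hF ha hu c r).trans (ENNReal.tsum_le_tsum fun k => ?_)
      gcongr
      exact avg_le_maximal hr hx
    simp_rw [conjMaximal, ENNReal.mul_rpow_of_nonneg _ _ hroot, mul_left_comm (a _),
      ENNReal.tsum_mul_left]
    gcongr

theorem maximal_rpow_mul_le_of_conjMaximal_le (hs : 0 < s) {x : Fin n → ℝ}
    (hx : u x ≠ 0 ∧ u x ≠ ∞) (h : conjMaximal s u η x ≤ B * η x) :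
    maximal (fun y => η y ^ s * u y) x ≤ (B ^ s : ℝ≥0) * (η x ^ s * u x) := by
  rw [conjMaximal, one_div, ENNReal.rpow_inv_le_iff hs, ENNReal.mul_rpow_of_nonneg _ _ hs.le,
    ← ENNReal.coe_rpow_of_nonneg _ hs.le] at h
  calc maximal (fun y => η y ^ s * u y) x
      = u x * ((u x)⁻¹ * maximal (fun y => η y ^ s * u y) x) := by
        rw [← mul_assoc, ENNReal.mul_inv_cancel hx.1 hx.2, one_mul]
    _ ≤ u x * ((B ^ s : ℝ≥0) * η x ^ s) := by gcongr
    _ = _ := by ring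

theorem ae_ne_zero_of_conjMaximal_le (hs : 0 < s) (hηm : AEMeasurable η)
    (hη : ¬ η =ᵐ[volume] 0) (hum : AEMeasurable u) (hu : ∀ᵐ x, u x ≠ 0 ∧ u x ≠ ∞)
    (h : ∀ᵐ x, conjMaximal s u η x ≤ B * η x) : ∀ᵐ x, η x ≠ 0 := by
  have hne : ¬ (fun y => η y ^ s * u y) =ᵐ[volume] 0 := fun h0 => hη <| by
    filter_upwards [h0, hu] with x hx hux
    simpa [hux.1, ENNReal.rpow_eq_zero_iff_of_pos hs] using hx
  filter_upwards [h, hu] with x hx hux hx0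
  have hzero : maximal (fun y => η y ^ s * u y) x = 0 := by
    simpa [hx0, ENNReal.zero_rpow_of_pos hs] using maximal_rpow_mul_le_of_conjMaximal_le hs hux hx
  exact isDoubling_volume.ballMaximal_ne_zero (by fun_prop) hne x hzero

theorem A1.of_conjMaximal_le (hs : 0 < s) (hηm : AEMeasurable η)
    (hη : ∀ᵐ x, η x ≠ 0 ∧ η x ≠ ∞) (hum : AEMeasurable u) (hu : ∀ᵐ x, u x ≠ 0 ∧ u x ≠ ∞)
    (h : ∀ᵐ x, conjMaximal s u η x ≤ B * η x) : A1 (B ^ s) (fun x => η x ^ s * u x) := by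
  refine A1.of_maximal_le (by fun_prop) ?_ ?_
  · filter_upwards [hη, hu] with x h₁ h₂
    exact mul_ne_zero_top (rpow_ne_zero_top h₁ _) h₂
  · filter_upwards [h, hu] with x hx hux
    exact maximal_rpow_mul_le_of_conjMaximal_le hs hux hx

theorem lintegral_conjMaximal_rpow_mul_le (hs : 0 < s) (hr : 0 < r)
    (hC : ∀ f, AEMeasurable f → ∫⁻ x, maximal f x ^ r * v x ≤ C * ∫⁻ x, f x ^ r * v x)
    (hum : AEMeasurable u) (hu : ∀ᵐ x, u x ≠ 0 ∧ u x ≠ ∞) (hw : ∀ᵐ x, v x = u x ^ (-r) * w x)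
    (hg : AEMeasurable g) :
    ∫⁻ x, conjMaximal s u g x ^ (s * r) * w x ≤ C * ∫⁻ x, g x ^ (s * r) * w x := by
  calc ∫⁻ x, conjMaximal s u g x ^ (s * r) * w x
      = ∫⁻ x, maximal (fun y => g y ^ s * u y) x ^ r * v x := by
        refine lintegral_congr_ae ?_
        filter_upwards [hw] with x hx
        rw [hx, conjMaximal, ← ENNReal.rpow_mul, ← mul_assoc, one_div_mul_cancel hs.ne', one_mul,
          ENNReal.mul_rpow_of_nonneg _ _ hr.le, ENNReal.inv_rpow, ENNReal.rpow_neg]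
        ring
    _ ≤ C * ∫⁻ x, (g x ^ s * u x) ^ r * v x := hC _ (by fun_prop)
    _ = C * ∫⁻ x, g x ^ (s * r) * w x := by
        congr 1
        refine lintegral_congr_ae ?_
        filter_upwards [hu, hw] with x hx hwx
        rw [hwx, ENNReal.mul_rpow_of_nonneg _ _ hr.le, mul_assoc, ← mul_assoc (u x ^ r),
          ← ENNReal.rpow_add _ _ hx.1 hx.2, add_neg_cancel, ENNReal.rpow_zero, one_mul,
          ENNReal.rpow_mul]

theorem A1.conjMaximal_le (hu : A1 K u) (hs : 0 < s) {a : ℝ≥0∞}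
    (hg : ∀ᵐ x, g x ≤ a) : ∀ᵐ x, conjMaximal s u g x ≤ K ^ (1 / s) * a := by
  rcases eq_or_ne a ∞ with rfl | ha
  · rw [ENNReal.mul_top (rpow_ne_zero_top hu.coe_ne _).1]
    exact Eventually.of_forall fun _ => le_top
  have has : a ^ s ≠ ∞ := ENNReal.rpow_ne_top_of_nonneg hs.le ha
  have hmax (x) : maximal (fun y => g y ^ s * u y) x ≤ a ^ s * maximal u x := by
    refine (ballMaximal_mono ?_ x).trans (ballMaximal_const_mul_le has x)
    filter_upwards [hg] with y hy
    gcongr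
  filter_upwards [hu.le, hu.weight.ae_ne] with x hx hux
  rw [conjMaximal, one_div, ENNReal.rpow_inv_le_iff hs, ENNReal.mul_rpow_of_nonneg _ _ hs.le,
    ← ENNReal.rpow_mul, inv_mul_cancel₀ hs.ne', ENNReal.rpow_one]
  calc (u x)⁻¹ * maximal (fun y => g y ^ s * u y) x ≤ (u x)⁻¹ * (a ^ s * (K * u x)) := by
        gcongr
        exact (hmax x).trans (by gcongr)
    _ = K * a ^ s * ((u x)⁻¹ * u x) := by ring
    _ = K * a ^ s := by rw [ENNReal.inv_mul_cancel hux.1 hux.2, mul_one]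

theorem exists_lintegral_add_rpow_le {α : Type*} [MeasurableSpace α] {μ : Measure α}
    {T₁ T₂ : (α → ℝ≥0∞) → α → ℝ≥0∞} {C₁ C₂ : ℝ≥0} (hp : 1 ≤ p)
    (hT₁ : IsCountablySublinear μ T₁)
    (h₁ : ∀ g, AEMeasurable g μ → ∫⁻ x, T₁ g x ^ p ∂μ ≤ C₁ * ∫⁻ x, g x ^ p ∂μ)
    (h₂ : ∀ g, AEMeasurable g μ → ∫⁻ x, T₂ g x ^ p ∂μ ≤ C₂ * ∫⁻ x, g x ^ p ∂μ) :
    ∃ B : ℝ≥0, 1 ≤ B ∧ ∀ g, AEMeasurable g μ →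
      ∫⁻ x, (T₁ g x + T₂ g x) ^ p ∂μ ≤ B * ∫⁻ x, g x ^ p ∂μ := by
  have hp1 : 0 ≤ p - 1 := by linarith
  refine ⟨max 1 (2 ^ (p - 1) * (C₁ + C₂)), le_max_left _ _, fun g hg => ?_⟩
  calc ∫⁻ x, (T₁ g x + T₂ g x) ^ p ∂μ
      ≤ ∫⁻ x, 2 ^ (p - 1) * (T₁ g x ^ p + T₂ g x ^ p) ∂μ :=
        lintegral_mono fun x => ENNReal.rpow_add_le_mul_rpow_add_rpow _ _ hp
    _ = 2 ^ (p - 1) * ((∫⁻ x, T₁ g x ^ p ∂μ) + ∫⁻ x, T₂ g x ^ p ∂μ) := by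
        rw [lintegral_const_mul' _ _ (by finiteness),
          lintegral_add_left' ((hT₁.aemeasurable hg).pow_const _)]
    _ ≤ 2 ^ (p - 1) * (C₁ * (∫⁻ x, g x ^ p ∂μ) + C₂ * ∫⁻ x, g x ^ p ∂μ) := by
        gcongr
        exacts [h₁ g hg, h₂ g hg]
    _ = (2 ^ (p - 1) * (C₁ + C₂) : ℝ≥0) * ∫⁻ x, g x ^ p ∂μ := by
        rw [ENNReal.coe_mul, ENNReal.coe_rpow_of_nonneg _ hp1]
        push_cast
        ring
    _ ≤ _ := by
        gcongr
        exact le_max_right _ _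

theorem exists_conjMaximal_add_le (hT : IsCountablySublinear volume fun g x =>
      conjMaximal r u g x + conjMaximal s v g x) (hp : 1 ≤ p) (hB : 1 ≤ B)
    (hbd : ∀ g, AEMeasurable g → ∫⁻ x, (conjMaximal r u g x + conjMaximal s v g x) ^ p ≤
      B * ∫⁻ x, g x ^ p) (hr : 0 < r) (hum : AEMeasurable u) (hu : ∀ᵐ x, u x ≠ 0 ∧ u x ≠ ∞) :
    ∃ η : (Fin n → ℝ) → ℝ≥0∞, AEMeasurable η ∧ (∀ᵐ x, η x ≠ 0 ∧ η x ≠ ∞) ∧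
      (∀ x, conjMaximal r u η x ≤ (2 * B : ℝ≥0) * η x) ∧
      ∀ x, conjMaximal s v η x ≤ (2 * B : ℝ≥0) * η x := by
  have hp0 : 0 < p := by linarith
  set T : ((Fin n → ℝ) → ℝ≥0∞) → (Fin n → ℝ) → ℝ≥0∞ :=
    fun g x => conjMaximal r u g x + conjMaximal s v g x
  set h : (Fin n → ℝ) → ℝ≥0∞ := (closedBall 0 1).indicator 1 with hh
  have hhm : AEMeasurable h := (measurable_one.indicator measurableSet_closedBall).aemeasurable
  have hTη := hT.apply_rubioDeFrancia_le hB hhm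
  have hle (x) : conjMaximal r u (rubioDeFrancia T B h) x ≤ _ := le_self_add.trans (hTη x)
  have hηm : AEMeasurable (rubioDeFrancia T B h) := hT.aemeasurable_rubioDeFrancia hhm
  refine ⟨_, hηm, ?_, hle, fun x => le_add_self.trans (hTη x)⟩
  have hη0 : ¬ rubioDeFrancia T B h =ᵐ[volume] 0 := fun h0 => by
    obtain ⟨x, hx, hx0⟩ := exists_mem_closedBall_of_ae h0 (0 : Fin n → ℝ) one_pos
    have hle := hx0 ▸ le_rubioDeFrancia (T := T) (B := B) (h := h) x
    simp [hh, hx] at hle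
  have hηtop : ∫⁻ x, rubioDeFrancia T B h x ^ p ≠ ∞ := by
    refine ne_top_of_le_ne_top (ENNReal.mul_ne_top (by finiteness) ?_)
      (hT.lintegral_rubioDeFrancia_rpow_le hB Measure.AbsolutelyContinuous.rfl hp hbd hhm)
    have hpow (x) : h x ^ p = h x := by
      by_cases hx : x ∈ closedBall (0 : Fin n → ℝ) 1 <;> simp [hh, hx, hp0]
    simp_rw [hpow, hh]
    rw [lintegral_indicator_one measurableSet_closedBall]
    exact measure_closedBall_lt_top.ne
  filter_upwards [ae_ne_zero_of_conjMaximal_le hr hηm hη0 hum hu (Eventually.of_forall hle),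
    ae_lt_top' (hηm.pow_const _) hηtop] with x h0 htop
  exact ⟨h0, fun hx => by simp [hx, hp0] at htop⟩

theorem Ap.exists_conjMaximal_le (hp : 2 ≤ p) (hw : Ap p K w) :
    ∃ (B : ℝ≥0) (η : (Fin n → ℝ) → ℝ≥0∞), AEMeasurable η ∧ (∀ᵐ x, η x ≠ 0 ∧ η x ≠ ∞) ∧
      (∀ x, conjMaximal 1 (fun y => w y ^ (-(1 / p))) η x ≤ B * η x) ∧
      ∀ x, conjMaximal (p - 1) (fun y => w y ^ (1 / p)) η x ≤ B * η x := by
  have hp1 : 0 < p - 1 := by linarith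
  have hp0 : 0 < p := by linarith
  have hwm := hw.weight.aemeasurable
  have hpow (e : ℝ) : ∀ᵐ x, w x ^ e ≠ 0 ∧ w x ^ e ≠ ∞ :=
    hw.weight.ae_ne.mono fun x hx => rpow_ne_zero_top hx e
  have hT₁ := isCountablySublinear_conjMaximal le_rfl (hwm.pow_const (-(1 / p)))
  have hT₂ := isCountablySublinear_conjMaximal (s := p - 1) (by linarith) (hwm.pow_const (1 / p))
  obtain ⟨C₁, -, hC₁⟩ := exists_lintegral_maximal_rpow_le n (by linarith : 1 < p) K
  obtain ⟨C₂, -, hC₂⟩ := exists_lintegral_maximal_rpow_le n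
    (one_lt_div_sub_one (by linarith : 1 < p)) (K ^ (1 / (p - 1)))
  have h₁ (g) (hg : AEMeasurable g) : ∫⁻ x, conjMaximal 1 (fun y => w y ^ (-(1 / p))) g x ^ p ≤
      C₁ * ∫⁻ x, g x ^ p := by
    have := lintegral_conjMaximal_rpow_mul_le (w := 1) one_pos hp0 (fun f => hC₁ w f hw)
      (hwm.pow_const _) (hpow _) (Eventually.of_forall fun x => by
        rw [← ENNReal.rpow_mul, neg_mul_neg, one_div_mul_cancel hp0.ne', ENNReal.rpow_one,
          Pi.one_apply, mul_one]) hg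
    simpa using this
  have h₂ (g) (hg : AEMeasurable g) :
      ∫⁻ x, conjMaximal (p - 1) (fun y => w y ^ (1 / p)) g x ^ p ≤ C₂ * ∫⁻ x, g x ^ p := by
    have := lintegral_conjMaximal_rpow_mul_le (u := fun y => w y ^ (1 / p)) (w := 1) hp1
      (by positivity : 0 < p / (p - 1)) (fun f => hC₂ _ f (hw.dual (by linarith)))
      (hwm.pow_const _) (hpow _) (Eventually.of_forall fun x => by
        rw [← ENNReal.rpow_mul, Pi.one_apply, mul_one, dualWeight]
        congr 1
        field_simp) hg
    simpa [mul_div_cancel₀ _ hp1.ne'] using this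
  obtain ⟨B, hB, hbd⟩ := exists_lintegral_add_rpow_le (by linarith) hT₁ h₁ h₂
  obtain ⟨η, hη⟩ := exists_conjMaximal_add_le (hT₁.add hT₂) (by linarith) hB hbd one_pos
    (hwm.pow_const _) (hpow _)
  exact ⟨2 * B, η, hη⟩

theorem Ap.exists_factorization (hp : 2 ≤ p) (hw : Ap p K w) :
    ∃ (L : ℝ≥0) (w₁ w₂ : (Fin n → ℝ) → ℝ≥0∞), A1 L w₁ ∧ A1 L w₂ ∧
      ∀ᵐ x, w x = w₁ x * w₂ x ^ (-(p - 1)) := by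
  have hp1 : 0 < p - 1 := by linarith
  have hwm := hw.weight.aemeasurable
  have hpow (e : ℝ) : ∀ᵐ x, w x ^ e ≠ 0 ∧ w x ^ e ≠ ∞ :=
    hw.weight.ae_ne.mono fun x hx => rpow_ne_zero_top hx e
  obtain ⟨B, η, hηm, hη, hη₁, hη₂⟩ := hw.exists_conjMaximal_le hp
  refine ⟨_, _, _,
    (A1.of_conjMaximal_le hp1 hηm hη (hwm.pow_const _) (hpow _) (Eventually.of_forall hη₂)).mono
      (le_max_left _ _),
    (A1.of_conjMaximal_le one_pos hηm hη (hwm.pow_const _) (hpow _)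
      (Eventually.of_forall hη₁)).mono (le_max_right _ _), ?_⟩
  filter_upwards [hη, hw.weight.ae_ne] with x h1 h2
  obtain ⟨s, hs⟩ := exists_eq_eexp h1
  obtain ⟨t, ht⟩ := exists_eq_eexp h2
  simp only [hs, ht, eexp_rpow, eexp_mul]
  congr 1
  field_simp
  ring

end ConjugatedMaximal

section Absorption

variable {α : Type*} [MeasurableSpace α] {μ : Measure α} {p r s : ℝ} {f f₁ f₂ g R : α → ℝ≥0∞}

theorem lintegral_le_of_forall_le_of_ne_top [SigmaFinite μ] {A : ℝ≥0∞}
    (h : ∀ g : α → ℝ≥0∞, Measurable g → g ≤ f → ∫⁻ x, g x ∂μ ≠ ∞ → ∫⁻ x, g x ∂μ ≤ A) :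
    ∫⁻ x, f x ∂μ ≤ A := by
  by_contra! hA
  simp_rw [lintegral_eq_nnreal, lt_iSup_iff] at hA
  obtain ⟨φ, hφf, hφ⟩ := hA
  have hφ' : A < ∫⁻ x, φ x ∂μ := by
    rwa [← SimpleFunc.lintegral_eq_lintegral, SimpleFunc.coe_map] at hφ
  obtain ⟨g, hgφ, hg, hAg⟩ := SimpleFunc.exists_lt_lintegral_simpleFunc_of_lt_lintegral hφ'
  exact hAg.not_ge (h _ g.measurable.coe_nnreal_ennreal
    (fun x => (ENNReal.coe_le_coe.2 (hgφ x)).trans (hφf x)) hg.ne)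

theorem le_rpow_inv_mul_of_le_mul_rpow {x y C : ℝ≥0∞} {θ : ℝ} (hθ : 0 < θ) (hx : x ≠ 0 ∧ x ≠ ∞)
    (h : x ≤ C * (y ^ θ * x ^ (1 - θ))) : x ≤ C ^ θ⁻¹ * y := by
  have hx' := rpow_ne_zero_top hx (1 - θ)
  have hθx : x ^ θ ≤ C * y ^ θ := by
    rw [← ENNReal.mul_le_mul_iff_left hx'.1 hx'.2, ← ENNReal.rpow_add _ _ hx.1 hx.2,
      add_sub_cancel, ENNReal.rpow_one, mul_assoc]
    exact h
  rw [← ENNReal.le_rpow_inv_iff hθ] at hθx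
  rwa [ENNReal.mul_rpow_of_nonneg _ _ (inv_nonneg.2 hθ.le), ENNReal.rpow_rpow_inv hθ.ne'] at hθx

theorem rpow_mul_rpow_neg_le {x y : ℝ≥0∞} (hr : 0 < r) (hrp : r < p) (hs : 0 < s)
    (hy : y ≠ 0 ∧ y ≠ ∞) (h : x ^ (r / s) ≤ y) : x ^ p * y ^ (-(s * (p - r) / r)) ≤ x ^ r := by
  have hpr : 0 < p - r := sub_pos.2 hrp
  have hxy : x ^ (p - r) ≤ y ^ (s * (p - r) / r) := by
    calc x ^ (p - r) = (x ^ (r / s)) ^ (s * (p - r) / r) := by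
          rw [← ENNReal.rpow_mul]
          congr 1
          field_simp
      _ ≤ y ^ (s * (p - r) / r) := by gcongr
  calc x ^ p * y ^ (-(s * (p - r) / r))
      = x ^ r * (x ^ (p - r) * y ^ (-(s * (p - r) / r))) := by
        rw [← mul_assoc, ← ENNReal.rpow_add_of_nonneg _ _ hr.le hpr.le, add_sub_cancel]
    _ ≤ x ^ r * (y ^ (s * (p - r) / r) * y ^ (-(s * (p - r) / r))) := by gcongr
    _ = x ^ r := by
        rw [← ENNReal.rpow_add _ _ hy.1 hy.2, add_neg_cancel, ENNReal.rpow_zero, mul_one]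

theorem lintegral_rpow_le_rpow_mul_rpow (hr : 0 < r) (hrp : r < p) (hf : AEMeasurable f μ)
    (hRm : AEMeasurable R μ) (hR : ∀ᵐ x ∂μ, R x ≠ 0 ∧ R x ≠ ∞) :
    ∫⁻ x, f x ^ r ∂μ ≤ (∫⁻ x, f x ^ p * R x ^ (-(s * (p - r) / r)) ∂μ) ^ (r / p) *
      (∫⁻ x, R x ^ s ∂μ) ^ (1 - r / p) := by
  have hp : 0 < p := hr.trans hrp
  have hrp1 : r / p ≤ 1 := (div_le_one hp).2 hrp.le
  refine le_trans (le_of_eq (lintegral_congr_ae ?_)) (ENNReal.lintegral_mul_norm_pow_le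
    (by fun_prop) (by fun_prop) (by positivity) (sub_nonneg.2 hrp1) (add_sub_cancel _ _))
  filter_upwards [hR] with x hx
  obtain ⟨t, ht⟩ := exists_eq_eexp hx
  rw [ENNReal.mul_rpow_of_nonneg _ _ (by positivity), ← ENNReal.rpow_mul,
    mul_div_cancel₀ _ hp.ne', mul_assoc]
  simp only [ht, eexp_rpow, eexp_mul]
  rw [show t * -(s * (p - r) / r) * (r / p) + t * s * (1 - r / p) = 0 by field_simp; ring,
    eexp_zero, mul_one]

theorem lintegral_rpow_le_of_lintegral_mul_rpow_neg_le (hr : 0 < r) (hrp : r < p) (hs : 0 < s)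
    (hf₁ : AEMeasurable f₁ μ) (hRm : AEMeasurable R μ) (hR : ∀ᵐ x ∂μ, R x ≠ 0 ∧ R x ≠ ∞)
    (hfR : ∀ x, f₂ x ^ (r / s) ≤ R x) (hRs : ∫⁻ x, R x ^ s ∂μ ≤ 2 ^ s * ∫⁻ x, f₂ x ^ r ∂μ)
    {C : ℝ≥0∞} (h : ∫⁻ x, f₁ x ^ p * R x ^ (-(s * (p - r) / r)) ∂μ ≤
      C * ∫⁻ x, f₂ x ^ p * R x ^ (-(s * (p - r) / r)) ∂μ) :
    ∫⁻ x, f₁ x ^ r ∂μ ≤ C ^ (r / p) * (2 ^ s) ^ (1 - r / p) * ∫⁻ x, f₂ x ^ r ∂μ := by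
  have hθ : 0 ≤ r / p := (div_pos hr (hr.trans hrp)).le
  have hθ' : 0 ≤ 1 - r / p := sub_nonneg.2 ((div_le_one (hr.trans hrp)).2 hrp.le)
  have hf₂ : ∫⁻ x, f₂ x ^ p * R x ^ (-(s * (p - r) / r)) ∂μ ≤ ∫⁻ x, f₂ x ^ r ∂μ :=
    lintegral_mono_ae (hR.mono fun x hx => rpow_mul_rpow_neg_le hr hrp hs hx (hfR x))
  calc ∫⁻ x, f₁ x ^ r ∂μ
      ≤ (C * ∫⁻ x, f₂ x ^ r ∂μ) ^ (r / p) * (2 ^ s * ∫⁻ x, f₂ x ^ r ∂μ) ^ (1 - r / p) := by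
        refine (lintegral_rpow_le_rpow_mul_rpow (s := s) hr hrp hf₁ hRm hR).trans ?_
        gcongr
        exact h.trans (by gcongr)
    _ = C ^ (r / p) * (2 ^ s) ^ (1 - r / p) * ∫⁻ x, f₂ x ^ r ∂μ := by
        rw [ENNReal.mul_rpow_of_nonneg _ _ hθ, ENNReal.mul_rpow_of_nonneg _ _ hθ',
          mul_mul_mul_comm, ← ENNReal.rpow_add_of_nonneg _ _ hθ hθ', add_sub_cancel,
          ENNReal.rpow_one]

theorem lintegral_rpow_mul_le (hp : 0 < p) (hpr : p < r) (hf : AEMeasurable f μ)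
    (hR : AEMeasurable R μ) : ∫⁻ x, f x ^ p * R x ∂μ ≤
      (∫⁻ x, f x ^ r ∂μ) ^ (p / r) * (∫⁻ x, R x ^ (r / (r - p)) ∂μ) ^ (1 - p / r) := by
  have hr : 0 < r := hp.trans hpr
  have hrp : 0 < r - p := sub_pos.2 hpr
  refine le_trans (le_of_eq (lintegral_congr fun x => ?_)) (ENNReal.lintegral_mul_norm_pow_le
    (hf.pow_const r) (hR.pow_const (r / (r - p))) (by positivity)
    (sub_nonneg.2 ((div_le_one hr).2 hpr.le)) (add_sub_cancel _ _))
  rw [← ENNReal.rpow_mul, ← ENNReal.rpow_mul, mul_div_cancel₀ _ hr.ne',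
    show r / (r - p) * (1 - p / r) = 1 by field_simp, ENNReal.rpow_one]

theorem lintegral_rpow_le_of_lintegral_mul_le (hp : 0 < p) (hpr : p < r)
    (hf₂ : AEMeasurable f₂ μ) (hRm : AEMeasurable R μ) (hg : g ≤ f₁)
    (hg₀ : ∫⁻ x, g x ^ r ∂μ ≠ 0 ∧ ∫⁻ x, g x ^ r ∂μ ≠ ∞) (hgR : ∀ x, g x ^ (r - p) ≤ R x)
    (hR : ∫⁻ x, R x ^ (r / (r - p)) ∂μ ≤ 2 ^ (r / (r - p)) * ∫⁻ x, g x ^ r ∂μ) {C : ℝ≥0∞}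
    (h : ∫⁻ x, f₁ x ^ p * R x ∂μ ≤ C * ∫⁻ x, f₂ x ^ p * R x ∂μ) :
    ∫⁻ x, g x ^ r ∂μ ≤ (C * 2) ^ (r / p) * ∫⁻ x, f₂ x ^ r ∂μ := by
  have hr : 0 < r := hp.trans hpr
  have hrp : 0 < r - p := sub_pos.2 hpr
  have hθ : 0 ≤ 1 - p / r := sub_nonneg.2 ((div_le_one hr).2 hpr.le)
  rw [← inv_div p r]
  refine le_rpow_inv_mul_of_le_mul_rpow (by positivity) hg₀ ?_
  calc ∫⁻ x, g x ^ r ∂μ ≤ ∫⁻ x, f₁ x ^ p * R x ∂μ := by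
        refine lintegral_mono fun x => ?_
        rw [← add_sub_cancel p r, ENNReal.rpow_add_of_nonneg _ _ hp.le hrp.le]
        gcongr
        exacts [hg x, hgR x]
    _ ≤ C * ((∫⁻ x, f₂ x ^ r ∂μ) ^ (p / r) *
          (2 ^ (r / (r - p)) * ∫⁻ x, g x ^ r ∂μ) ^ (1 - p / r)) := by
        refine h.trans ?_
        gcongr
        exact (lintegral_rpow_mul_le hp hpr hf₂ hRm).trans (by gcongr)
    _ = C * 2 * ((∫⁻ x, f₂ x ^ r ∂μ) ^ (p / r) * (∫⁻ x, g x ^ r ∂μ) ^ (1 - p / r)) := by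
        rw [ENNReal.mul_rpow_of_nonneg _ _ hθ, ← ENNReal.rpow_mul,
          show r / (r - p) * (1 - p / r) = 1 by field_simp, ENNReal.rpow_one]
        ring

theorem IsDoubling.exists_ballMaximal_majorant {X : Type*} [PseudoMetricSpace X]
    [MeasurableSpace X] [BorelSpace X] {ν τ : Measure X} {D B : ℝ≥0} {g : X → ℝ≥0∞}
    (hν : IsDoubling ν D) (hντ : ν ≪ τ) (hτν : τ ≪ ν) (hB : 1 ≤ B) (hs : 1 ≤ s)
    (hbd : ∀ g, AEMeasurable g τ → ∫⁻ x, ballMaximal ν g x ^ s ∂τ ≤ B * ∫⁻ x, g x ^ s ∂τ)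
    (hg : AEMeasurable g τ) (hg₀ : ∫⁻ x, g x ^ s ∂τ ≠ 0 ∧ ∫⁻ x, g x ^ s ∂τ ≠ ∞) :
    ∃ R, AEMeasurable R τ ∧ (∀ᵐ x ∂τ, R x ≠ 0 ∧ R x ≠ ∞) ∧ g ≤ R ∧
      (∀ x, ballMaximal ν R x ≤ (2 * B : ℝ≥0) * R x) ∧
      ∫⁻ x, R x ^ s ∂τ ≤ 2 ^ s * ∫⁻ x, g x ^ s ∂τ := by
  have hs0 : 0 < s := by linarith
  have hT : IsCountablySublinear τ (ballMaximal ν) := isCountablySublinear_ballMaximal hν hντ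
  set R := rubioDeFrancia (ballMaximal ν) B g
  have hRm : AEMeasurable R τ := hT.aemeasurable_rubioDeFrancia hg
  have hgR : g ≤ R := fun x => le_rubioDeFrancia x
  have hMR (x : X) : ballMaximal ν R x ≤ (2 * B : ℝ≥0) * R x := hT.apply_rubioDeFrancia_le hB hg x
  have hRs := hT.lintegral_rubioDeFrancia_rpow_le hB Measure.AbsolutelyContinuous.rfl hs hbd hg
  refine ⟨R, hRm, ?_, hgR, hMR, hRs⟩
  have hR0 : ¬ R =ᵐ[ν] 0 := fun h0 => hg₀.1 <| by
    rw [lintegral_congr_ae (g := fun _ => 0), lintegral_zero]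
    filter_upwards [hτν.ae_le h0] with x hx
    rw [le_zero_iff.1 ((hgR x).trans hx.le), ENNReal.zero_rpow_of_pos hs0]
  filter_upwards [ae_lt_top' (hRm.pow_const s) (ne_top_of_le_ne_top (by finiteness [hg₀.2]) hRs)]
    with x hx
  refine ⟨fun h0 => hν.ballMaximal_ne_zero (hRm.mono_ac hντ) hR0 x ?_, fun htop => ?_⟩
  · simpa [h0] using hMR x
  · simp [htop, ENNReal.top_rpow_of_pos hs0] at hx

end Absorption

section Extrapolation

variable {n : ℕ} {p r s : ℝ} {K : ℝ≥0} {f g w w₀ : (Fin n → ℝ) → ℝ≥0∞}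
  {𝓕 : Set (((Fin n → ℝ) → ℝ≥0∞) × ((Fin n → ℝ) → ℝ≥0∞))}

/-- The pairs in `𝓕` satisfy a strong-type inequality with exponent `p` for all `A_s` weights, with
constants that depend only on `s` and the `A_s` constant. -/
def Dominated (𝓕 : Set (((Fin n → ℝ) → ℝ≥0∞) × ((Fin n → ℝ) → ℝ≥0∞))) (p : ℝ) : Prop :=
  ∀ s : ℝ, 1 < s → ∀ K : ℝ≥0, ∃ C : ℝ≥0, ∀ w : (Fin n → ℝ) → ℝ≥0∞, Ap s K w → ∀ f ∈ 𝓕,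
    ∫⁻ x, f.1 x ^ p * w x ≤ C * ∫⁻ x, f.2 x ^ p * w x

theorem IsAInfty.exists_ap (hw : IsAInfty w) (t : ℝ) :
    ∃ s : ℝ, 1 < s ∧ t ≤ s ∧ ∃ K : ℝ≥0, Ap s K w := by
  obtain ⟨q, hq, hwq⟩ := hw
  obtain ⟨K, hK⟩ := hwq.exists_ap hq
  exact ⟨max q t, lt_max_of_lt_left hq, le_max_right _ _, K, hK.mono_exponent hq (le_max_left _ _)⟩

theorem lintegral_mul_le_of_forall_min_le (hg : AEMeasurable g) (hw : IsWeight w)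
    (hw₀ : IsWeight w₀) {A : ℝ≥0∞}
    (h : ∀ k : ℕ, ∫⁻ x, g x * min (w x) ((k + 1 : ℝ≥0∞) * w₀ x) ≤ A) : ∫⁻ x, g x * w x ≤ A := by
  have hwm := hw.aemeasurable
  have hwm₀ := hw₀.aemeasurable
  refine le_of_tendsto' (lintegral_tendsto_of_tendsto_of_monotone (fun k => by fun_prop)
    (Eventually.of_forall fun x a b hab => ?_) ?_) h
  · dsimp only
    gcongr
  · filter_upwards [hw.ae_ne, hw₀.ae_ne] with x hx hx₀
    refine tendsto_const_nhds.congr' ?_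
    obtain ⟨N, hN⟩ := ENNReal.exists_nat_gt (ENNReal.div_ne_top hx.2 hx₀.1)
    rw [ENNReal.div_lt_iff (Or.inl hx₀.1) (Or.inl hx₀.2)] at hN
    filter_upwards [eventually_ge_atTop N] with k hk
    rw [min_eq_left (hN.le.trans _)]
    gcongr
    exact (Nat.cast_le.2 hk).trans le_self_add

section FromAInfty

variable {p₀ : ℝ} {φ : ℝ≥0 → ℝ≥0} (hφ : Monotone φ)
  (hyp : ∀ w : (Fin n → ℝ) → ℝ≥0∞, IsAInfty w → ∀ f ∈ 𝓕, ∫⁻ x, f.1 x ^ p₀ * w x < ∞ →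
    ∫⁻ x, f.1 x ^ p₀ * w x ≤ φ (aInftyConst w).toNNReal * ∫⁻ x, f.2 x ^ p₀ * w x)

include hφ hyp

theorem exists_lintegral_le_of_aInfty (hs : 1 < s) (K : ℝ≥0) :
    ∃ C : ℝ≥0, ∀ w : (Fin n → ℝ) → ℝ≥0∞, Ap s K w → ∀ f ∈ 𝓕, ∫⁻ x, f.1 x ^ p₀ * w x < ∞ →
      ∫⁻ x, f.1 x ^ p₀ * w x ≤ C * ∫⁻ x, f.2 x ^ p₀ * w x := by
  obtain ⟨C, hC⟩ := exists_aInftyConst_le n hs K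
  refine ⟨φ C, fun w hw f hf hfin => (hyp w ⟨s, hs, hw.isAq hs⟩ f hf hfin).trans ?_⟩
  gcongr
  exact hφ (ENNReal.toNNReal_mono ENNReal.coe_ne_top (hC w hw))

/-- The weights `min (w, k w₀)` are `A_t` weights with constants bounded in `k`, and they are below
a multiple of `w₀`, so that the left-hand sides are finite. -/
theorem lintegral_lt_top_of_aInfty (h𝓕 : ∀ f ∈ 𝓕, AEMeasurable f.1 volume ∧ AEMeasurable f.2 volume)
    (hs : 1 < s) (hw : Ap s K w) (hw₀ : IsAInfty w₀)
    {f : ((Fin n → ℝ) → ℝ≥0∞) × ((Fin n → ℝ) → ℝ≥0∞)} (hf : f ∈ 𝓕)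
    (hf₁ : ∫⁻ x, f.1 x ^ p₀ * w₀ x < ∞) (hf₂ : ∫⁻ x, f.2 x ^ p₀ * w x ≠ ∞) :
    ∫⁻ x, f.1 x ^ p₀ * w x < ∞ := by
  obtain ⟨t, ht, hst, K₀, hK₀⟩ := hw₀.exists_ap s
  obtain ⟨C, hC⟩ := exists_lintegral_le_of_aInfty hφ hyp ht (2 ^ (t - 1) * (K + K₀))
  refine lt_of_le_of_lt (lintegral_mul_le_of_forall_min_le ((h𝓕 f hf).1.pow_const _) hw.weight
    hK₀.weight (A := C * ∫⁻ x, f.2 x ^ p₀ * w x) fun k => ?_) (by finiteness)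
  have hk : (k + 1 : ℝ≥0∞) ≠ 0 ∧ (k + 1 : ℝ≥0∞) ≠ ∞ := ⟨by positivity, by finiteness⟩
  have hmin := (hw.mono_exponent hs hst).inf ht (hK₀.const_mul ht hk)
  have hfin : ∫⁻ x, f.1 x ^ p₀ * min (w x) ((k + 1 : ℝ≥0∞) * w₀ x) < ∞ := by
    calc ∫⁻ x, f.1 x ^ p₀ * min (w x) ((k + 1 : ℝ≥0∞) * w₀ x)
        ≤ ∫⁻ x, (k + 1 : ℝ≥0∞) * (f.1 x ^ p₀ * w₀ x) := by
          refine lintegral_mono fun x => ?_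
          rw [mul_left_comm]
          gcongr
          exact min_le_right _ _
      _ = (k + 1 : ℝ≥0∞) * ∫⁻ x, f.1 x ^ p₀ * w₀ x := lintegral_const_mul' _ _ hk.2
      _ < ∞ := ENNReal.mul_lt_top hk.2.lt_top hf₁
  refine (hC _ hmin f hf hfin).trans ?_
  gcongr
  exact min_le_left _ _

theorem dominated_of_aInfty
    (h𝓕 : ∀ f ∈ 𝓕, AEMeasurable f.1 volume ∧ AEMeasurable f.2 volume) :
    Dominated {f ∈ 𝓕 | ∃ w₀ : (Fin n → ℝ) → ℝ≥0∞,
      IsAInfty w₀ ∧ ∫⁻ x, f.1 x ^ p₀ * w₀ x < ∞} p₀ := by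
  intro s hs K
  obtain ⟨C, hC⟩ := exists_lintegral_le_of_aInfty hφ hyp hs K
  refine ⟨C + 1, fun w hw f ⟨hf, w₀, hw₀, hf₀⟩ => ?_⟩
  by_cases htop : ∫⁻ x, f.2 x ^ p₀ * w x = ∞
  · rw [htop, ENNReal.mul_top (by positivity)]
    exact le_top
  refine (hC w hw f hf (lintegral_lt_top_of_aInfty hφ hyp h𝓕 hs hw hw₀ hf hf₀ htop)).trans ?_
  gcongr
  exact le_self_add

end FromAInfty

theorem IsWeight.lintegral_withDensity_rpow (hw : IsWeight w) (hg : AEMeasurable g) (p : ℝ) :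
    ∫⁻ x, g x ^ p ∂(volume.withDensity w) = ∫⁻ x, g x ^ p * w x := by
  simp_rw [lintegral_withDensity_mul hw.aemeasurable (hg.pow_const p), mul_comm]

theorem IsWeight.absolutelyContinuous_withDensity (hw : IsWeight w) :
    volume ≪ volume.withDensity w :=
  withDensity_absolutelyContinuous' hw.aemeasurable (hw.ae_ne.mono fun _ h => h.1)

theorem IsWeight.exists_maximal_majorant {B : ℝ≥0} (hw : IsWeight w) (hB : 1 ≤ B) (hs : 1 ≤ s)
    (hbd : ∀ g : (Fin n → ℝ) → ℝ≥0∞, AEMeasurable g →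
      ∫⁻ x, maximal g x ^ s * w x ≤ B * ∫⁻ x, g x ^ s * w x)
    (hg : AEMeasurable g)
    (hg₀ : ∫⁻ x, g x ^ s * w x ≠ 0 ∧ ∫⁻ x, g x ^ s * w x ≠ ∞) :
    ∃ R, A1 (2 * B) R ∧ g ≤ R ∧
      ∫⁻ x, R x ^ s ∂(volume.withDensity w) ≤ 2 ^ s * ∫⁻ x, g x ^ s * w x := by
  have hac : volume.withDensity w ≪ volume := withDensity_absolutelyContinuous _ _
  have hac' := hw.absolutelyContinuous_withDensity
  rw [← hw.lintegral_withDensity_rpow hg] at hg₀ ⊢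
  obtain ⟨R, hRm, hR, hgR, hMR, hRs⟩ := (isDoubling_volume (n := n)).exists_ballMaximal_majorant
    hac' hac hB hs (fun g hg => by
      rw [hw.lintegral_withDensity_rpow (hg.mono_ac hac'),
        hw.lintegral_withDensity_rpow isDoubling_volume.measurable_ballMaximal.aemeasurable]
      exact hbd g (hg.mono_ac hac')) (hg.mono_ac hac) hg₀
  exact ⟨R, A1.of_maximal_le (hRm.mono_ac hac') (hac'.ae_le hR)
    (Eventually.of_forall hMR), hgR, hRs⟩

theorem IsWeight.lintegral_rpow_mul_eq_zero_iff (hw : IsWeight w) (hg : AEMeasurable g)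
    (hp : 0 < p) : ∫⁻ x, g x ^ p * w x = 0 ↔ g =ᵐ[volume] 0 := by
  rw [← hw.lintegral_withDensity_rpow hg]
  refine ⟨fun h => hw.absolutelyContinuous_withDensity.ae_le
    (ENNReal.ae_eq_zero_of_lintegral_rpow_eq_zero hp.le
      (hg.mono_ac (withDensity_absolutelyContinuous _ _)) h), fun h => ?_⟩
  rw [lintegral_congr_ae (g := fun _ => 0), lintegral_zero]
  filter_upwards [withDensity_absolutelyContinuous volume w |>.ae_le h] with x hx
  simp [hx, hp]

theorem Dominated.down (h𝓕 : ∀ f ∈ 𝓕, AEMeasurable f.1 volume ∧ AEMeasurable f.2 volume)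
    (hr : 0 < r) (hrp : r < p) (h : Dominated 𝓕 p) : Dominated 𝓕 r := by
  intro s hs K
  have hp : 0 < p := hr.trans hrp
  have hs0 : 0 < s := by linarith
  have he : 0 < s * (p - r) / r := div_pos (mul_pos hs0 (sub_pos.2 hrp)) hr
  obtain ⟨B, hB1, hB⟩ := exists_lintegral_maximal_rpow_le n hs K
  obtain ⟨C, hC⟩ := h (s + s * (p - r) / r) (by linarith) (K * (2 * B) ^ (s * (p - r) / r))
  obtain ⟨C', hC'⟩ := h s hs K
  refine ⟨max 1 (C ^ (r / p) * (2 ^ s) ^ (1 - r / p)), fun w hw f hf => ?_⟩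
  obtain ⟨hf₁, hf₂⟩ := h𝓕 f hf
  have hac : volume.withDensity w ≪ volume := withDensity_absolutelyContinuous _ _
  rcases eq_or_ne (∫⁻ x, f.2 x ^ r * w x) ∞ with htop | htop
  · rw [htop, ENNReal.mul_top (ENNReal.coe_ne_zero.2 (one_pos.trans_le (le_max_left _ _)).ne')]
    exact le_top
  rcases eq_or_ne (∫⁻ x, f.2 x ^ r * w x) 0 with h0 | h0
  · have hf₂0 := (hw.weight.lintegral_rpow_mul_eq_zero_iff hf₂ hp).2
      ((hw.weight.lintegral_rpow_mul_eq_zero_iff hf₂ hr).1 h0)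
    have hf₁0 := (hw.weight.lintegral_rpow_mul_eq_zero_iff hf₁ hp).1
      (le_zero_iff.1 ((hC' w hw f hf).trans (by rw [hf₂0, mul_zero])))
    exact ((hw.weight.lintegral_rpow_mul_eq_zero_iff hf₁ hr).2 hf₁0).trans_le zero_le
  have hk (x : Fin n → ℝ) : (f.2 x ^ (r / s)) ^ s = f.2 x ^ r := by
    rw [← ENNReal.rpow_mul, div_mul_cancel₀ _ hs0.ne']
  obtain ⟨R, hR, hkR, hRs⟩ := hw.weight.exists_maximal_majorant hB1 hs.le (fun g hg => hB w g hw hg)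
    (hf₂.pow_const (r / s)) (by simpa only [hk] using ⟨h0, htop⟩)
  have hRm := hR.weight.aemeasurable
  simp_rw [hk, ← hw.weight.lintegral_withDensity_rpow hf₂] at hRs
  rw [← hw.weight.lintegral_withDensity_rpow hf₁, ← hw.weight.lintegral_withDensity_rpow hf₂]
  refine (lintegral_rpow_le_of_lintegral_mul_rpow_neg_le hr hrp hs0 (hf₁.mono_ac hac)
    (hRm.mono_ac hac) (hac.ae_le hR.weight.ae_ne) hkR hRs (C := C) ?_).trans ?_
  · rw [lintegral_withDensity_mul hw.weight.aemeasurable (by fun_prop),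
      lintegral_withDensity_mul hw.weight.aemeasurable (by fun_prop)]
    simpa only [mul_left_comm] using hC _ (hw.mul_rpow_neg hs hR he) f hf
  · gcongr
    have hθ : 0 ≤ 1 - r / p := sub_nonneg.2 ((div_le_one hp).2 hrp.le)
    rw [ENNReal.coe_max, ENNReal.coe_mul, ENNReal.coe_rpow_of_nonneg _ (div_pos hr hp).le,
      ENNReal.coe_rpow_of_nonneg _ hθ, ENNReal.coe_rpow_of_nonneg _ hs0.le]
    exact le_max_right _ _

theorem Ap.exists_dual_majorant (n : ℕ) (hs : 1 < s) (K : ℝ≥0) {m : ℝ} (hm : 1 < m) :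
    ∃ L : ℝ≥0, ∀ w g : (Fin n → ℝ) → ℝ≥0∞, Ap s K w → AEMeasurable g →
      ∫⁻ x, g x ^ m * w x ≠ 0 ∧ ∫⁻ x, g x ^ m * w x ≠ ∞ →
      ∃ R, AEMeasurable R ∧ Ap s L (fun x => w x * R x) ∧ g ≤ R ∧
        ∫⁻ x, R x ^ m ∂(volume.withDensity w) ≤ 2 ^ m * ∫⁻ x, g x ^ m * w x := by
  set D : ℝ≥0 := K * (5 ^ n) ^ s
  set B : ℝ≥0 := max 1 (2 ^ m * (D * ENNReal.ofReal (m / (m - 1)))).toNNReal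
  have hB : 2 ^ m * (D * ENNReal.ofReal (m / (m - 1))) ≤ B := by
    rw [← ENNReal.coe_toNNReal (a := 2 ^ m * (D * ENNReal.ofReal (m / (m - 1)))) (by finiteness)]
    exact ENNReal.coe_le_coe.2 (le_max_right _ _)
  refine ⟨K * (2 * B), fun w g hw hg hg₀ => ?_⟩
  have hac : volume.withDensity w ≪ volume := withDensity_absolutelyContinuous _ _
  have hac' := hw.weight.absolutelyContinuous_withDensity
  have hwd : IsDoubling (volume.withDensity w) D := hw.isDoubling hs
  rw [← hw.weight.lintegral_withDensity_rpow hg] at hg₀ ⊢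
  obtain ⟨R, hRm, hR, hgR, hMR, hRs⟩ := hwd.exists_ballMaximal_majorant .rfl .rfl
    (le_max_left _ _) hm.le (fun g hg => (hwd.lintegral_ballMaximal_rpow_le hm hg).trans
      (by gcongr)) (hg.mono_ac hac) hg₀
  exact ⟨R, hRm.mono_ac hac', hw.mul_of_ballMaximal_le hs (hRm.mono_ac hac') (hac'.ae_le hR)
    (Eventually.of_forall hMR), hgR, hRs⟩

theorem Dominated.up (h𝓕 : ∀ f ∈ 𝓕, AEMeasurable f.1 volume ∧ AEMeasurable f.2 volume)
    (hp : 0 < p) (hpr : p < r) (h : Dominated 𝓕 p) : Dominated 𝓕 r := by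
  intro s hs K
  have hr : 0 < r := hp.trans hpr
  have hrp : 0 < r - p := sub_pos.2 hpr
  have hm : 1 < r / (r - p) := by rw [lt_div_iff₀ hrp]; linarith
  obtain ⟨L, hL⟩ := Ap.exists_dual_majorant n hs K hm
  obtain ⟨C, hC⟩ := h s hs L
  refine ⟨(C * 2) ^ (r / p), fun w hw f hf => ?_⟩
  obtain ⟨hf₁, hf₂⟩ := h𝓕 f hf
  have hac : volume.withDensity w ≪ volume := withDensity_absolutelyContinuous _ _
  rw [← hw.weight.lintegral_withDensity_rpow hf₁, ← hw.weight.lintegral_withDensity_rpow hf₂,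
    ENNReal.coe_rpow_of_nonneg _ (div_pos hr hp).le, ENNReal.coe_mul, ENNReal.coe_ofNat]
  have := SigmaFinite.withDensity_of_ne_top (μ := (volume : Measure (Fin n → ℝ)))
    (hw.weight.ae_ne.mono fun _ h => h.2)
  refine lintegral_le_of_forall_le_of_ne_top fun G hG hGf hGtop => ?_
  rcases eq_or_ne (∫⁻ x, G x ∂(volume.withDensity w)) 0 with hG0 | hG0
  · exact hG0.trans_le zero_le
  set g : (Fin n → ℝ) → ℝ≥0∞ := fun x => G x ^ r⁻¹
  have hgm : Measurable g := hG.pow_const _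
  have hgf : g ≤ f.1 := fun x => (ENNReal.rpow_inv_le_iff hr).2 (hGf x)
  have hgr (x : Fin n → ℝ) : g x ^ r = G x := ENNReal.rpow_inv_rpow hr.ne' _
  have hgm' (x : Fin n → ℝ) : (g x ^ (r - p)) ^ (r / (r - p)) = g x ^ r := by
    rw [← ENNReal.rpow_mul, mul_div_cancel₀ _ hrp.ne']
  simp_rw [← hgr] at hG0 hGtop ⊢
  obtain ⟨R, hRm, hR, hgR, hRs⟩ := hL w (fun x => g x ^ (r - p)) hw (by fun_prop) (by
    simp_rw [hgm', ← hw.weight.lintegral_withDensity_rpow hgm.aemeasurable]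
    exact ⟨hG0, hGtop⟩)
  simp_rw [hgm', ← hw.weight.lintegral_withDensity_rpow hgm.aemeasurable] at hRs
  refine lintegral_rpow_le_of_lintegral_mul_le hp hpr (hf₂.mono_ac hac) (hRm.mono_ac hac) hgf
    ⟨hG0, hGtop⟩ hgR hRs ?_
  rw [lintegral_withDensity_mul hw.weight.aemeasurable (by fun_prop),
    lintegral_withDensity_mul hw.weight.aemeasurable (by fun_prop)]
  simpa only [mul_left_comm] using hC _ hR f hf

theorem Dominated.of_pos (h𝓕 : ∀ f ∈ 𝓕, AEMeasurable f.1 volume ∧ AEMeasurable f.2 volume)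
    (hp : 0 < p) (hr : 0 < r) (h : Dominated 𝓕 p) : Dominated 𝓕 r := by
  rcases lt_trichotomy r p with hrp | rfl | hpr
  · exact h.down h𝓕 hr hrp
  · exact h
  · exact h.up h𝓕 hp hpr

end Extrapolation

section WeakType

variable {α : Type*} [MeasurableSpace α] {ν : Measure α} {q P r t : ℝ} {f g H : α → ℝ≥0∞}
  {A C m N : ℝ≥0∞} {E s : Set α}

theorem measure_le_of_forall_subset_le [SigmaFinite ν] (hs : NullMeasurableSet s ν)
    (h : ∀ E, MeasurableSet E → E ⊆ s → ν E ≠ ∞ → ν E ≤ A) : ν s ≤ A := by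
  obtain ⟨s', hs's, hs', hae⟩ := hs.exists_measurable_subset_ae_eq
  rw [← measure_congr hae]
  by_contra! hA
  obtain ⟨E, hE, hEs, hAE, hEtop⟩ := ν.exists_subset_measure_lt_top hs' hA
  exact (h E hE (hEs.trans hs's) hEtop.ne).not_gt hAE

theorem setLIntegral_le_mul_rpow_mul_rpow (hP : 1 < P) (hH : AEMeasurable H ν)
    (hHP : ∫⁻ x, H x ^ P ∂ν ≤ A ^ P * m) (s : Set α) :
    ∫⁻ x in s, H x ∂ν ≤ A * m ^ (1 / P) * ν s ^ (1 - 1 / P) := by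
  have hP0 : 0 < P := by linarith
  have holder := lintegral_rpow_mul_le (R := 1) one_pos hP hH.restrict
    (aemeasurable_one (μ := ν.restrict s))
  simp only [ENNReal.rpow_one, Pi.one_apply, mul_one, ENNReal.one_rpow, lintegral_one,
    Measure.restrict_apply_univ] at holder
  calc ∫⁻ x in s, H x ∂ν ≤ (∫⁻ x in s, H x ^ P ∂ν) ^ (1 / P) * ν s ^ (1 - 1 / P) := holder
    _ ≤ (A ^ P * m) ^ (1 / P) * ν s ^ (1 - 1 / P) := by
        gcongr
        exact (setLIntegral_le_lintegral _ _).trans hHP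
    _ = A * m ^ (1 / P) * ν s ^ (1 - 1 / P) := by
        rw [ENNReal.mul_rpow_of_nonneg _ _ (by positivity), ← ENNReal.rpow_mul,
          mul_one_div_cancel hP0.ne', ENNReal.rpow_one]

theorem exists_rpow_mul_rpow_mul_ofReal_rpow_eq (q : ℝ) (hm : m ≠ 0 ∧ m ≠ ∞)
    (hN : N ≠ 0 ∧ N ≠ ∞) : ∃ σ : ℝ, 0 < σ ∧ ∀ a b : ℝ,
      N ^ a * m ^ (1 - a / q) * ENNReal.ofReal (σ ^ (b - a)) = N ^ b * m ^ (1 - b / q) := by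
  obtain ⟨μ, rfl⟩ := exists_eq_eexp hm
  obtain ⟨ν, rfl⟩ := exists_eq_eexp hN
  refine ⟨Real.exp (ν - μ / q), Real.exp_pos _, fun a b => ?_⟩
  rw [← Real.exp_mul, ← eexp]
  simp only [eexp_rpow, eexp_mul]
  congr 1
  ring

theorem setLIntegral_lt_le_of_lintegral_rpow_le (hP : 1 < P) (hq : 0 < q)
    (hH : AEMeasurable H ν) (hHP : ∫⁻ x, H x ^ P ∂ν ≤ A ^ P * m) {t : ℝ} (ht : 0 < t)
    (hgN : ν {x | ENNReal.ofReal t < g x} ≤ N ^ q * ENNReal.ofReal (t ^ (-q))) :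
    ∫⁻ x in {x | ENNReal.ofReal t < g x}, H x ∂ν ≤
      A * (N ^ (q * (1 - 1 / P)) * m ^ (1 - q * (1 - 1 / P) / q)) *
        ENNReal.ofReal (t ^ (-(q * (1 - 1 / P)))) := by
  have hP1 : 0 < 1 - 1 / P := sub_pos.2 ((div_lt_one (by linarith)).2 hP)
  calc ∫⁻ x in {x | ENNReal.ofReal t < g x}, H x ∂ν
      ≤ A * m ^ (1 / P) * (N ^ q * ENNReal.ofReal (t ^ (-q))) ^ (1 - 1 / P) := by
        refine (setLIntegral_le_mul_rpow_mul_rpow hP hH hHP _).trans ?_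
        gcongr
    _ = _ := by
        rw [ENNReal.mul_rpow_of_nonneg _ _ hP1.le, ← ENNReal.rpow_mul,
          ENNReal.ofReal_rpow_of_nonneg (by positivity) hP1.le, ← Real.rpow_mul ht.le, neg_mul,
          show 1 - q * (1 - 1 / P) / q = 1 / P by field_simp; ring]
        ring

theorem setLIntegral_lt_le_of_ae_le (hHA : ∀ᵐ x ∂ν, H x ≤ A) {t : ℝ}
    (hgN : ν {x | ENNReal.ofReal t < g x} ≤ N ^ q * ENNReal.ofReal (t ^ (-q))) :
    ∫⁻ x in {x | ENNReal.ofReal t < g x}, H x ∂ν ≤ A * N ^ q * ENNReal.ofReal (t ^ (-q)) :=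
  calc ∫⁻ x in {x | ENNReal.ofReal t < g x}, H x ∂ν
      ≤ ∫⁻ _ in {x | ENNReal.ofReal t < g x}, A ∂ν := lintegral_mono_ae (ae_restrict_of_ae hHA)
    _ = A * ν {x | ENNReal.ofReal t < g x} := setLIntegral_const _ _
    _ ≤ A * (N ^ q * ENNReal.ofReal (t ^ (-q))) := mul_le_mul_right hgN _
    _ = _ := (mul_assoc _ _ _).symm

theorem lintegral_rpow_mul_le_of_meas_lt_le (hP : 1 < P) (hr : 0 < r) (hrP : q * (1 - 1 / P) < r)
    (hrq : r < q) (hH : AEMeasurable H ν) (hg : AEMeasurable g ν) (hHA : ∀ᵐ x ∂ν, H x ≤ A)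
    (hm : m ≠ 0 ∧ m ≠ ∞) (hN : N ≠ 0 ∧ N ≠ ∞) (hHP : ∫⁻ x, H x ^ P ∂ν ≤ A ^ P * m)
    (hgN : ∀ t : ℝ, 0 < t → ν {x | ENNReal.ofReal t < g x} ≤ N ^ q * ENNReal.ofReal (t ^ (-q))) :
    ∫⁻ x, g x ^ r * H x ∂ν ≤
      A * ENNReal.ofReal (r / (r - q * (1 - 1 / P)) + r / (q - r)) * (N ^ r * m ^ (1 - r / q)) := by
  have hq : 0 < q := hr.trans hrq
  have hlevel (t : ℝ) : (ν.withDensity H) {x | ENNReal.ofReal t < g x} =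
      ∫⁻ x in {x | ENNReal.ofReal t < g x}, H x ∂ν :=
    withDensity_apply₀ _ (nullMeasurableSet_lt aemeasurable_const hg)
  -- The level sets are bounded by one expression in an exponent, taken at `a` and at `q`; a single
  -- cut `σ` balances both.
  set a := q * (1 - 1 / P)
  have hbig (t : ℝ) (ht : 0 < t) : (ν.withDensity H) {x | ENNReal.ofReal t < g x} ≤
      A * (N ^ a * m ^ (1 - a / q)) * ENNReal.ofReal (t ^ (-a)) :=
    (hlevel t).trans_le (setLIntegral_lt_le_of_lintegral_rpow_le hP hq hH hHP ht (hgN t ht))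
  have hsmall (t : ℝ) (ht : 0 < t) : (ν.withDensity H) {x | ENNReal.ofReal t < g x} ≤
      A * (N ^ q * m ^ (1 - q / q)) * ENNReal.ofReal (t ^ (-q)) := by
    rw [hlevel, div_self hq.ne', sub_self, ENNReal.rpow_zero, mul_one]
    exact setLIntegral_lt_le_of_ae_le hHA (hgN t ht)
  obtain ⟨σ, hσ, hσeq⟩ := exists_rpow_mul_rpow_mul_ofReal_rpow_eq q hm hN
  have hc₁ : 0 ≤ r / (r - a) := div_nonneg hr.le (by linarith)
  have hc₂ : 0 ≤ r / (q - r) := div_nonneg hr.le (by linarith)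
  calc ∫⁻ x, g x ^ r * H x ∂ν = ∫⁻ x, g x ^ r ∂(ν.withDensity H) := by
        rw [lintegral_withDensity_eq_lintegral_mul₀ hH (hg.pow_const r)]
        simp only [Pi.mul_apply, mul_comm]
    _ ≤ A * (N ^ a * m ^ (1 - a / q)) * ENNReal.ofReal (r / (r - a) * σ ^ (r - a)) +
          A * (N ^ q * m ^ (1 - q / q)) * ENNReal.ofReal (r / (q - r) * σ ^ (r - q)) :=
        lintegral_rpow_le_of_meas_lt_le_rpow (hg.mono_ac (withDensity_absolutelyContinuous _ _))
          hr hrP hrq hbig hsmall hσ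
    _ = A * ENNReal.ofReal (r / (r - a)) *
            (N ^ a * m ^ (1 - a / q) * ENNReal.ofReal (σ ^ (r - a))) +
          A * ENNReal.ofReal (r / (q - r)) *
            (N ^ q * m ^ (1 - q / q) * ENNReal.ofReal (σ ^ (r - q))) := by
        rw [ENNReal.ofReal_mul hc₁, ENNReal.ofReal_mul hc₂]
        ring
    _ = A * ENNReal.ofReal (r / (r - a) + r / (q - r)) * (N ^ r * m ^ (1 - r / q)) := by
        rw [hσeq, hσeq, ENNReal.ofReal_add hc₁ hc₂]
        ring

theorem measure_le_of_lintegral_rpow_mul_le (hP : 1 < P) (hr : 0 < r) (hrP : q * (1 - 1 / P) < r)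
    (hrq : r < q) (hH : AEMeasurable H ν) (hg : AEMeasurable g ν) (hHA : ∀ᵐ x ∂ν, H x ≤ A)
    (hE : MeasurableSet E) (hνE : ν E ≠ 0 ∧ ν E ≠ ∞) (hHE : ∀ x ∈ E, 1 ≤ H x)
    (hHP : ∫⁻ x, H x ^ P ∂ν ≤ A ^ P * ν E) (hN : N ≠ 0 ∧ N ≠ ∞)
    (hgN : ∀ t : ℝ, 0 < t → ν {x | ENNReal.ofReal t < g x} ≤ N ^ q * ENNReal.ofReal (t ^ (-q)))
    (hfg : ∫⁻ x, f x ^ r * H x ∂ν ≤ C * ∫⁻ x, g x ^ r * H x ∂ν) (ht : 0 < t)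
    (hEf : ∀ x ∈ E, ENNReal.ofReal t ≤ f x) :
    ν E ≤ (C * (A * ENNReal.ofReal (r / (r - q * (1 - 1 / P)) + r / (q - r)))) ^ (q / r) *
      N ^ q * ENNReal.ofReal (t ^ (-q)) := by
  have hq : 0 < q := hr.trans hrq
  set c := A * ENNReal.ofReal (r / (r - q * (1 - 1 / P)) + r / (q - r))
  have htr : ENNReal.ofReal (t ^ (-r)) * ENNReal.ofReal t ^ r = 1 := by
    rw [ENNReal.ofReal_rpow_of_pos ht, ← ENNReal.ofReal_mul (by positivity), ← Real.rpow_add ht,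
      neg_add_cancel, Real.rpow_zero, ENNReal.ofReal_one]
  have hE' : ν E ≤ ENNReal.ofReal (t ^ (-r)) * ∫⁻ x, f x ^ r * H x ∂ν := by
    calc ν E = ENNReal.ofReal (t ^ (-r)) * ∫⁻ _ in E, ENNReal.ofReal t ^ r ∂ν := by
          rw [setLIntegral_const, ← mul_assoc, htr, one_mul]
      _ ≤ ENNReal.ofReal (t ^ (-r)) * ∫⁻ x in E, f x ^ r * H x ∂ν := by
          refine mul_le_mul_right (setLIntegral_mono' hE fun x hx => ?_) _
          refine le_mul_of_le_of_one_le ?_ (hHE x hx)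
          gcongr
          exact hEf x hx
      _ ≤ ENNReal.ofReal (t ^ (-r)) * ∫⁻ x, f x ^ r * H x ∂ν := by
          gcongr
          exact Measure.restrict_le_self
  have habs : ν E ≤ C * c * ENNReal.ofReal (t ^ (-r)) *
      ((N ^ q) ^ (r / q) * ν E ^ (1 - r / q)) := by
    have hweak := lintegral_rpow_mul_le_of_meas_lt_le hP hr hrP hrq hH hg hHA hνE hN hHP hgN
    refine hE'.trans ((mul_le_mul_right (hfg.trans (mul_le_mul_right hweak _)) _).trans_eq ?_)
    rw [← ENNReal.rpow_mul, mul_div_cancel₀ _ hq.ne']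
    ring
  refine (le_rpow_inv_mul_of_le_mul_rpow (by positivity) hνE habs).trans_eq ?_
  rw [inv_div, ENNReal.mul_rpow_of_nonneg _ _ (by positivity),
    ENNReal.ofReal_rpow_of_pos (by positivity), ← Real.rpow_mul ht.le,
    show -r * (q / r) = -q by field_simp]
  ring

end WeakType

section MixedWeakType

variable {n : ℕ} {a b q : ℝ} {K L : ℝ≥0} {N : ℝ≥0∞} {g u v W : (Fin n → ℝ) → ℝ≥0∞}

theorem weakNorm_le_iff (hq : 0 < q) : weakNorm q W g ≤ N ↔ ∀ t : ℝ, 0 < t →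
    (volume.withDensity W) {x | ENNReal.ofReal t < g x} ≤ N ^ q * ENNReal.ofReal (t ^ (-q)) := by
  have hlevel {t : ℝ} (ht : 0 < t) (m : ℝ≥0∞) :
      ENNReal.ofReal t * m ^ (1 / q) ≤ N ↔ m ≤ N ^ q * ENNReal.ofReal (t ^ (-q)) := by
    rw [← ENNReal.ofReal_rpow_of_pos ht, ENNReal.rpow_neg, ← div_eq_mul_inv,
      ← ENNReal.div_rpow_of_nonneg _ _ hq.le, ← ENNReal.rpow_inv_le_iff hq, one_div, mul_comm,
      ENNReal.le_div_iff_mul_le (Or.inl (by simpa)) (Or.inl ENNReal.ofReal_ne_top)]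
  simp only [withDensity_apply', weakNorm, iSup_le_iff]
  refine ⟨fun h t ht => (hlevel ht _).1 (h t.toNNReal (by simpa)), fun h t ht => ?_⟩
  simpa only [ENNReal.ofReal_coe_nnreal] using (hlevel (NNReal.coe_pos.2 ht) _).2 (h t ht)

/-- The weights `u₀ * ω ^ (-a)` with `u₀, ω ∈ A_1` whose `A_1` constants are at most `K`; for
`a = p - 1` these are the factored `A_p` weights. -/
def IsA1Quotient (a : ℝ) (K : ℝ≥0) (u : (Fin n → ℝ) → ℝ≥0∞) : Prop :=
  ∃ u₀ ω : (Fin n → ℝ) → ℝ≥0∞, A1 K u₀ ∧ A1 K ω ∧ ∀ᵐ x, u x = u₀ x * ω x ^ (-a)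

theorem IsA1Quotient.mono (hu : IsA1Quotient a K u) (hKL : K ≤ L) : IsA1Quotient a L u := by
  obtain ⟨u₀, ω, hu₀, hω, h⟩ := hu
  exact ⟨u₀, ω, hu₀.mono hKL, hω.mono hKL, h⟩

theorem IsA1Quotient.aemeasurable (hu : IsA1Quotient a K u) : AEMeasurable u := by
  obtain ⟨u₀, ω, hu₀, hω, h⟩ := hu
  exact (hu₀.weight.aemeasurable.mul (hω.weight.aemeasurable.pow_const _)).congr
    (EventuallyEq.symm h)

theorem IsA1Quotient.ae_ne (hu : IsA1Quotient a K u) : ∀ᵐ x, u x ≠ 0 ∧ u x ≠ ∞ := by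
  obtain ⟨u₀, ω, hu₀, hω, h⟩ := hu
  filter_upwards [h, hu₀.weight.ae_ne, hω.weight.ae_ne] with x hx h₁ h₂
  rw [hx]
  exact mul_ne_zero_top h₁ (rpow_ne_zero_top h₂ _)

theorem A1.rpow_mul_rpow_of_lt (hu : A1 K u) (hv : A1 L v) (ha : 0 ≤ a) (ha1 : a < 1)
    (hb : 0 ≤ b) (hab : a + b ≤ 1) : A1 (K ^ a * L ^ b) (fun x => u x ^ a * v x ^ b) := by
  have ha' : 0 < 1 - a := sub_pos.2 ha1
  have hvb := hv.rpow (a := b / (1 - a)) (by positivity) ((div_le_one ha').2 (by linarith))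
  have h := hu.rpow_mul_rpow hvb ha ha'.le (add_sub_cancel a 1)
  simpa only [← ENNReal.rpow_mul, ← NNReal.rpow_mul, div_mul_cancel₀ _ ha'.ne'] using h

theorem A1.rpow_div_mul_rpow_div (hu : A1 K u) (hv : A1 L v) (ha : 0 ≤ a) (hb : 0 ≤ b) :
    A1 (K ^ (a / (a + b + 1)) * L ^ (b / (a + b + 1)))
      (fun x => u x ^ (a / (a + b + 1)) * v x ^ (b / (a + b + 1))) :=
  hu.rpow_mul_rpow_of_lt hv (by positivity) ((div_lt_one (by positivity)).2 (by linarith))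
    (by positivity) (by rw [← add_div]; exact (div_le_one (by positivity)).2 (by linarith))

theorem A1.ap_mul_rpow_neg_mul_rpow_neg {K₁ K₂ : ℝ≥0} {ω₁ ω₂ : (Fin n → ℝ) → ℝ≥0∞} (hu : A1 K u)
    (hω₁ : A1 K₁ ω₁) (hω₂ : A1 K₂ ω₂) (ha : 0 ≤ a) (hb : 0 ≤ b) :
    Ap (1 + (a + b + 1)) (K * (K₁ ^ (a / (a + b + 1)) * K₂ ^ (b / (a + b + 1))) ^ (a + b + 1))
      (fun x => u x * (ω₁ x ^ (-a) * ω₂ x ^ (-b))) := by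
  refine (hu.ap (hω₁.rpow_div_mul_rpow_div hω₂ ha hb) (by positivity)).congr ?_
  filter_upwards [hω₁.weight.ae_ne, hω₂.weight.ae_ne] with x h₁ h₂
  obtain ⟨t₁, e₁⟩ := exists_eq_eexp h₁
  obtain ⟨t₂, e₂⟩ := exists_eq_eexp h₂
  simp only [e₁, e₂, eexp_rpow, eexp_mul]
  congr 2
  field_simp
  ring

-- With `A = a + b + 1` the weight equals `v * (u * (ω₁ ^ (a / A) * ω₂ ^ (b / A)) ^ θ) ^ (-A / θ)`,
-- and the base is in `A_1` once `θ` is small.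
theorem exists_ap_rpow_neg_mul (hn : 0 < n) (ha : 0 ≤ a) (hb : 0 ≤ b) (K : ℝ≥0) :
    ∃ (P : ℝ) (K' : ℝ≥0), 1 < P ∧ ∀ u v ω₁ ω₂ : (Fin n → ℝ) → ℝ≥0∞,
      A1 K u → A1 K v → A1 K ω₁ → A1 K ω₂ →
      Ap P K' (fun x => u x ^ (-P) * (u x * ω₁ x ^ (-a) * (v x * ω₂ x ^ (-b)))) := by
  obtain ⟨θ, hθ, -, hmul⟩ := exists_A1_mul_rpow hn K
  set A : ℝ := a + b + 1 with hA
  have hA0 : 0 < A := by positivity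
  obtain ⟨K₁, hK₁⟩ := hmul θ hθ.le le_rfl (K ^ (a / A) * K ^ (b / A))
  refine ⟨1 + A / θ, K * K₁ ^ (A / θ), by linarith [div_pos hA0 hθ],
    fun u v ω₁ ω₂ hu hv hω₁ hω₂ => ?_⟩
  refine (hv.ap (hK₁ _ _ hu (hω₁.rpow_div_mul_rpow_div hω₂ ha hb)) (by positivity)).congr ?_
  filter_upwards [hu.weight.ae_ne, hv.weight.ae_ne, hω₁.weight.ae_ne, hω₂.weight.ae_ne]
    with x h₁ h₂ h₃ h₄
  obtain ⟨t₁, e₁⟩ := exists_eq_eexp h₁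
  obtain ⟨t₂, e₂⟩ := exists_eq_eexp h₂
  obtain ⟨t₃, e₃⟩ := exists_eq_eexp h₃
  obtain ⟨t₄, e₄⟩ := exists_eq_eexp h₄
  simp only [e₁, e₂, e₃, e₄, eexp_rpow, eexp_mul, ← hA]
  congr 1
  field_simp
  ring

theorem exists_A1_majorant {P : ℝ} (hP : 1 < P) (K K' : ℝ≥0) :
    ∃ L : ℝ≥0, ∀ u W h : (Fin n → ℝ) → ℝ≥0∞, A1 K u → Ap P K' (fun x => u x ^ (-P) * W x) →
      AEMeasurable W → AEMeasurable h → (∀ᵐ x, h x ≤ 1) → ¬ h =ᵐ[volume] 0 →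
      ∃ H : (Fin n → ℝ) → ℝ≥0∞, AEMeasurable H ∧ h ≤ H ∧ (∀ᵐ x, H x ≤ 2) ∧
        ∫⁻ x, H x ^ P ∂(volume.withDensity W) ≤ 2 ^ P * ∫⁻ x, h x ^ P ∂(volume.withDensity W) ∧
        A1 L (fun x => H x * u x) := by
  obtain ⟨C, hC1, hC⟩ := exists_lintegral_maximal_rpow_le n hP K'
  set B : ℝ≥0 := max C K
  have hB1 : 1 ≤ B := hC1.trans (le_max_left _ _)
  refine ⟨2 * B, fun u W h hu hw hW hh hh1 hh0 => ?_⟩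
  have hum := hu.weight.aemeasurable
  have hT := isCountablySublinear_conjMaximal le_rfl hum
  have hbd (g : (Fin n → ℝ) → ℝ≥0∞) (hg : AEMeasurable g) :
      ∫⁻ x, conjMaximal 1 u g x ^ P ∂(volume.withDensity W) ≤
        B * ∫⁻ x, g x ^ P ∂(volume.withDensity W) := by
    have := lintegral_conjMaximal_rpow_mul_le one_pos (by linarith : 0 < P) (fun f => hC _ f hw) hum
      hu.weight.ae_ne (Eventually.of_forall fun _ => rfl) hg
    simp only [one_mul, mul_comm _ (W _)] at this
    rw [lintegral_withDensity_mul hW (hg.pow_const _),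
      lintegral_withDensity_mul hW ((hT.aemeasurable hg).pow_const _)]
    exact this.trans (by gcongr; exact le_max_left _ _)
  have hbd_top (g : (Fin n → ℝ) → ℝ≥0∞) (A : ℝ≥0∞) (hgA : ∀ᵐ x, g x ≤ A) :
      ∀ᵐ x, conjMaximal 1 u g x ≤ B * A := by
    filter_upwards [hu.conjMaximal_le one_pos hgA] with x hx
    rw [div_one, ENNReal.rpow_one] at hx
    exact hx.trans (by gcongr; exact le_max_right _ _)
  set H := rubioDeFrancia (conjMaximal 1 u) B h
  have hHm : AEMeasurable H := hT.aemeasurable_rubioDeFrancia hh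
  have hhH : h ≤ H := fun x => le_rubioDeFrancia x
  have hTH : ∀ᵐ x, conjMaximal 1 u H x ≤ (2 * B : ℝ≥0) * H x :=
    Eventually.of_forall (hT.apply_rubioDeFrancia_le hB1 hh)
  have hH2 : ∀ᵐ x, H x ≤ 2 := ae_rubioDeFrancia_le_two hB1 hbd_top hh1
  have hH0 : ¬ H =ᵐ[volume] 0 := fun h0 => hh0 <| h0.mono fun x hx =>
    le_zero_iff.1 ((hhH x).trans hx.le)
  have hHne : ∀ᵐ x, H x ≠ 0 ∧ H x ≠ ∞ := by
    filter_upwards [ae_ne_zero_of_conjMaximal_le one_pos hHm hH0 hum hu.weight.ae_ne hTH, hH2]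
      with x h₁ h₂
    exact ⟨h₁, ne_top_of_le_ne_top ENNReal.ofNat_ne_top h₂⟩
  refine ⟨H, hHm, hhH, hH2, hT.lintegral_rubioDeFrancia_rpow_le hB1
    (withDensity_absolutelyContinuous _ _) hP.le hbd hh, ?_⟩
  simpa using A1.of_conjMaximal_le one_pos hHm hHne hum hu.weight.ae_ne hTH

theorem exists_ap_mul_rpow_mul (hn : 0 < n) (ha : 0 ≤ a) (hb : 0 ≤ b) (K L : ℝ≥0) :
    ∃ θ : ℝ, 0 < θ ∧ θ < 1 ∧ ∀ ε : ℝ, 0 ≤ ε → ε ≤ θ → ∃ (s : ℝ) (K' : ℝ≥0), 1 < s ∧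
      ∀ u v ω₁ ω₂ : (Fin n → ℝ) → ℝ≥0∞, A1 L u → A1 K v → A1 K ω₁ → A1 K ω₂ →
      Ap s K' (fun x => u x * ω₁ x ^ (-a) * (v x * ω₂ x ^ (-b)) ^ ε) := by
  obtain ⟨θ, hθ, hθ1, hmul⟩ := exists_A1_mul_rpow hn L
  refine ⟨θ, hθ, hθ1, fun ε hε hεθ => ?_⟩
  obtain ⟨K₁, hK₁⟩ := hmul ε hε hεθ K
  refine ⟨_, _, ?_, fun u v ω₁ ω₂ hu hv hω₁ hω₂ => ((hK₁ u v hu hv).ap_mul_rpow_neg_mul_rpow_neg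
    hω₁ hω₂ ha (mul_nonneg hb hε)).congr ?_⟩
  · linarith [mul_nonneg hb hε]
  filter_upwards [hv.weight.ae_ne, hω₂.weight.ae_ne] with x h₁ h₂
  rw [ENNReal.mul_rpow_of_ne_top h₁.2 (rpow_ne_zero_top h₂ _).2, ← ENNReal.rpow_mul, neg_mul]
  ring

theorem exists_exponent_lt {P θ : ℝ} (hP : 1 < P) (hθ : 0 < θ) (hθ1 : θ < 1) (hq : 0 < q) :
    ∃ ε : ℝ, 0 ≤ ε ∧ ε ≤ θ ∧ 0 < q * (1 - ε) ∧ q * (1 - 1 / P) < q * (1 - ε) ∧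
      q * (1 - ε) < q := by
  obtain ⟨ε, hε, hεP⟩ := exists_between (lt_min hθ (one_div_pos.2 (one_pos.trans hP)))
  obtain ⟨hεθ, hεP⟩ := lt_min_iff.1 hεP
  exact ⟨ε, hε.le, hεθ.le, mul_pos hq (by linarith), by gcongr, by nlinarith⟩

/-- `H` majorizes the indicator function of `E`, is bounded by `2`, and its norm in `L^P(W)` is
comparable to that of the indicator function. The Rubio de Francia algorithm produces such an `H`
for which moreover `H * u₀` is an `A_1` weight. -/
structure IsMajorant (P : ℝ) (W : (Fin n → ℝ) → ℝ≥0∞) (E : Set (Fin n → ℝ))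
    (H : (Fin n → ℝ) → ℝ≥0∞) : Prop where
  aemeasurable : AEMeasurable H
  one_le : ∀ x ∈ E, 1 ≤ H x
  le_two : ∀ᵐ x, H x ≤ 2
  lintegral_le : ∫⁻ x, H x ^ P ∂(volume.withDensity W) ≤ 2 ^ P * (volume.withDensity W) E

theorem exists_isMajorant (hn : 0 < n) (ha : 0 ≤ a) (hb : 0 ≤ b) (K : ℝ≥0) :
    ∃ (P : ℝ) (L : ℝ≥0), 1 < P ∧ ∀ u₀ v₀ ω₁ ω₂ W : (Fin n → ℝ) → ℝ≥0∞,
      A1 K u₀ → A1 K v₀ → A1 K ω₁ → A1 K ω₂ →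
      (∀ᵐ x, W x = u₀ x * ω₁ x ^ (-a) * (v₀ x * ω₂ x ^ (-b))) → AEMeasurable W →
      ∀ E, MeasurableSet E → (volume.withDensity W) E ≠ 0 →
      ∃ H, IsMajorant P W E H ∧ A1 L (fun x => H x * u₀ x) := by
  obtain ⟨P, K', hP, hAp⟩ := exists_ap_rpow_neg_mul hn ha hb K
  obtain ⟨L, hL⟩ := exists_A1_majorant hP K K'
  refine ⟨P, L, hP, fun u₀ v₀ ω₁ ω₂ W hu₀ hv₀ hω₁ hω₂ hW hWm E hE hE0 => ?_⟩
  have hw : Ap P K' (fun x => u₀ x ^ (-P) * W x) :=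
    (hAp u₀ v₀ ω₁ ω₂ hu₀ hv₀ hω₁ hω₂).congr (hW.mono fun x hx => by simp only [hx])
  have h0 : ¬ E.indicator (1 : (Fin n → ℝ) → ℝ≥0∞) =ᵐ[volume] 0 := fun h0 => hE0 <|
    withDensity_absolutelyContinuous _ _ <| by
      simpa [indicator_ae_eq_zero, Function.support_one] using h0
  obtain ⟨H, hHm, hEH, hH2, hHP, hHA⟩ := hL u₀ W _ hu₀ hw hWm
    (aemeasurable_one.indicator hE)
    (Eventually.of_forall fun x => indicator_le_self' (fun _ _ => zero_le_one) x) h0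
  refine ⟨H, ⟨hHm, fun x hx => by simpa [hx] using hEH x, hH2, hHP.trans_eq ?_⟩, hHA⟩
  congr 1
  rw [← lintegral_indicator_one hE]
  refine lintegral_congr fun x => ?_
  by_cases hx : x ∈ E <;> simp [hx, (by linarith : 0 < P)]

theorem weakNorm_le_of_forall_majorant {P r : ℝ} {C : ℝ≥0} {f : (Fin n → ℝ) → ℝ≥0∞} (hP : 1 < P)
    (hr : 0 < r) (hrP : q * (1 - 1 / P) < r) (hrq : r < q) (hC : C ≠ 0)
    (hW : ∀ᵐ x, W x ≠ ∞) (hf : AEMeasurable f) (hg : AEMeasurable g)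
    (hmaj : ∀ E, MeasurableSet E → (volume.withDensity W) E ≠ 0 →
      ∃ H, IsMajorant P W E H ∧ ∫⁻ x, f x ^ r * H x ∂(volume.withDensity W) ≤
        C * ∫⁻ x, g x ^ r * H x ∂(volume.withDensity W)) :
    weakNorm q W f ≤
      (C * (2 * ENNReal.ofReal (r / (r - q * (1 - 1 / P)) + r / (q - r)))) ^ (1 / r) *
        weakNorm q W g := by
  set M : ℝ≥0∞ := C * (2 * ENNReal.ofReal (r / (r - q * (1 - 1 / P)) + r / (q - r)))
  have hq : 0 < q := hr.trans hrq
  have hac := withDensity_absolutelyContinuous (μ := volume) W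
  have : SigmaFinite (volume.withDensity W) := SigmaFinite.withDensity_of_ne_top hW
  have hM : M ≠ 0 ∧ M ≠ ∞ := by
    have : 0 < r / (r - q * (1 - 1 / P)) + r / (q - r) :=
      add_pos (div_pos hr (sub_pos.2 hrP)) (div_pos hr (sub_pos.2 hrq))
    exact mul_ne_zero_top ⟨by simpa, by simp⟩ (mul_ne_zero_top (by simp) ⟨by simpa, by simp⟩)
  obtain hG | hG := eq_or_ne (weakNorm q W g) ∞
  · rw [hG, ENNReal.mul_top (rpow_ne_zero_top hM _).1]
    exact le_top
  refine le_apply_of_forall_le_apply_add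
    (ENNReal.continuous_const_mul (rpow_ne_zero_top hM _).2) fun δ hδ => ?_
  set N := weakNorm q W g + ENNReal.ofReal δ
  have hN : N ≠ 0 ∧ N ≠ ∞ := ⟨by simp [N, hδ], by simp [N, hG]⟩
  refine (weakNorm_le_iff hq).2 fun t ht => ?_
  rw [ENNReal.mul_rpow_of_nonneg _ _ hq.le, ← ENNReal.rpow_mul, one_div_mul_eq_div]
  refine measure_le_of_forall_subset_le (nullMeasurableSet_lt aemeasurable_const
    (hf.mono_ac hac)) fun E hE hEt hνE => ?_
  obtain h0 | h0 := eq_or_ne ((volume.withDensity W) E) 0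
  · rw [h0]
    exact zero_le
  obtain ⟨H, hH, hfg⟩ := hmaj E hE h0
  exact measure_le_of_lintegral_rpow_mul_le hP hr hrP hrq (hH.aemeasurable.mono_ac hac)
    (hg.mono_ac hac) (hac.ae_le hH.le_two) hE ⟨h0, hνE⟩ hH.one_le hH.lintegral_le hN
    ((weakNorm_le_iff hq).1 le_self_add) hfg ht fun x hx => (hEt hx).le

theorem lintegral_rpow_mul_inv_rpow {r : ℝ} (hr : 0 ≤ r) (hW : AEMeasurable W)
    {f H : (Fin n → ℝ) → ℝ≥0∞} (hf : AEMeasurable f) (hv : AEMeasurable v) (hH : AEMeasurable H) :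
    ∫⁻ x, (f x * (v x)⁻¹) ^ r * H x ∂(volume.withDensity W) =
      ∫⁻ x, f x ^ r * (H x * ((v x)⁻¹ ^ r * W x)) := by
  rw [lintegral_withDensity_mul hW (by fun_prop)]
  refine lintegral_congr fun x => ?_
  rw [ENNReal.mul_rpow_of_nonneg _ _ hr]
  ring

theorem inv_rpow_mul_rpow {x : ℝ≥0∞} (hq : 0 < q) (hx : x ^ q ≠ 0 ∧ x ^ q ≠ ∞) (ε : ℝ) :
    x⁻¹ ^ (q * (1 - ε)) * x ^ q = (x ^ q) ^ ε := by
  have hx : x ≠ 0 ∧ x ≠ ∞ := by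
    simpa [← ENNReal.rpow_mul, mul_inv_cancel₀ hq.ne'] using rpow_ne_zero_top hx q⁻¹
  obtain ⟨t, rfl⟩ := exists_eq_eexp hx
  simp only [eexp_inv, eexp_rpow, eexp_mul]
  congr 1
  ring

theorem ap_mul_inv_rpow_mul {s ε : ℝ} {u₀ v₀ ω₁ ω₂ H : (Fin n → ℝ) → ℝ≥0∞} (hq : 0 < q)
    (hu : ∀ᵐ x, u x = u₀ x * ω₁ x ^ (-a)) (hv : ∀ᵐ x, v x ^ q = v₀ x * ω₂ x ^ (-b))
    (hne : ∀ᵐ x, v x ^ q ≠ 0 ∧ v x ^ q ≠ ∞)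
    (h : Ap s K (fun x => H x * u₀ x * ω₁ x ^ (-a) * (v₀ x * ω₂ x ^ (-b)) ^ ε)) :
    Ap s K (fun x => H x * ((v x)⁻¹ ^ (q * (1 - ε)) * (u x * v x ^ q))) := by
  refine h.congr ?_
  filter_upwards [hu, hv, hne] with x hux hvx hx
  rw [mul_left_comm _ (u x), inv_rpow_mul_rpow hq hx, hux, hvx]
  ring

theorem aemeasurable_of_rpow (hq : 0 < q) (hv : AEMeasurable (fun x => v x ^ q)) :
    AEMeasurable v := by
  simpa [← ENNReal.rpow_mul, mul_inv_cancel₀ hq.ne'] using hv.pow_const q⁻¹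

variable {𝓕 : Set (((Fin n → ℝ) → ℝ≥0∞) × ((Fin n → ℝ) → ℝ≥0∞))}

theorem exists_weakNorm_le (hn : 0 < n)
    (h𝓕 : ∀ f ∈ 𝓕, AEMeasurable f.1 volume ∧ AEMeasurable f.2 volume)
    (hdom : ∀ r : ℝ, 0 < r → Dominated 𝓕 r) (hq : 0 < q) (ha : 0 ≤ a) (hb : 0 ≤ b) (K : ℝ≥0) :
    ∃ C : ℝ≥0, ∀ u v : (Fin n → ℝ) → ℝ≥0∞,
      IsA1Quotient a K u → IsA1Quotient b K (fun x => v x ^ q) → ∀ f ∈ 𝓕,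
        weakNorm q (fun x => u x * v x ^ q) (fun x => f.1 x * (v x)⁻¹) ≤
          C * weakNorm q (fun x => u x * v x ^ q) (fun x => f.2 x * (v x)⁻¹) := by
  obtain ⟨P, L, hP, hmaj⟩ := exists_isMajorant hn ha hb K
  obtain ⟨θ, hθ, hθ1, hAp⟩ := exists_ap_mul_rpow_mul hn ha hb K L
  obtain ⟨ε, hε, hεθ, hr, hrP, hrq⟩ := exists_exponent_lt hP hθ hθ1 hq
  obtain ⟨s, K', hs, hAp⟩ := hAp ε hε hεθ
  set r := q * (1 - ε)
  obtain ⟨C, hC⟩ := hdom r hr s hs K'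
  set D : ℝ≥0 := C + 1
  set M : ℝ≥0∞ := (D * (2 * ENNReal.ofReal (r / (r - q * (1 - 1 / P)) + r / (q - r)))) ^ (1 / r)
  have hM : M ≠ ∞ := ENNReal.rpow_ne_top_of_nonneg (by positivity) (by finiteness)
  refine ⟨M.toNNReal, fun u v hu hv f hf => ?_⟩
  rw [ENNReal.coe_toNNReal hM]
  have hvm : AEMeasurable v := aemeasurable_of_rpow hq hv.aemeasurable
  have hWm : AEMeasurable (fun x => u x * v x ^ q) := hu.aemeasurable.mul hv.aemeasurable
  have hW : ∀ᵐ x, u x * v x ^ q ≠ ∞ := by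
    filter_upwards [hu.ae_ne, hv.ae_ne] with x hux hvx using (mul_ne_zero_top hux hvx).2
  have hv_ne := hv.ae_ne
  obtain ⟨u₀, ω₁, hu₀, hω₁, hu⟩ := hu
  obtain ⟨v₀, ω₂, hv₀, hω₂, hv⟩ := hv
  refine weakNorm_le_of_forall_majorant (C := D) hP hr hrP hrq (by simp [D]) hW
    ((h𝓕 f hf).1.mul hvm.inv) ((h𝓕 f hf).2.mul hvm.inv) fun E hE hE0 => ?_
  obtain ⟨H, hH, hHu⟩ := hmaj u₀ v₀ ω₁ ω₂ _ hu₀ hv₀ hω₁ hω₂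
    (by filter_upwards [hu, hv] with x hux hvx using by rw [hux, hvx]) hWm E hE hE0
  have hw := ap_mul_inv_rpow_mul hq hu hv hv_ne (hAp _ v₀ ω₁ ω₂ hHu hv₀ hω₁ hω₂)
  refine ⟨H, hH, ?_⟩
  rw [lintegral_rpow_mul_inv_rpow hr.le hWm (h𝓕 f hf).1 hvm hH.aemeasurable,
    lintegral_rpow_mul_inv_rpow hr.le hWm (h𝓕 f hf).2 hvm hH.aemeasurable]
  refine (hC _ hw f hf).trans ?_
  gcongr
  exact le_self_add

end MixedWeakType

section HatClass

variable {n : ℕ} {q δ : ℝ} {f w u₀ : (Fin n → ℝ) → ℝ≥0∞} {h : (Fin n → ℝ) → ℝ}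

/-- The bound for the `A_1` constant of a finite power `(M f) ^ δ`, where `0 < δ < 1`. -/
noncomputable def coifmanRochbergConst (n : ℕ) (δ : ℝ) : ℝ≥0 :=
  1 + 5 ^ n * 5 ^ n * (δ / (1 - δ)).toNNReal + (5 ^ n) ^ δ

theorem one_le_coifmanRochbergConst (n : ℕ) (δ : ℝ) : 1 ≤ coifmanRochbergConst n δ := by
  rw [coifmanRochbergConst, add_assoc]
  exact le_self_add

theorem maximal_maximal_rpow_le (f : (Fin n → ℝ) → ℝ≥0∞) (hδ : 0 < δ) (hδ1 : δ < 1)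
    (x : Fin n → ℝ) :
    maximal (fun y => maximal f y ^ δ) x ≤ coifmanRochbergConst n δ * maximal f x ^ δ := by
  have hC : (coifmanRochbergConst n δ : ℝ≥0∞) =
      1 + (5 ^ n : ℝ≥0) * (5 ^ n : ℝ≥0) * ENNReal.ofReal (δ / (1 - δ)) + (5 ^ n : ℝ≥0) ^ δ := by
    rw [coifmanRochbergConst, ENNReal.ofReal, ← ENNReal.coe_rpow_of_nonneg _ hδ.le]
    push_cast
    rfl
  rw [hC]
  exact isDoubling_volume.ballMaximal_rpow_ballMaximal_le f hδ hδ1 x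

theorem ae_maximal_ne_top (hδ : 0 < δ) (hδ1 : δ < 1) {x₀ : Fin n → ℝ} (hx₀ : maximal f x₀ ≠ ∞) :
    ∀ᵐ x, maximal f x ≠ ∞ := by
  have hball : ∀ N : ℕ, ∀ᵐ x ∂(volume.restrict (closedBall x₀ (N + 1))), maximal f x ^ δ < ∞ := by
    intro N
    have hN : (0 : ℝ) < N + 1 := by positivity
    have havg : avg x₀ (N + 1) (fun y => maximal f y ^ δ) ≠ ∞ :=
      ne_top_of_le_ne_top
        (ENNReal.mul_ne_top ENNReal.coe_ne_top (ENNReal.rpow_ne_top_of_nonneg hδ.le hx₀))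
        ((avg_le_maximal hN (mem_closedBall_self hN.le)).trans
          (maximal_maximal_rpow_le f hδ hδ1 x₀))
    refine ae_lt_top (measurable_maximal.pow_const _) ?_
    rw [setLIntegral_eq_mul_avg _ _ hN]
    exact ENNReal.mul_ne_top measure_closedBall_lt_top.ne havg
  filter_upwards [ae_all_iff.2 fun N => (ae_restrict_iff' measurableSet_closedBall).1 (hball N)]
    with x hx
  obtain ⟨N, hN⟩ := exists_nat_ge (dist x x₀)
  intro htop
  have := hx N (mem_closedBall.2 (by linarith))
  simp [htop, hδ] at this

theorem a1_maximal_rpow (hf : AEMeasurable f) (hf0 : ¬ f =ᵐ[volume] 0) {x₀ : Fin n → ℝ}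
    (hx₀ : maximal f x₀ ≠ ∞) (hδ : 0 < δ) (hδ1 : δ < 1) :
    A1 (coifmanRochbergConst n δ) (fun x => maximal f x ^ δ) := by
  refine A1.of_maximal_le (measurable_maximal.pow_const _).aemeasurable ?_
    (Eventually.of_forall (maximal_maximal_rpow_le f hδ hδ1))
  filter_upwards [ae_maximal_ne_top hδ hδ1 hx₀] with x hx
  exact rpow_ne_zero_top ⟨isDoubling_volume.ballMaximal_ne_zero hf hf0 x, hx⟩ _

theorem maximalReal_trichotomy (hh : LocallyIntegrable h) (hδ : 0 < δ) (hδ1 : δ < 1) :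
    (∀ x, maximalReal h x = 0) ∨ (∀ x, maximalReal h x = ∞) ∨
      A1 (coifmanRochbergConst n δ) (fun x => maximalReal h x ^ δ) := by
  by_cases h0 : (fun y => ‖h y‖ₑ) =ᵐ[volume] 0
  · refine Or.inl fun x => le_antisymm (maximal_le fun c r hr _ => ?_) zero_le
    exact (avg_mono h0.le c r).trans_eq (avg_const hr 0)
  by_cases htop : ∀ x, maximalReal h x = ∞
  · exact Or.inr (Or.inl htop)
  obtain ⟨x₀, hx₀⟩ := not_forall.1 htop
  exact Or.inr (Or.inr
    (a1_maximal_rpow hh.aestronglyMeasurable.enorm h0 hx₀ hδ hδ1))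

theorem exists_a1_maximalReal_rpow_eq (hh : LocallyIntegrable h) {e : ℝ}
    (hne : ∀ᵐ x, maximalReal h x ^ e ≠ 0 ∧ maximalReal h x ^ e ≠ ∞) :
    ∃ ω : (Fin n → ℝ) → ℝ≥0∞, A1 (coifmanRochbergConst n (1 / 2)) ω ∧
      ∀ x, maximalReal h x ^ e = ω x ^ (2 * e) := by
  obtain rfl | he := eq_or_ne e 0
  · exact ⟨fun _ => 1, A1.one.mono (one_le_coifmanRochbergConst n _), fun x => by simp⟩
  obtain ⟨x, hx⟩ := hne.exists
  obtain h0 | htop | hA := maximalReal_trichotomy hh (δ := 1 / 2) (by norm_num) (by norm_num)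
  · obtain he | he := he.lt_or_gt <;> simp [h0, he] at hx
  · obtain he | he := he.lt_or_gt <;> simp [htop, he] at hx
  · refine ⟨_, hA, fun x => ?_⟩
    rw [← ENNReal.rpow_mul, one_div, inv_mul_cancel_left₀ two_ne_zero]

theorem HatFactor.isA1Quotient {K : ℝ≥0} (hw : IsWeight w) (h : HatFactor q w u₀) (hu₀ : A1 K u₀)
    (hK : coifmanRochbergConst n (1 / 2) ≤ K) : IsA1Quotient (2 * (q - 1)) K w := by
  obtain ⟨β, h₁, h₂, hβ0, hβ1, hh₁, hh₂, heq⟩ := h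
  have hfac : ∀ᵐ x, (maximalReal h₁ x ^ (β * (1 - q)) ≠ 0 ∧ maximalReal h₁ x ^ (β * (1 - q)) ≠ ∞) ∧
      maximalReal h₂ x ^ ((1 - β) * (1 - q)) ≠ 0 ∧ maximalReal h₂ x ^ ((1 - β) * (1 - q)) ≠ ∞ := by
    filter_upwards [hw.ae_ne, heq] with x hx he
    rw [he, mul_ne_zero_iff, mul_ne_zero_iff] at hx
    obtain ⟨⟨⟨ha, hb⟩, hc⟩, ht⟩ := hx
    refine ⟨⟨hb, fun hbt => ht ?_⟩, ⟨hc, fun hct => ht ?_⟩⟩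
    · rw [hbt, ENNReal.mul_top ha, ENNReal.top_mul hc]
    · rw [hct, ENNReal.mul_top (mul_ne_zero ha hb)]
  obtain ⟨ω₁, hω₁, he₁⟩ := exists_a1_maximalReal_rpow_eq hh₁ (hfac.mono fun _ h => h.1)
  obtain ⟨ω₂, hω₂, he₂⟩ := exists_a1_maximalReal_rpow_eq hh₂ (hfac.mono fun _ h => h.2)
  have hA := hω₁.rpow_mul_rpow hω₂ hβ0 (sub_nonneg.2 hβ1) (add_sub_cancel _ _)
  rw [← NNReal.rpow_add_of_nonneg _ hβ0 (sub_nonneg.2 hβ1), add_sub_cancel, NNReal.rpow_one] at hA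
  refine ⟨u₀, _, hu₀, hA.mono hK, ?_⟩
  filter_upwards [heq, hω₁.weight.ae_ne, hω₂.weight.ae_ne] with x hx hx₁ hx₂
  rw [hx, he₁, he₂, mul_assoc]
  obtain ⟨t₁, e₁⟩ := exists_eq_eexp hx₁
  obtain ⟨t₂, e₂⟩ := exists_eq_eexp hx₂
  simp only [e₁, e₂, eexp_rpow, eexp_mul]
  congr 2
  ring

theorem A1.of_a1Const_lt {u : (Fin n → ℝ) → ℝ≥0∞} (hu : IsWeight u) {K : ℝ≥0}
    (h : a1Const u < K) : A1 K u := by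
  obtain ⟨C, hC, hCK⟩ := sInf_lt_iff.1 h
  refine ⟨hu, ?_⟩
  filter_upwards [hC] with x hx using hx.trans (mul_le_mul_left hCK.le _)

theorem IsHatA2.exists_hatFactor (hq : 0 < q) (hw : IsHatA2 q w) :
    ∃ u₀ : (Fin n → ℝ) → ℝ≥0∞, HatFactor q w u₀ ∧ A1 (((hatA2Const q w).toNNReal + 1) ^ q) u₀ := by
  obtain ⟨-, u₁, hu₁, hfac₁⟩ := hw
  have hfin : hatA2Const q w ≠ ∞ :=
    ne_top_of_le_ne_top (ENNReal.rpow_ne_top_of_nonneg (by positivity) hu₁.2.ne)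
      (iInf_le_of_le u₁ (iInf_le_of_le hu₁ (iInf_le _ hfac₁)))
  have hlt : hatA2Const q w < hatA2Const q w + 1 := ENNReal.lt_add_right hfin one_ne_zero
  obtain ⟨u₀, h⟩ := iInf_lt_iff.1 hlt
  obtain ⟨hu₀, h⟩ := iInf_lt_iff.1 h
  obtain ⟨hfac, h⟩ := iInf_lt_iff.1 h
  refine ⟨u₀, hfac, A1.of_a1Const_lt hu₀.1 ?_⟩
  rw [ENNReal.coe_rpow_of_nonneg _ hq.le, ENNReal.coe_add, ENNReal.coe_toNNReal hfin]
  rwa [one_div, ENNReal.rpow_inv_lt_iff hq] at h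

end HatClass

section Sawyer

variable {n : ℕ} {q α : ℝ} {u v : (Fin n → ℝ) → ℝ≥0∞}
  {𝓕 : Set (((Fin n → ℝ) → ℝ≥0∞) × ((Fin n → ℝ) → ℝ≥0∞))}

theorem IsAInfty.exists_isA1Quotient (hu : IsAInfty u) :
    ∃ (a : ℝ) (K : ℝ≥0), 0 ≤ a ∧ IsA1Quotient a K u := by
  obtain ⟨s, hs1, hs, K, hK⟩ := hu.exists_ap 2
  obtain ⟨L, u₀, ω, hu₀, hω, h⟩ := hK.exists_factorization hs
  exact ⟨s - 1, L, (sub_pos.2 hs1).le, u₀, ω, hu₀, hω, h⟩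

theorem exists_weakNorm_le_of_isAInfty (hn : 0 < n)
    (h𝓕 : ∀ f ∈ 𝓕, AEMeasurable f.1 volume ∧ AEMeasurable f.2 volume)
    (hdom : ∀ r : ℝ, 0 < r → Dominated 𝓕 r) (hq : 0 < q) (hu : IsAInfty u)
    (hv : IsAInfty (fun x => v x ^ q)) :
    ∃ C : ℝ≥0, ∀ f ∈ 𝓕, weakNorm q (fun x => u x * v x ^ q) (fun x => f.1 x * (v x)⁻¹) ≤
      C * weakNorm q (fun x => u x * v x ^ q) (fun x => f.2 x * (v x)⁻¹) := by
  obtain ⟨a, K, ha, hu⟩ := hu.exists_isA1Quotient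
  obtain ⟨b, L, hb, hv⟩ := hv.exists_isA1Quotient
  obtain ⟨C, hC⟩ := exists_weakNorm_le hn h𝓕 hdom hq ha hb (max K L)
  exact ⟨C, hC u v (hu.mono (le_max_left _ _)) (hv.mono (le_max_right _ _))⟩

theorem isA1Quotient_maximalReal_rpow_neg {K : ℝ≥0} {h : (Fin n → ℝ) → ℝ}
    (hA : A1 K (fun x => maximalReal h x ^ (1 / 2 : ℝ))) (hK : 1 ≤ K) (a : ℝ) :
    IsA1Quotient (2 * a) K (fun x => maximalReal h x ^ (-a)) := by
  refine ⟨fun _ => 1, _, A1.one.mono hK, hA, Eventually.of_forall fun x => ?_⟩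
  simp [← ENNReal.rpow_mul]

theorem exists_weakNorm_le_of_isHatA2 (hn : 0 < n)
    (h𝓕 : ∀ f ∈ 𝓕, AEMeasurable f.1 volume ∧ AEMeasurable f.2 volume)
    (hdom : ∀ r : ℝ, 0 < r → Dominated 𝓕 r) (hq : 1 ≤ q) (hα : 0 < α) (K : ℝ≥0) :
    ∃ C : ℝ≥0, ∀ (u : (Fin n → ℝ) → ℝ≥0∞) (h : (Fin n → ℝ) → ℝ) (v : (Fin n → ℝ) → ℝ≥0∞),
      IsHatA2 q u → ((hatA2Const q u).toNNReal + 1) ^ q ≤ K → LocallyIntegrable h →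
      (∀ x, v x = maximalReal h x ^ (-α)) →
      ∀ f ∈ 𝓕, weakNorm q (fun x => u x * v x ^ q) (fun x => f.1 x * (v x)⁻¹) ≤
        C * weakNorm q (fun x => u x * v x ^ q) (fun x => f.2 x * (v x)⁻¹) := by
  have hq0 : 0 < q := one_pos.trans_le hq
  set L := coifmanRochbergConst n (1 / 2)
  have hKL : 1 ≤ max K L := (one_le_coifmanRochbergConst n _).trans (le_max_right _ _)
  obtain ⟨C, hC⟩ := exists_weakNorm_le hn h𝓕 hdom hq0 (a := 2 * (q - 1)) (b := 2 * (α * q))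
    (by linarith) (by positivity) (max K L)
  refine ⟨C, fun u h v hu huK hh hv f hf => ?_⟩
  obtain ⟨u₀, hfac, hu₀⟩ := hu.exists_hatFactor hq0
  have huQ := hfac.isA1Quotient hu.1 (hu₀.mono (huK.trans (le_max_left _ _))) (le_max_right _ _)
  obtain h0 | htop | hA := maximalReal_trichotomy hh (δ := 1 / 2) (by norm_num) (by norm_num)
  · simp [weakNorm, hv, h0, hα, hq0]
  · simp [weakNorm, hv, htop, hα, hq0]
  · have hvQ := isA1Quotient_maximalReal_rpow_neg (hA.mono (le_max_right K L)) hKL (α * q)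
    simp only [← neg_mul, ENNReal.rpow_mul, ← hv] at hvQ
    exact hC u v huQ hvQ f hf

theorem exists_monotone_weakNorm_le_of_isHatA2 (hn : 0 < n)
    (h𝓕 : ∀ f ∈ 𝓕, AEMeasurable f.1 volume ∧ AEMeasurable f.2 volume)
    (hdom : ∀ r : ℝ, 0 < r → Dominated 𝓕 r) (hq : 1 ≤ q) (hα : 0 < α) :
    ∃ ψ : ℝ≥0 → ℝ≥0, Monotone ψ ∧
      ∀ (u : (Fin n → ℝ) → ℝ≥0∞) (h : (Fin n → ℝ) → ℝ) (v : (Fin n → ℝ) → ℝ≥0∞),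
      IsHatA2 q u → LocallyIntegrable h → (∀ x, v x = maximalReal h x ^ (-α)) →
      ∀ f ∈ 𝓕, weakNorm q (fun x => u x * v x ^ q) (fun x => f.1 x * (v x)⁻¹) ≤
        ψ (hatA2Const q u).toNNReal *
          weakNorm q (fun x => u x * v x ^ q) (fun x => f.2 x * (v x)⁻¹) := by
  choose C hC using fun k : ℕ => exists_weakNorm_le_of_isHatA2 hn h𝓕 hdom hq hα k
  refine ⟨fun t => ∑ k ∈ Finset.range (⌈(t + 1) ^ q⌉₊ + 1), C k, fun s t hst => ?_,
    fun u h v hu hh hv f hf => (hC _ u h v hu (Nat.le_ceil _) hh hv f hf).trans ?_⟩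
  · refine Finset.sum_le_sum_of_subset (Finset.range_mono ?_)
    gcongr
  · gcongr
    exact Finset.single_le_sum (f := C) (fun _ _ => zero_le) (Finset.self_mem_range_succ _)

end Sawyer

end Muckenhoupt

theorem theorem1p4_general {n : ℕ} (hn : 0 < n)
    (F : Set (((Fin n → ℝ) → ℝ≥0∞) × ((Fin n → ℝ) → ℝ≥0∞)))
    (hF : ∀ f ∈ F, AEMeasurable f.1 volume ∧ AEMeasurable f.2 volume)
    (p₀ : ℝ) (hp₀ : 0 < p₀) (φ : ℝ≥0 → ℝ≥0) (hφ : Monotone φ)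
    (hyp : ∀ w : (Fin n → ℝ) → ℝ≥0∞, IsAInfty w → ∀ f ∈ F,
      ∫⁻ x, f.1 x ^ p₀ * w x < ∞ →
      ∫⁻ x, f.1 x ^ p₀ * w x ≤ φ (aInftyConst w).toNNReal * ∫⁻ x, f.2 x ^ p₀ * w x)
    (q : ℝ) (hq : 0 < q) :
    (∀ u v : (Fin n → ℝ) → ℝ≥0∞, IsAInfty u → IsAInfty (fun x => v x ^ q) →
      ∃ C : ℝ≥0, ∀ f ∈ F,
        (∃ w₀ : (Fin n → ℝ) → ℝ≥0∞, IsAInfty w₀ ∧ ∫⁻ x, f.1 x ^ p₀ * w₀ x < ∞) →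
        weakNorm q (fun x => u x * v x ^ q) (fun x => f.1 x * (v x)⁻¹) ≤
          C * weakNorm q (fun x => u x * v x ^ q) (fun x => f.2 x * (v x)⁻¹)) ∧
    (1 ≤ q → ∀ α : ℝ, 0 < α → ∃ ψ : ℝ≥0 → ℝ≥0, Monotone ψ ∧
      ∀ (u : (Fin n → ℝ) → ℝ≥0∞) (h : (Fin n → ℝ) → ℝ) (v : (Fin n → ℝ) → ℝ≥0∞),
        IsHatA2 q u → LocallyIntegrable h volume → (∀ x, v x = maximalReal h x ^ (-α)) →
        ∀ f ∈ F,
        (∃ w₀ : (Fin n → ℝ) → ℝ≥0∞, IsAInfty w₀ ∧ ∫⁻ x, f.1 x ^ p₀ * w₀ x < ∞) →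
        weakNorm q (fun x => u x * v x ^ q) (fun x => f.1 x * (v x)⁻¹) ≤
          ψ (hatA2Const q u).toNNReal *
            weakNorm q (fun x => u x * v x ^ q) (fun x => f.2 x * (v x)⁻¹)) := by
  set F₀ := {f ∈ F | ∃ w₀ : (Fin n → ℝ) → ℝ≥0∞, IsAInfty w₀ ∧ ∫⁻ x, f.1 x ^ p₀ * w₀ x < ∞}
  have hF₀ : ∀ f ∈ F₀, AEMeasurable f.1 volume ∧ AEMeasurable f.2 volume := fun f hf => hF f hf.1
  have hdom (r : ℝ) (hr : 0 < r) : Dominated F₀ r :=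
    (dominated_of_aInfty hφ hyp hF).of_pos hF₀ hp₀ hr
  refine ⟨fun u v hu hv => ?_, fun hq1 α hα => ?_⟩
  · obtain ⟨C, hC⟩ := exists_weakNorm_le_of_isAInfty hn hF₀ hdom hq hu hv
    exact ⟨C, fun f hf hw => hC f ⟨hf, hw⟩⟩
  · obtain ⟨ψ, hψ, hle⟩ := exists_monotone_weakNorm_le_of_isHatA2 hn hF₀ hdom hq1 hα
    exact ⟨ψ, hψ, fun u h v hu hh hv f hf hw => hle u h v hu hh hv f ⟨hf, hw⟩⟩

theorem theorem1p4 {n : ℕ} (hn : 0 < n)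
    (F : Set (((Fin n → ℝ) → ℝ≥0∞) × ((Fin n → ℝ) → ℝ≥0∞)))
    (hF : ∀ f ∈ F, AEMeasurable f.1 volume ∧ AEMeasurable f.2 volume)
    (p₀ : ℝ) (hp₀ : 0 < p₀) (φ : ℝ≥0 → ℝ≥0) (hφ : Monotone φ)
    (hyp : ∀ w : (Fin n → ℝ) → ℝ≥0∞, IsAInfty w → ∀ f ∈ F,
      ∫⁻ x, f.1 x ^ p₀ * w x < ∞ →
      ∫⁻ x, f.1 x ^ p₀ * w x ≤ φ (aInftyConst w).toNNReal * ∫⁻ x, f.2 x ^ p₀ * w x)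
    (q : ℝ) (hq : 1 ≤ q) :
    (∀ u v : (Fin n → ℝ) → ℝ≥0∞, IsAInfty u → IsAInfty (fun x => v x ^ q) →
      ∃ C : ℝ≥0, ∀ f ∈ F,
        (∃ w₀ : (Fin n → ℝ) → ℝ≥0∞, IsAInfty w₀ ∧ ∫⁻ x, f.1 x ^ p₀ * w₀ x < ∞) →
        weakNorm q (fun x => u x * v x ^ q) (fun x => f.1 x * (v x)⁻¹) ≤
          C * weakNorm q (fun x => u x * v x ^ q) (fun x => f.2 x * (v x)⁻¹)) ∧
    (∀ α : ℝ, 0 < α → ∃ ψ : ℝ≥0 → ℝ≥0, Monotone ψ ∧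
      ∀ (u : (Fin n → ℝ) → ℝ≥0∞) (h : (Fin n → ℝ) → ℝ) (v : (Fin n → ℝ) → ℝ≥0∞),
        IsHatA2 q u → LocallyIntegrable h volume → (∀ x, v x = maximalReal h x ^ (-α)) →
        ∀ f ∈ F,
        (∃ w₀ : (Fin n → ℝ) → ℝ≥0∞, IsAInfty w₀ ∧ ∫⁻ x, f.1 x ^ p₀ * w₀ x < ∞) →
        weakNorm q (fun x => u x * v x ^ q) (fun x => f.1 x * (v x)⁻¹) ≤
          ψ (hatA2Const q u).toNNReal *
            weakNorm q (fun x => u x * v x ^ q) (fun x => f.2 x * (v x)⁻¹)) := by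
  have h := theorem1p4_general hn F hF p₀ hp₀ φ hφ hyp q (one_pos.trans_le hq)
  exact ⟨h.1, h.2 hq⟩
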